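/- Work in the language of second-order arithmetic, and let a structure $M$ for it consist of a set $|M|$ with $0,1,+,\cdot,<$ together with a nonempty collection $\mathcal S_M$ of subsets of $|M|$ over which the set variables range; $|M|$ need not be standard. The theory $\mathsf{RCA}_0$ has as axioms the usual basic axioms for $0,1,+,\cdot,<$, the scheme of $\Sigma^0_1$-induction and the scheme of $\Delta^0_1$-comprehension (both with number and set parameters). The following definitions are read inside $M$. A set of numbers is finite if it is bounded and infinite if it is unbounded; $[\mathbb N]^{<\omega}$ is the collection of finite sets of numbers, represented by numerical codes, and a finite set is coded by the least number $(k,(m,n))$, where $(a,b)=(a+b)^2+a$, such that its elements are the $i<k$ for which $m(i+1)+1$ divides $n$. For an infinite set $X$ with increasing enumeration $X(0)<X(1)<\dots$ put $X[n]=\{X(i):i<n\}$; these are precisely the finite initial segments of $X$. A function $f:[\mathbb N]^{<\omega}\to\{0,1\}$ is eventually constant if for each infinite $X\subseteq\mathbb N$ there is an $N$ with $f(X[n])=f(X[N])$ for all $n>N$; then $\overline f(X)$ denotes this eventual value. The cofinite $\Delta^0_2$-Ramsey theorem, $\Delta^0_2\text{-}\mathsf{RT(cof)}$, states: for each eventually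 constant $f:[\mathbb N]^{<\omega}\to\{0,1\}$ there is an infinite set $X\subseteq\mathbb N$ such that $\overline f$ is constant on $\{Y\subseteq X: Y\text{ infinite and }X\setminus Y\text{ finite}\}$. The theory $\mathsf{ATR}_0$ extends $\mathsf{ACA}_0$ (the basic axioms, the induction axiom for sets, and comprehension for all arithmetical formulas with parameters) by the following scheme: for each arithmetical formula $\theta(n,Z)$ (possibly with further number and set parameters) and each set $X$ coding a linear order on $\operatorname{field}(X)=\{i:(i,i)\in X\}$ that has no infinite descending sequence, there is a set $Y$ such that $$Y=\{(n,j): j\in\operatorname{field}(X)\text{ and }\theta(n,Y^j)\},\qquad Y^j=\{(m,i)\in Y: i<_X j\}.$$ **Proposition 3.5.** Over $\mathsf{RCA}_0$, $\Delta^0_2\text{-}\mathsf{RT(cof)}$ entails $\mathsf{ATR}_0$. That is, every structure $M$ for the language of second-order arithmetic that is a model of $\mathsf{RCA}_0$ and satisfies $\Delta^0_2\text{-}\mathsf{RT(cof)}$ is a model of $\mathsf{ATR}_0$. -/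

import Mathlib

universe u

/-- A structure for the language of second order arithmetic: a first order part with
`0, 1, +, ·, <`, and a nonempty collection of subsets of the first order part, over which the
set variables range. The number part may be nonstandard and the set part is arbitrary. -/
structure L2Structure where
  carrier : Type u
  zero : carrier
  one : carrier
  add : carrier → carrier → carrier
  mul : carrier → carrier → carrier
  lt : carrier → carrier → Prop
  sets : Set (Set carrier)
  sets_nonempty : sets.Nonempty

namespace L2Structure

instance : CoeSort L2Structure.{u} (Type u) := ⟨L2Structure.carrier⟩

variable (M : L2Structure.{u})

instance : Zero M := ⟨M.zero⟩
instance : One M := ⟨M.one⟩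
instance : Add M := ⟨M.add⟩
instance : Mul M := ⟨M.mul⟩
instance : LT M := ⟨M.lt⟩

end L2Structure

/-- Numerical terms; `var i` is the `i`-th number variable (de Bruijn index). -/
inductive L2Term : Type
  | var (i : ℕ)
  | zero
  | one
  | add (s t : L2Term)
  | mul (s t : L2Term)

/-- Arithmetical formulas of second order arithmetic (no set quantifiers). `mem t i` says that `t`
belongs to the `i`-th set variable, which is always free. `all`, `ex` and the bounded quantifiers
`ball t`, `bex t` (that is, `∀ x < t` and `∃ x < t`) bind number variable `0` of their body; the
bound `t` is not in the scope of the quantifier. -/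
inductive ArithFormula : Type
  | eq (s t : L2Term)
  | lt (s t : L2Term)
  | mem (t : L2Term) (i : ℕ)
  | neg (φ : ArithFormula)
  | and (φ ψ : ArithFormula)
  | or (φ ψ : ArithFormula)
  | ball (t : L2Term) (φ : ArithFormula)
  | bex (t : L2Term) (φ : ArithFormula)
  | all (φ : ArithFormula)
  | ex (φ : ArithFormula)

namespace ArithFormula

/-- Bounded (`Δ⁰₀`) formulas: every quantifier is bounded. -/
def IsBounded : ArithFormula → Prop
  | eq _ _ => True
  | lt _ _ => True
  | mem _ _ => True
  | neg φ => φ.IsBounded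
  | and φ ψ => φ.IsBounded ∧ ψ.IsBounded
  | or φ ψ => φ.IsBounded ∧ ψ.IsBounded
  | ball _ φ => φ.IsBounded
  | bex _ φ => φ.IsBounded
  | all _ => False
  | ex _ => False

/-- `Σ⁰₁` formulas: one existential number quantifier in front of a bounded formula. -/
def IsSigma01 (φ : ArithFormula) : Prop := ∃ θ : ArithFormula, θ.IsBounded ∧ φ = ex θ

/-- `Π⁰₁` formulas: one universal number quantifier in front of a bounded formula. -/
def IsPi01 (φ : ArithFormula) : Prop := ∃ θ : ArithFormula, θ.IsBounded ∧ φ = all θ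

end ArithFormula

/-- Prepend a value to an assignment: variable `0` gets `a`, variable `i + 1` gets `v i`. -/
def consVal {α : Type u} (a : α) (v : ℕ → α) : ℕ → α
  | 0 => a
  | i + 1 => v i

namespace L2Structure

variable (M : L2Structure.{u})

/-- Value of a term under an assignment of the number variables. -/
def termVal (v : ℕ → M) : L2Term → M
  | .var i => v i
  | .zero => 0
  | .one => 1
  | .add s t => termVal v s + termVal v t
  | .mul s t => termVal v s * termVal v t

/-- Tarskian satisfaction of an arithmetical formula, where `V` assigns values to the set variables
and `v` to the number variables. -/
def Sat (V : ℕ → Set M) : (ℕ → M) → ArithFormula → Prop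
  | v, .eq s t => M.termVal v s = M.termVal v t
  | v, .lt s t => M.termVal v s < M.termVal v t
  | v, .mem t i => M.termVal v t ∈ V i
  | v, .neg φ => ¬ Sat V v φ
  | v, .and φ ψ => Sat V v φ ∧ Sat V v ψ
  | v, .or φ ψ => Sat V v φ ∨ Sat V v ψ
  | v, .ball t φ => ∀ x : M, x < M.termVal v t → Sat V (consVal x v) φ
  | v, .bex t φ => ∃ x : M, x < M.termVal v t ∧ Sat V (consVal x v) φ
  | v, .all φ => ∀ x : M, Sat V (consVal x v) φ
  | v, .ex φ => ∃ x : M, Sat V (consVal x v) φ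

/-- The basic axioms of second order arithmetic. -/
structure BasicAxioms : Prop where
  succ_ne_zero : ∀ n : M, n + 1 ≠ 0
  succ_inj : ∀ m n : M, m + 1 = n + 1 → m = n
  add_zero : ∀ m : M, m + 0 = m
  add_succ : ∀ m n : M, m + (n + 1) = (m + n) + 1
  mul_zero : ∀ m : M, m * 0 = 0
  mul_succ : ∀ m n : M, m * (n + 1) = m * n + m
  not_lt_zero : ∀ m : M, ¬ m < 0
  lt_succ : ∀ m n : M, m < n + 1 ↔ m < n ∨ m = n

/-- The scheme of `Σ⁰₁` induction, with number and set parameters. -/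
def Sigma01Induction : Prop :=
  ∀ φ : ArithFormula, φ.IsSigma01 →
    ∀ V : ℕ → Set M, (∀ i, V i ∈ M.sets) → ∀ v : ℕ → M,
      M.Sat V (consVal 0 v) φ →
      (∀ n : M, M.Sat V (consVal n v) φ → M.Sat V (consVal (n + 1) v) φ) →
      ∀ n : M, M.Sat V (consVal n v) φ

/-- The scheme of `Δ⁰₁` comprehension, with number and set parameters. -/
def Delta01Comprehension : Prop :=
  ∀ φ ψ : ArithFormula, φ.IsSigma01 → ψ.IsPi01 →
    ∀ V : ℕ → Set M, (∀ i, V i ∈ M.sets) → ∀ v : ℕ → M,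
      (∀ n : M, M.Sat V (consVal n v) φ ↔ M.Sat V (consVal n v) ψ) →
      ∃ X ∈ M.sets, ∀ n : M, n ∈ X ↔ M.Sat V (consVal n v) φ

/-- `M` is a model of `RCA₀`. -/
structure RCA0 : Prop where
  basic : M.BasicAxioms
  induction : M.Sigma01Induction
  comprehension : M.Delta01Comprehension

/-- The scheme of arithmetical comprehension, with number and set parameters. -/
def ArithComprehension : Prop :=
  ∀ φ : ArithFormula, ∀ V : ℕ → Set M, (∀ i, V i ∈ M.sets) → ∀ v : ℕ → M,
    ∃ X ∈ M.sets, ∀ n : M, n ∈ X ↔ M.Sat V (consVal n v) φ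

/-- `M` is a model of `ACA₀`. -/
structure ACA0 : Prop where
  basic : M.BasicAxioms
  induction : ∀ X ∈ M.sets, (0 : M) ∈ X → (∀ n : M, n ∈ X → n + 1 ∈ X) → ∀ n : M, n ∈ X
  comprehension : M.ArithComprehension

variable {M}

/-- The pairing function `(a, b) = (a + b)² + a`. -/
def pair (a b : M) : M := (a + b) * (a + b) + a

/-- `F` is (the graph of) a function from `A` to `B`. -/
def IsFun (F A B : Set M) : Prop :=
  (∀ p ∈ F, ∃ a ∈ A, ∃ b ∈ B, p = pair a b) ∧ ∀ a ∈ A, ∃! b, pair a b ∈ F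

/-- `c` has the form `(k, (m, n))`; such a number describes the finite set of all `i < k` such that
`m(i + 1) + 1` divides `n`. -/
def IsTriple (c : M) : Prop := ∃ k m n : M, c = pair k (pair m n)

/-- `i` belongs to the finite set described by `c`. -/
def FinMem (i c : M) : Prop :=
  ∃ k m n : M, c = pair k (pair m n) ∧ i < k ∧ ∃ q : M, n = q * (m * (i + 1) + 1)

variable (M) in
/-- The collection `[ℕ]^{<ω}` of (codes of) finite sets of numbers: each finite set is represented
by its smallest description, so that distinct codes represent distinct finite sets. -/
def finCodes : Set M :=
  {c | IsTriple c ∧ ∀ c' : M, c' < c → IsTriple c' → ¬ ∀ i : M, FinMem i c' ↔ FinMem i c}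

/-- `X` is unbounded. -/
def IsInfinite (X : Set M) : Prop := ∀ b : M, ∃ x ∈ X, b < x

/-- `X` is bounded. -/
def IsFinite (X : Set M) : Prop := ∃ b : M, ∀ x ∈ X, x < b

/-- `s` is one of the finite initial segments `X[n]` of `X`, for some `n`. -/
def IsInitialSegment (s : M) (X : Set M) : Prop :=
  s ∈ M.finCodes ∧ (∀ i, FinMem i s → i ∈ X) ∧
    ∀ i ∈ X, ∀ j, FinMem j s → i < j → FinMem i s

/-- For the graph `F` of a function `f` on `[ℕ]^{<ω}`: the value `f(X[n])` is `q` for all large `n`,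
that is, `f` has value `q` on all finite initial segments of `X` that extend a certain one. For
eventually constant `f` this is the relation `f̄(X) = q`. -/
def LimitValue (F X : Set M) (q : M) : Prop :=
  ∃ s₀, IsInitialSegment s₀ X ∧
    ∀ s, IsInitialSegment s X → (∀ i, FinMem i s₀ → FinMem i s) → pair s q ∈ F

/-- The function on `[ℕ]^{<ω}` with graph `F` is eventually constant (in the sense of `M`). -/
def EventuallyConstant (F : Set M) : Prop :=
  ∀ X ∈ M.sets, IsInfinite X → ∃ q : M, LimitValue F X q

variable (M) in
/-- The cofinite `Δ⁰₂`-Ramsey theorem holds in `M`: for each eventually constant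
`f : [ℕ]^{<ω} → {0,1}` there is an infinite `X` such that `f̄` is constant on the collection of
infinite `Y ⊆ X` for which `X \ Y` is finite. -/
def CofiniteDelta02RT : Prop :=
  ∀ F ∈ M.sets, IsFun F M.finCodes {0, 1} → EventuallyConstant F →
    ∃ X ∈ M.sets, IsInfinite X ∧ ∃ q ∈ ({0, 1} : Set M),
      ∀ Y ∈ M.sets, IsInfinite Y → Y ⊆ X → IsFinite (X \ Y) → LimitValue F Y q

/-- The field of a reflexive relation coded by `X`. -/
def field (X : Set M) : Set M := {i | pair i i ∈ X}

/-- `i <_X j` for the relation coded by `X`. -/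
def relLt (X : Set M) (i j : M) : Prop := pair i j ∈ X ∧ pair j i ∉ X

/-- `X` codes a linear order (on its field). -/
structure IsLinOrd (X : Set M) : Prop where
  refl : ∀ i j : M, pair i j ∈ X → i ∈ field X ∧ j ∈ field X
  trans : ∀ i j k : M, pair i j ∈ X → pair j k ∈ X → pair i k ∈ X
  antisymm : ∀ i j : M, pair i j ∈ X → pair j i ∈ X → i = j
  total : ∀ i ∈ field X, ∀ j ∈ field X, pair i j ∈ X ∨ pair j i ∈ X

/-- `X` codes a well order in the sense of `M`: a linear order without infinite descending
sequence in `M`. -/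
def IsWellOrd (X : Set M) : Prop :=
  IsLinOrd X ∧ ¬ ∃ F ∈ M.sets, IsFun F Set.univ (field X) ∧
    ∀ n a b : M, pair n a ∈ F → pair (n + 1) b ∈ F → relLt X b a

/-- `Y^j = {(m, i) ∈ Y : i <_X j}`. -/
def below (X Y : Set M) (j : M) : Set M :=
  {p | ∃ m i : M, p = pair m i ∧ relLt X i j ∧ p ∈ Y}

variable (M) in
/-- The scheme of arithmetical transfinite recursion: for each arithmetical formula `θ(n, Z)` with
number and set parameters and each well order `X` there is a set `Y` with
`Y = {(n, j) : j ∈ field(X) and θ(n, Y^j)}`. -/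
def ArithTransfiniteRecursion : Prop :=
  ∀ θ : ArithFormula, ∀ V : ℕ → Set M, (∀ i, V i ∈ M.sets) → ∀ v : ℕ → M,
    ∀ X ∈ M.sets, IsWellOrd X →
      ∃ Y ∈ M.sets, ∀ p : M, p ∈ Y ↔
        ∃ n j : M, p = pair n j ∧ j ∈ field X ∧
          M.Sat (consVal (below X Y j) V) (consVal n v) θ

variable (M) in
/-- `M` is a model of `ATR₀`. -/
structure ATR0 : Prop where
  aca0 : M.ACA0
  recursion : M.ArithTransfiniteRecursion

end L2Structure

/-! The Ramsey theorem is applied twice, in the same way. A colour read off `X` is fixed by a finite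
initial segment of `X`. If `X` is homogeneous and `x < y` are in `X`, then `cut X x y = {x} ∪ (X ∩
[y, ∞))` has the same colour, so the colour yields a statement about all pairs `x < y` in `X`.

Arithmetical comprehension (`proj_mem`): for a Σ⁰₁ set, colour a set with first elements `x < y < z`
by whether no `n < x` is enumerated between stages `y` and `z`. Strong Σ⁰₁ bounding excludes the
negative colour. For the positive colour, `n < x < y` in `X` implies that `n` is enumerated before
`y` or never, so the Σ⁰₁ set is Δ⁰₁ in `X`.

Transfinite recursion is reduced to solving a well founded condition `p ∈ D ↔ base p ∨ ∃ q, (pos q p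
∧ q ∈ D) ∨ (neg q p ∧ q ∉ D)`. Along an infinite `X`, the value of `p` at stage `x` is obtained by
admitting only witnesses `q < x` and reading their values at the next stage. By well-foundedness
this value is the limit of computations along initial segments of `X`. If every `p` is eventually
constant along `X`, the eventual values solve the condition. To force this, call a set starting with
`x < y` good if no `p < x` changes its value from `y` to the following stage, or if those changes
are undercut (some `q < y` that precedes all these `p` changes one stage later) and the set without
`x` is not good. Undercutting descends in the precedence relation, so this colour is also fixed by
an initial segment.

On a good homogeneous set the second alternative is impossible, so no `p < x` changes at any `y >
x`, and `Recursion.exists_solution` follows. In the other case (`Recursion.not_all_chg`) changes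
always occur and are never undercut. Fix `x` and a minimal `p < x` that changes infinitely often. If
`p` drops from true to false, a preceding `q` changes at the next stage. As this is no undercutting,
some `r < x` not preceded by `q` changes together with `p`; precedence is a weak order, so `r`
precedes `p`, which far enough out contradicts minimality. Thus `p` eventually only rises and cannot
keep changing.

Finally, an arithmetical `θ(n, Z)` is an iterated `∃ ¬` over a literal about `Z` (`HasNorm.sat`),
and evaluating it along a well order is such a recursive condition (`IsNorm.exists_hierarchy`). That
well orders have minimal elements for definable sets needs iteration of functions, another instance
of `Recursion.exists_solution`. -/

namespace L2Structure

/-! ### Arithmetic in `RCA₀`: the numbers form an ordered semiring -/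

variable {M : L2Structure.{u}}

/-- `M` is a model of `RCA₀`, as an instance argument. -/
class IsRCA (M : L2Structure.{u}) : Prop where
  rca : M.RCA0

@[simp] theorem consVal_zero {α : Type u} (a : α) (v : ℕ → α) : consVal a v 0 = a := rfl

@[simp] theorem consVal_succ {α : Type u} (a : α) (v : ℕ → α) (i : ℕ) :
    consVal a v (i + 1) = v i := rfl

@[simp] theorem consVal_one {α : Type u} (a : α) (v : ℕ → α) : consVal a v 1 = v 0 := rfl

/-- Induction for predicates defined by a formula of the form `∃ x, θ` with `θ` bounded. -/
theorem sigma_induction [h : IsRCA M] (θ : ArithFormula) (hθ : θ.IsBounded) (V : ℕ → Set M)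
    (hV : ∀ i, V i ∈ M.sets) (v : ℕ → M) (P : M → Prop)
    (hP : ∀ n, P n ↔ ∃ d, M.Sat V (consVal d (consVal n v)) θ)
    (h0 : P 0) (hs : ∀ n, P n → P (n + 1)) (n : M) : P n := by
  have := h.rca.induction (.ex θ) ⟨θ, hθ, rfl⟩ V hV v
  simp only [Sat, ← hP] at this
  exact this h0 hs n

/-- Induction for equations between terms. -/
theorem eq_induction [IsRCA M] (s t : L2Term) (v : ℕ → M) (P : M → Prop)
    (hP : ∀ n, P n ↔ M.termVal (consVal 0 (consVal n v)) s = M.termVal (consVal 0 (consVal n v)) t)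
    (hs' : ∀ d w, M.termVal (consVal d w) s = M.termVal (consVal 0 w) s)
    (ht' : ∀ d w, M.termVal (consVal d w) t = M.termVal (consVal 0 w) t)
    (h0 : P 0) (hs : ∀ n, P n → P (n + 1)) (n : M) : P n := by
  obtain ⟨S, hS⟩ := M.sets_nonempty
  -- The equation does not involve variable `0`, so the existential quantifier in front of it is
  -- vacuous.
  refine sigma_induction (.eq s t) trivial (fun _ => S) (fun _ => hS) v P (fun n => ?_) h0 hs n
  simp only [Sat, hs', ht', hP n, exists_const_iff]
  exact ⟨fun h => ⟨⟨0⟩, h⟩, fun h => h.2⟩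

open L2Term in
theorem zero_add_aux [h : IsRCA M] (n : M) : 0 + n = n := by
  -- Variable `0` is the dummy witness and `1` the induction variable; parameters start at `2`.
  refine eq_induction (.add .zero (var 1)) (var 1) (fun _ => 0) (fun n => 0 + n = n)
    (fun n => by simp [termVal]) (by simp [termVal]) (by simp [termVal]) (h.rca.basic.add_zero _) ?_ n
  intro n hn
  rw [h.rca.basic.add_succ, hn]

open L2Term in
theorem succ_add_aux [h : IsRCA M] (m n : M) : (m + 1) + n = (m + n) + 1 := by
  refine eq_induction (.add (.add (var 2) .one) (var 1)) (.add (.add (var 2) (var 1)) .one)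
    (fun _ => m) (fun n => (m + 1) + n = (m + n) + 1)
    (fun n => by simp [termVal]) (by simp [termVal]) (by simp [termVal]) ?_ ?_ n
  · rw [h.rca.basic.add_zero, h.rca.basic.add_zero]
  · intro n hn
    rw [h.rca.basic.add_succ, hn, h.rca.basic.add_succ]

open L2Term in
theorem add_comm_aux [h : IsRCA M] (m n : M) : m + n = n + m := by
  refine eq_induction (.add (var 2) (var 1)) (.add (var 1) (var 2))
    (fun _ => m) (fun n => m + n = n + m)
    (fun n => by simp [termVal]) (by simp [termVal]) (by simp [termVal]) ?_ ?_ n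
  · rw [h.rca.basic.add_zero, zero_add_aux]
  · intro n hn
    rw [h.rca.basic.add_succ, hn, succ_add_aux]

open L2Term in
theorem add_assoc_aux [h : IsRCA M] (a b c : M) : a + b + c = a + (b + c) := by
  refine eq_induction (.add (.add (var 2) (var 3)) (var 1)) (.add (var 2) (.add (var 3) (var 1)))
    (consVal a (fun _ => b)) (fun c => a + b + c = a + (b + c))
    (fun n => by simp [termVal, consVal]) (by simp [termVal, consVal]) (by simp [termVal, consVal])
      ?_ ?_ c
  · rw [h.rca.basic.add_zero, h.rca.basic.add_zero]
  · intro n hn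
    simp only [h.rca.basic.add_succ, hn]

open L2Term in
theorem zero_mul_aux [h : IsRCA M] (n : M) : 0 * n = 0 := by
  refine eq_induction (.mul .zero (var 1)) .zero (fun _ => 0) (fun n => 0 * n = 0)
    (fun n => by simp [termVal]) (by simp [termVal]) (by simp [termVal]) (h.rca.basic.mul_zero _) ?_ n
  intro n hn
  rw [h.rca.basic.mul_succ, hn, h.rca.basic.add_zero]

open L2Term in
theorem succ_mul_aux [h : IsRCA M] (m n : M) : (m + 1) * n = m * n + n := by
  refine eq_induction (.mul (.add (var 2) .one) (var 1)) (.add (.mul (var 2) (var 1)) (var 1))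
    (fun _ => m) (fun n => (m + 1) * n = m * n + n)
    (fun n => by simp [termVal]) (by simp [termVal]) (by simp [termVal]) ?_ ?_ n
  · rw [h.rca.basic.mul_zero, h.rca.basic.mul_zero, h.rca.basic.add_zero]
  · intro n hn
    rw [h.rca.basic.mul_succ, hn, h.rca.basic.mul_succ, add_assoc_aux, add_assoc_aux,
      ← add_assoc_aux m n 1, add_comm_aux m n, add_assoc_aux n m 1]

open L2Term in
theorem mul_comm_aux [h : IsRCA M] (m n : M) : m * n = n * m := by
  refine eq_induction (.mul (var 2) (var 1)) (.mul (var 1) (var 2))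
    (fun _ => m) (fun n => m * n = n * m)
    (fun n => by simp [termVal]) (by simp [termVal]) (by simp [termVal]) ?_ ?_ n
  · rw [h.rca.basic.mul_zero, zero_mul_aux]
  · intro n hn
    rw [h.rca.basic.mul_succ, hn, succ_mul_aux]

open L2Term in
theorem mul_add_aux [h : IsRCA M] (a b c : M) : a * (b + c) = a * b + a * c := by
  refine eq_induction (.mul (var 2) (.add (var 3) (var 1)))
    (.add (.mul (var 2) (var 3)) (.mul (var 2) (var 1)))
    (consVal a (fun _ => b)) (fun c => a * (b + c) = a * b + a * c)
    (fun n => by simp [termVal, consVal]) (by simp [termVal, consVal]) (by simp [termVal, consVal])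
      ?_ ?_ c
  · rw [h.rca.basic.mul_zero, h.rca.basic.add_zero, h.rca.basic.add_zero]
  · intro n hn
    rw [h.rca.basic.add_succ, h.rca.basic.mul_succ, h.rca.basic.mul_succ, hn, add_assoc_aux]

open L2Term in
theorem mul_assoc_aux [h : IsRCA M] (a b c : M) : a * b * c = a * (b * c) := by
  refine eq_induction (.mul (.mul (var 2) (var 3)) (var 1)) (.mul (var 2) (.mul (var 3) (var 1)))
    (consVal a (fun _ => b)) (fun c => a * b * c = a * (b * c))
    (fun n => by simp [termVal, consVal]) (by simp [termVal, consVal]) (by simp [termVal, consVal])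
      ?_ ?_ c
  · simp only [h.rca.basic.mul_zero]
  · intro n hn
    rw [h.rca.basic.mul_succ, h.rca.basic.mul_succ, hn, mul_add_aux]

instance instCommSemiring [h : IsRCA M] : CommSemiring M where
  add := (· + ·)
  zero := 0
  one := 1
  mul := (· * ·)
  add_assoc := add_assoc_aux
  zero_add := zero_add_aux
  add_zero := h.rca.basic.add_zero
  add_comm := add_comm_aux
  mul_assoc := mul_assoc_aux
  mul_comm := mul_comm_aux
  zero_mul := zero_mul_aux
  mul_zero := h.rca.basic.mul_zero
  left_distrib := mul_add_aux
  right_distrib a b c := by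
    rw [mul_comm_aux, mul_add_aux, mul_comm_aux c, mul_comm_aux c]
  one_mul n := by
    have : (0 + 1 : M) * n = 0 * n + n := succ_mul_aux 0 n
    rwa [zero_add_aux, zero_mul_aux, zero_add_aux] at this
  mul_one n := by
    have := h.rca.basic.mul_succ n 0
    rwa [zero_add_aux, h.rca.basic.mul_zero, zero_add_aux] at this
  nsmul := nsmulRec
  npow := npowRec

theorem zero_or_succ [h : IsRCA M] (n : M) : n = 0 ∨ ∃ k, n = k + 1 := by
  obtain ⟨S, hS⟩ := M.sets_nonempty
  refine sigma_induction (.or (.eq (.var 1) .zero) (.eq (.var 1) (.add (.var 0) .one))) ⟨trivial, trivial⟩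
    (fun _ => S) (fun _ => hS) (fun _ => 0) (fun n => n = 0 ∨ ∃ k, n = k + 1) (fun n => ?_)
    (.inl rfl) (fun n _ => .inr ⟨n, rfl⟩) n
  have : Nonempty M := ⟨0⟩
  simp [Sat, termVal, exists_or]

theorem add_right_cancel_aux [h : IsRCA M] (a b c : M) (hc : a + c = b + c) : a = b := by
  obtain ⟨S, hS⟩ := M.sets_nonempty
  refine sigma_induction (.or (.neg (.eq (.add (.var 2) (.var 1)) (.add (.var 3) (.var 1))))
    (.eq (.var 2) (.var 3))) ⟨trivial, trivial⟩
    (fun _ => S) (fun _ => hS) (consVal a fun _ => b) (fun c => a + c = b + c → a = b) (fun n => ?_)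
    (by simp) (fun n ih hn => ih ?_) c hc
  · simp [Sat, termVal, consVal, imp_iff_not_or]
  · rw [← add_assoc, ← add_assoc] at hn
    exact h.rca.basic.succ_inj _ _ hn

theorem lt_add_succ_aux [h : IsRCA M] (a k : M) : a < a + (k + 1) := by
  obtain ⟨S, hS⟩ := M.sets_nonempty
  refine sigma_induction (.lt (.var 2) (.add (.var 2) (.add (.var 1) .one))) trivial
    (fun _ => S) (fun _ => hS) (fun _ => a) (fun k => a < a + (k + 1)) (fun n => ?_)
    ?_ (fun n ih => ?_) k
  · simp [Sat, termVal, consVal]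
  · rw [zero_add, h.rca.basic.lt_succ]; simp
  · rw [← add_assoc, h.rca.basic.lt_succ]; exact .inl ih

/-- Reduces the primitive `<` to addition, so that order properties become semiring identities. -/
theorem lt_iff_exists_aux [h : IsRCA M] (a b : M) : a < b ↔ ∃ k, b = a + (k + 1) := by
  constructor
  · obtain ⟨S, hS⟩ := M.sets_nonempty
    refine sigma_induction (.or (.neg (.lt (.var 2) (.var 1))) (.eq (.var 1) (.add (.var 2)
      (.add (.var 0) .one)))) ⟨trivial, trivial⟩
      (fun _ => S) (fun _ => hS) (fun _ => a) (fun b => a < b → ∃ k, b = a + (k + 1)) (fun n => ?_)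
      ?_ (fun n ih hn => ?_) b
    · simp [Sat, termVal, consVal, imp_iff_not_or, exists_or]
    · exact fun h0 => (h.rca.basic.not_lt_zero _ h0).elim
    · rcases (h.rca.basic.lt_succ _ _).1 hn with h1 | rfl
      · obtain ⟨k, hk⟩ := ih h1
        exact ⟨k + 1, by rw [hk]; ring⟩
      · exact ⟨0, by ring⟩
  · rintro ⟨k, rfl⟩
    exact lt_add_succ_aux a k

theorem trichotomy_aux [h : IsRCA M] (a b : M) : a < b ∨ a = b ∨ b < a := by
  obtain ⟨S, hS⟩ := M.sets_nonempty
  refine sigma_induction (.or (.lt (.var 2) (.var 1)) (.or (.eq (.var 2) (.var 1))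
    (.lt (.var 1) (.var 2)))) ⟨trivial, trivial, trivial⟩
    (fun _ => S) (fun _ => hS) (fun _ => a) (fun b => a < b ∨ a = b ∨ b < a) (fun n => ?_)
    ?_ (fun n ih => ?_) b
  · simp [Sat, termVal, consVal]
  · rcases zero_or_succ a with rfl | ⟨k, rfl⟩
    · simp
    · right; right; rw [lt_iff_exists_aux]; exact ⟨k, by ring⟩
  · rcases ih with h1 | rfl | h1
    · exact .inl ((h.rca.basic.lt_succ _ _).2 (.inl h1))
    · exact .inl ((h.rca.basic.lt_succ _ _).2 (.inr rfl))
    · obtain ⟨k, rfl⟩ := (lt_iff_exists_aux _ _).1 h1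
      rcases zero_or_succ k with rfl | ⟨k, rfl⟩
      · simp
      · right; right; rw [lt_iff_exists_aux]; exact ⟨k, by ring⟩

theorem lt_irrefl_aux [h : IsRCA M] (a : M) : ¬ a < a := by
  rw [lt_iff_exists_aux]
  rintro ⟨k, hk⟩
  refine h.rca.basic.succ_ne_zero k (add_right_cancel_aux _ _ a ?_)
  rw [zero_add, add_comm]; exact hk.symm

theorem lt_trans_aux [h : IsRCA M] (a b c : M) (h1 : a < b) (h2 : b < c) : a < c := by
  rw [lt_iff_exists_aux] at *
  obtain ⟨k, rfl⟩ := h1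
  obtain ⟨l, rfl⟩ := h2
  exact ⟨k + l + 1, by ring⟩

noncomputable instance instLinearOrder [h : IsRCA M] : LinearOrder M where
  le a b := a < b ∨ a = b
  lt a b := a < b
  le_refl a := .inr rfl
  le_trans a b c := by
    rintro (h1 | rfl) (h2 | rfl)
    exacts [.inl (lt_trans_aux _ _ _ h1 h2), .inl h1, .inl h2, .inr rfl]
  le_antisymm a b := by
    rintro (h1 | rfl) (h2 | h2)
    exacts [(lt_irrefl_aux _ (lt_trans_aux _ _ _ h1 h2)).elim, h2.symm, rfl, rfl]
  lt_iff_le_not_ge a b := by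
    constructor
    · intro h1
      refine ⟨.inl h1, ?_⟩
      rintro (h2 | rfl)
      exacts [lt_irrefl_aux _ (lt_trans_aux _ _ _ h1 h2), lt_irrefl_aux _ h1]
    · rintro ⟨h1 | rfl, h2⟩
      exacts [h1, (h2 (.inr rfl)).elim]
  le_total a b := by
    rcases trichotomy_aux a b with h1 | h1 | h1
    exacts [.inl (.inl h1), .inl (.inr h1), .inr (.inl h1)]
  toDecidableLE := Classical.decRel _

theorem le_iff_exists_aux [h : IsRCA M] (a b : M) : a ≤ b ↔ ∃ k, b = a + k := by
  rw [le_iff_lt_or_eq, lt_iff_exists_aux]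
  constructor
  · rintro (⟨k, hk⟩ | rfl)
    exacts [⟨k + 1, hk⟩, ⟨0, by simp⟩]
  · rintro ⟨k, rfl⟩
    rcases zero_or_succ k with rfl | ⟨k, rfl⟩
    · simp
    · exact .inl ⟨k, rfl⟩

instance instIsOrderedCancelAddMonoid [h : IsRCA M] : IsOrderedCancelAddMonoid M where
  add_le_add_left a b hab c := by
    obtain ⟨k, rfl⟩ := (le_iff_exists_aux _ _).1 hab
    exact (le_iff_exists_aux _ _).2 ⟨k, by ring⟩
  le_of_add_le_add_left a b c hbc := by
    obtain ⟨k, hk⟩ := (le_iff_exists_aux _ _).1 hbc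
    refine (le_iff_exists_aux _ _).2 ⟨k, add_right_cancel_aux _ _ a ?_⟩
    rw [add_comm c, hk]; ring

instance instCanonicallyOrderedAdd [h : IsRCA M] : CanonicallyOrderedAdd M where
  exists_add_of_le {a b} hab := (le_iff_exists_aux _ _).1 hab
  le_add_self _ b := (le_iff_exists_aux _ _).2 ⟨b, by ring⟩
  le_self_add _ b := (le_iff_exists_aux _ _).2 ⟨b, rfl⟩

instance instNontrivial [h : IsRCA M] : Nontrivial M :=
  ⟨0, 1, fun h0 => h.rca.basic.succ_ne_zero 0 (by rw [zero_add]; exact h0.symm)⟩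

theorem lt_add_one_iff' [h : IsRCA M] {a b : M} : a < b + 1 ↔ a ≤ b := by
  rw [le_iff_lt_or_eq]; exact h.rca.basic.lt_succ a b

theorem add_one_le_iff' [h : IsRCA M] {a b : M} : a + 1 ≤ b ↔ a < b := by
  rw [← not_lt, lt_add_one_iff', not_le]

noncomputable instance instSuccAddOrder [h : IsRCA M] : SuccAddOrder M where
  succ a := a + 1
  le_succ _ := le_self_add
  max_of_succ_le ha := (lt_irrefl _ (add_one_le_iff'.1 ha)).elim
  succ_le_of_lt h := add_one_le_iff'.2 h
  succ_eq_add_one _ := rfl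

instance instNoMaxOrder [h : IsRCA M] : NoMaxOrder M :=
  ⟨fun a => ⟨a + 1, lt_add_one_iff'.2 le_rfl⟩⟩

theorem mul_succ_cancel_aux [h : IsRCA M] (a b c : M) (hab : a < b) : a * (c + 1) < b * (c + 1) := by
  obtain ⟨k, rfl⟩ := (lt_iff_exists_aux _ _).1 hab
  exact (lt_iff_exists_aux _ _).2 ⟨k * (c + 1) + c, by ring⟩

instance instIsStrictOrderedRing [h : IsRCA M] : IsStrictOrderedRing M where
  zero_le_one := zero_le
  le_of_add_le_add_left := fun a b c => le_of_add_le_add_left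
  mul_lt_mul_of_pos_left a ha b c hbc := by
    rcases zero_or_succ a with rfl | ⟨a, rfl⟩
    · exact (lt_irrefl _ ha).elim
    · rw [mul_comm _ b, mul_comm _ c]; exact mul_succ_cancel_aux _ _ _ hbc
  mul_lt_mul_of_pos_right a ha b c hbc := by
    rcases zero_or_succ a with rfl | ⟨a, rfl⟩
    · exact (lt_irrefl _ ha).elim
    · exact mul_succ_cancel_aux _ _ _ hbc

theorem left_le_pair [h : IsRCA M] (a b : M) : a ≤ pair a b := by
  unfold pair; exact le_add_self

theorem right_le_pair [h : IsRCA M] (a b : M) : b ≤ pair a b := by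
  unfold pair
  rcases zero_or_succ b with rfl | ⟨b, rfl⟩
  · exact zero_le
  · exact (le_iff_exists_aux _ _).2 ⟨a * a + 2 * a * b + 2 * a + b * b + b + a, by ring⟩

theorem pair_inj [h : IsRCA M] {a b c d : M} : pair a b = pair c d ↔ a = c ∧ b = d := by
  constructor
  · intro he
    -- `(a + b)² ≤ pair a b < (a + b + 1)²`, so pairs with different sums lie in disjoint intervals.
    have key : ∀ a b c d : M, a + b < c + d → pair a b < pair c d := by
      intro a b c d hl
      obtain ⟨k, hk⟩ := (lt_iff_exists_aux _ _).1 hl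
      unfold pair
      rw [hk]
      exact (lt_iff_exists_aux _ _).2
        ⟨a + b + b + (a + b) * k + k * (a + b) + k * k + k + k + c, by ring⟩
    have hs : a + b = c + d := by
      rcases lt_trichotomy (a + b) (c + d) with h1 | h1 | h1
      · exact absurd he (key _ _ _ _ h1).ne
      · exact h1
      · exact absurd he (key _ _ _ _ h1).ne'
    have hac : a = c := by
      unfold pair at he
      rw [hs] at he
      exact add_left_cancel he
    refine ⟨hac, ?_⟩
    rw [hac] at hs
    exact add_left_cancel hs
  · rintro ⟨rfl, rfl⟩; rfl

end L2Structure

/-! ### Closure properties of Δ⁰₁ comprehension -/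

namespace L2Structure

variable {M : L2Structure.{u}}

open Classical in
/-- First component of a pair (junk value `0` on numbers that are not pairs). -/
noncomputable def fst (c : M) : M := if h : ∃ a b, c = pair a b then h.choose else 0

open Classical in
/-- Second component of a pair (junk value `0` on numbers that are not pairs). -/
noncomputable def snd (c : M) : M :=
  if h : ∃ a b, c = pair a b then h.choose_spec.choose else 0

theorem pair_fst_snd_of_eq {a b c : M} (h : c = pair a b) : c = pair (fst c) (snd c) := by
  have h' : ∃ a b, c = pair a b := ⟨a, b, h⟩
  rw [fst, snd, dif_pos h', dif_pos h']
  exact h'.choose_spec.choose_spec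

@[simp] theorem fst_pair [IsRCA M] (a b : M) : fst (pair a b) = a :=
  (pair_inj.1 (pair_fst_snd_of_eq (c := pair a b) rfl)).1.symm

@[simp] theorem snd_pair [IsRCA M] (a b : M) : snd (pair a b) = b :=
  (pair_inj.1 (pair_fst_snd_of_eq (c := pair a b) rfl)).2.symm

theorem fst_of_not_pair {c : M} (h : ¬ ∃ a b, c = pair a b) : fst c = 0 := dif_neg h

theorem snd_of_not_pair {c : M} (h : ¬ ∃ a b, c = pair a b) : snd c = 0 := dif_neg h

/-- The set defined by `P` belongs to the second order part. -/
class Def (P : M → Prop) : Prop where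
  mem : {c | P c} ∈ M.sets

/-- The graph of `f` belongs to the second order part. -/
class DFun (f : M → M) : Prop where
  mem : {e | ∃ a b, e = pair a b ∧ a = f b} ∈ M.sets

/-- `S` belongs to the second order part. -/
class InM (S : Set M) : Prop where
  mem : S ∈ M.sets

theorem Def.inM {P : M → Prop} (h : Def P) : InM {c | P c} := ⟨h.mem⟩

instance instInMSetOf {P : M → Prop} [h : Def P] : InM {c | P c} := ⟨h.mem⟩

/-- Pairing as an operation on terms. -/
def pairT (s t : L2Term) : L2Term := .add (.mul (.add s t) (.add s t)) s

@[simp] theorem termVal_pairT (v : ℕ → M) (s t : L2Term) :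
    M.termVal v (pairT s t) = pair (M.termVal v s) (M.termVal v t) := rfl

theorem delta_comprehension [h : IsRCA M] (θ η : ArithFormula) (hθ : θ.IsBounded)
    (hη : η.IsBounded) (V : ℕ → Set M) (hV : ∀ i, V i ∈ M.sets) (v : ℕ → M) (P : M → Prop)
    (h1 : ∀ n, P n ↔ ∃ d, M.Sat V (consVal d (consVal n v)) θ)
    (h2 : ∀ n, P n ↔ ∀ d, M.Sat V (consVal d (consVal n v)) η) : Def P := by
  obtain ⟨X, hX, hX'⟩ := h.rca.comprehension (.ex θ) (.all η) ⟨θ, hθ, rfl⟩ ⟨η, hη, rfl⟩ V hV v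
    (fun n => (h1 n).symm.trans (h2 n))
  refine ⟨?_⟩
  convert hX
  ext n
  rw [hX' n]
  exact h1 n

theorem bounded_comprehension [h : IsRCA M] (θ : ArithFormula) (hθ : θ.IsBounded)
    (V : ℕ → Set M) (hV : ∀ i, V i ∈ M.sets) (v : ℕ → M) (P : M → Prop)
    (h1 : ∀ n d, M.Sat V (consVal d (consVal n v)) θ ↔ P n) : Def P := by
  refine delta_comprehension θ θ hθ hθ V hV v P (fun n => ?_) (fun n => ?_)
  · simp only [h1]; exact ⟨fun h => ⟨0, h⟩, fun ⟨_, h⟩ => h⟩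
  · simp only [h1]; exact ⟨fun h _ => h, fun h => h 0⟩

/-- The components of a pair are bounded by it, so decomposing `e` costs only bounded quantifiers.
They are existential in the Σ⁰₁ form and, once `e` is known to be a pair, universal in the Π⁰₁ form.
Variables `0` to `3` are `b`, `a`, the witness `d` and `e`. -/
theorem delta_comprehension_pair [h : IsRCA M] (θ η : ArithFormula) (hθ : θ.IsBounded)
    (hη : η.IsBounded) (V : ℕ → Set M) (hV : ∀ i, V i ∈ M.sets) (v : ℕ → M) (Q : M → M → Prop)
    (h1 : ∀ a b e, Q a b ↔ ∃ d, M.Sat V (consVal b (consVal a (consVal d (consVal e v)))) θ)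
    (h2 : ∀ a b e, Q a b ↔ ∀ d, M.Sat V (consVal b (consVal a (consVal d (consVal e v)))) η) :
    Def (fun e : M => ∃ a b, e = pair a b ∧ Q a b) := by
  have hlt : ∀ {e a b : M}, e = pair a b → a < e + 1 ∧ b < e + 1 := by
    rintro _ a b rfl
    exact ⟨lt_add_one_iff'.2 (left_le_pair _ _), lt_add_one_iff'.2 (right_le_pair _ _)⟩
  refine delta_comprehension
    (.bex (.add (.var 1) .one) (.bex (.add (.var 2) .one)
      (.and (.eq (.var 3) (pairT (.var 1) (.var 0))) θ)))
    (.and (.bex (.add (.var 1) .one) (.bex (.add (.var 2) .one)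
      (.eq (.var 3) (pairT (.var 1) (.var 0)))))
      (.ball (.add (.var 1) .one) (.ball (.add (.var 2) .one)
      (.or (.neg (.eq (.var 3) (pairT (.var 1) (.var 0)))) η))))
    ⟨trivial, hθ⟩ ⟨trivial, trivial, hη⟩ V hV v _ (fun e => ?_) (fun e => ?_)
  · simp only [Sat, termVal, termVal_pairT, consVal]
    constructor
    · rintro ⟨a, b, he, hQ⟩
      obtain ⟨d, hd⟩ := (h1 a b e).1 hQ
      exact ⟨d, a, (hlt he).1, b, (hlt he).2, he, hd⟩
    · rintro ⟨d, a, _, b, _, he, hd⟩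
      exact ⟨a, b, he, (h1 a b e).2 ⟨d, hd⟩⟩
  · simp only [Sat, termVal, termVal_pairT, consVal]
    constructor
    · rintro ⟨a, b, he, hQ⟩ d
      refine ⟨⟨a, (hlt he).1, b, (hlt he).2, he⟩, ?_⟩
      intro a' _ b' _
      by_cases he' : e = pair a' b'
      · right
        obtain ⟨rfl, rfl⟩ := pair_inj.1 (he.symm.trans he')
        exact (h2 a b e).1 hQ d
      · exact .inl he'
    · intro H
      obtain ⟨⟨a, ha, b, hb, he⟩, -⟩ := H 0
      refine ⟨a, b, he, (h2 a b e).2 fun d => ?_⟩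
      exact ((H d).2 a ha b hb).resolve_left (fun hn => hn he)

theorem bounded_comprehension_pair [h : IsRCA M] (θ : ArithFormula) (hθ : θ.IsBounded)
    (V : ℕ → Set M) (hV : ∀ i, V i ∈ M.sets) (v : ℕ → M) (Q : M → M → Prop)
    (h1 : ∀ a b e d, M.Sat V (consVal b (consVal a (consVal d (consVal e v)))) θ ↔ Q a b) :
    Def (fun e : M => ∃ a b, e = pair a b ∧ Q a b) := by
  refine delta_comprehension_pair θ θ hθ hθ V hV v Q (fun a b e => ?_) (fun a b e => ?_)
  · simp only [h1]; exact ⟨fun h => ⟨0, h⟩, fun ⟨_, h⟩ => h⟩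
  · simp only [h1]; exact ⟨fun h _ => h, fun h => h 0⟩

/-- Assignment of three set variables. -/
def sets3 (A B C : Set M) : ℕ → Set M := consVal A (consVal B fun _ => C)

theorem sets3_mem {A B C : Set M} (hA : A ∈ M.sets) (hB : B ∈ M.sets) (hC : C ∈ M.sets) (i : ℕ) :
    sets3 A B C i ∈ M.sets := by
  match i with
  | 0 => exact hA
  | 1 => exact hB
  | _ + 2 => exact hC

section Closure

variable {P Q : M → Prop} {f g : M → M}

theorem Def.congr (h : Def P) (hPQ : ∀ c, P c ↔ Q c) : Def Q := by
  have : P = Q := funext fun c => propext (hPQ c)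
  rwa [← this]

theorem DFun.congr (h : DFun f) (hfg : ∀ c, f c = g c) : DFun g := by
  have : f = g := funext hfg
  rwa [← this]

theorem Def.of_iff {P : M → Prop} (Q : M → Prop) [h : Def Q] (hPQ : ∀ c, Q c ↔ P c) : Def P :=
  h.congr hPQ

variable [hM : IsRCA M]

instance Def.not [h : Def P] : Def (fun c => ¬ P c) :=
  bounded_comprehension (.neg (.mem (.var 1) 0)) trivial _ (sets3_mem h.mem h.mem h.mem)
    (fun _ => 0) _ (fun _ _ => Iff.rfl)

instance Def.and [h : Def P] [h' : Def Q] : Def (fun c => P c ∧ Q c) :=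
  bounded_comprehension (.and (.mem (.var 1) 0) (.mem (.var 1) 1)) ⟨trivial, trivial⟩ _
    (sets3_mem h.mem h'.mem h.mem) (fun _ => 0) _ (fun _ _ => Iff.rfl)

instance Def.or [Def P] [Def Q] : Def (fun c => P c ∨ Q c) :=
  Def.of_iff (fun c => ¬ (¬ P c ∧ ¬ Q c)) fun c => by tauto

instance Def.imp [Def P] [Def Q] : Def (fun c => P c → Q c) :=
  Def.of_iff (fun c => ¬ (P c ∧ ¬ Q c)) fun c => by tauto

instance Def.iff [Def P] [Def Q] : Def (fun c => P c ↔ Q c) :=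
  Def.of_iff (fun c => (P c → Q c) ∧ (Q c → P c)) fun c => by tauto

instance Def.const (p : Prop) : Def (fun _ : M => p) := by
  obtain ⟨S, hS⟩ := M.sets_nonempty
  by_cases hp : p
  · exact bounded_comprehension (.eq .zero .zero) trivial _ (sets3_mem hS hS hS) (fun _ => 0) _
      (fun _ _ => by simp [Sat, hp])
  · exact bounded_comprehension (.neg (.eq .zero .zero)) trivial _ (sets3_mem hS hS hS)
      (fun _ => 0) _ (fun _ _ => by simp [Sat, hp])

theorem pair_mem_graph {a b : M} : pair a b ∈ {e : M | ∃ a b, e = pair a b ∧ a = f b} ↔ a = f b := by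
  constructor
  · rintro ⟨a', b', h, h'⟩
    obtain ⟨rfl, rfl⟩ := pair_inj.1 h
    exact h'
  · exact fun h => ⟨a, b, rfl, h⟩

/-- With the graph of `f` as a parameter, the value `f c` can be introduced by `∃` as well as by
`∀`, which gives the two forms required. -/
theorem Def.comp (h : Def P) (hf : DFun f) : Def (fun c => P (f c)) := by
  refine delta_comprehension (.and (.mem (pairT (.var 0) (.var 1)) 1) (.mem (.var 0) 0))
    (.or (.neg (.mem (pairT (.var 0) (.var 1)) 1)) (.mem (.var 0) 0))
    ⟨trivial, trivial⟩ ⟨trivial, trivial⟩ _ (sets3_mem h.mem hf.mem h.mem) (fun _ => 0) _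
    (fun n => ?_) (fun n => ?_)
  · simp only [Sat, termVal_pairT, sets3, termVal, consVal, pair_mem_graph]
    simp
  · simp only [Sat, termVal_pairT, sets3, termVal, consVal, pair_mem_graph]
    simp [← imp_iff_not_or]

instance Def.mem' {S : Set M} [h : InM S] [hf : DFun f] : Def (fun c => f c ∈ S) :=
  Def.comp (P := (· ∈ S)) ⟨h.mem⟩ hf

instance DFun.pair [hf : DFun f] [hg : DFun g] : DFun (fun c => pair (f c) (g c)) := by
  refine ⟨@Def.mem M (fun e => ∃ a b, e = L2Structure.pair a b ∧ a = L2Structure.pair (f b) (g b)) ?_⟩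
  refine bounded_comprehension_pair
    (.bex (.add (.var 1) .one) (.bex (.add (.var 2) .one) (.and (.eq (.var 3)
      (pairT (.var 1) (.var 0))) (.and (.mem (pairT (.var 1) (.var 2)) 0)
      (.mem (pairT (.var 0) (.var 2)) 1))))) ⟨trivial, trivial, trivial⟩ _
      (sets3_mem hf.mem hg.mem hf.mem) (fun _ => 0) _ (fun a b e d => ?_)
  simp only [Sat, termVal_pairT, sets3, termVal, consVal, pair_mem_graph]
  constructor
  · rintro ⟨x, _, y, _, h1, rfl, rfl⟩
    exact h1
  · rintro rfl
    exact ⟨f b, lt_add_one_iff'.2 (left_le_pair _ _), g b, lt_add_one_iff'.2 (right_le_pair _ _),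
      rfl, rfl, rfl⟩

theorem DFun.comp (hf : DFun f) (hg : DFun g) : DFun (fun c => f (g c)) := by
  refine ⟨@Def.mem M (fun e => ∃ a b, e = L2Structure.pair a b ∧ a = f (g b)) ?_⟩
  refine delta_comprehension_pair
    (.and (.mem (pairT (.var 2) (.var 0)) 1) (.mem (pairT (.var 1) (.var 2)) 0))
    (.or (.neg (.mem (pairT (.var 2) (.var 0)) 1)) (.mem (pairT (.var 1) (.var 2)) 0))
    ⟨trivial, trivial⟩ ⟨trivial, trivial⟩ _
      (sets3_mem hf.mem hg.mem hf.mem) (fun _ => 0) _ (fun a b e => ?_) (fun a b e => ?_)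
  · simp only [Sat, termVal_pairT, sets3, termVal, consVal, pair_mem_graph]
    simp
  · simp only [Sat, termVal_pairT, sets3, termVal, consVal, pair_mem_graph]
    simp [← imp_iff_not_or]

theorem DFun.of_formula (θ : ArithFormula) (hθ : θ.IsBounded) (v : ℕ → M)
    (h1 : ∀ V a b e d,
      M.Sat V (consVal b (consVal a (consVal d (consVal e v)))) θ ↔ a = f b) : DFun f := by
  obtain ⟨S, hS⟩ := M.sets_nonempty
  exact ⟨(bounded_comprehension_pair θ hθ _ (sets3_mem hS hS hS) v _ (h1 _)).mem⟩

instance DFun.id : DFun (fun c : M => c) :=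
  DFun.of_formula (.eq (.var 1) (.var 0)) trivial (fun _ => 0)
    (by simp [Sat, termVal, consVal])

instance DFun.const (a : M) : DFun (fun _ : M => a) :=
  DFun.of_formula (.eq (.var 1) (.var 4)) trivial (fun _ => a)
    (by simp [Sat, termVal, consVal])

/-- All quantifiers are bounded and the junk value is covered, so this can be copied into a bounded
formula. -/
theorem eq_fst_iff {y c : M} :
    y = fst c ↔ (∃ b < c + 1, c = pair y b) ∨ ((¬ ∃ a < c + 1, ∃ b < c + 1, c = pair a b) ∧ y = 0) := by
  have h2 : (∃ a < c + 1, ∃ b < c + 1, c = pair a b) ↔ ∃ a b, c = pair a b := by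
    constructor
    · rintro ⟨a, _, b, _, h⟩; exact ⟨a, b, h⟩
    · rintro ⟨a, b, h⟩
      exact ⟨a, h ▸ lt_add_one_iff'.2 (left_le_pair _ _), b,
        h ▸ lt_add_one_iff'.2 (right_le_pair _ _), h⟩
  rw [h2]
  by_cases hc : ∃ a b, c = pair a b
  · obtain ⟨a, b, rfl⟩ := hc
    simp only [fst_pair, pair_inj]
    constructor
    · rintro rfl
      exact .inl ⟨b, lt_add_one_iff'.2 (right_le_pair _ _), rfl, rfl⟩
    · rintro (⟨b', _, rfl, _⟩ | h)
      · rfl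
      · exact (h.1 ⟨a, b, rfl, rfl⟩).elim
  · rw [fst_of_not_pair hc]
    constructor
    · exact fun h => .inr ⟨hc, h⟩
    · rintro (⟨b', _, h⟩ | h)
      exacts [(hc ⟨_, _, h⟩).elim, h.2]

theorem eq_snd_iff {y c : M} :
    y = snd c ↔ (∃ b < c + 1, c = pair b y) ∨ ((¬ ∃ a < c + 1, ∃ b < c + 1, c = pair a b) ∧ y = 0) := by
  have h2 : (∃ a < c + 1, ∃ b < c + 1, c = pair a b) ↔ ∃ a b, c = pair a b := by
    constructor
    · rintro ⟨a, _, b, _, h⟩; exact ⟨a, b, h⟩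
    · rintro ⟨a, b, h⟩
      exact ⟨a, h ▸ lt_add_one_iff'.2 (left_le_pair _ _), b,
        h ▸ lt_add_one_iff'.2 (right_le_pair _ _), h⟩
  rw [h2]
  by_cases hc : ∃ a b, c = pair a b
  · obtain ⟨a, b, rfl⟩ := hc
    simp only [snd_pair, pair_inj]
    constructor
    · rintro rfl
      exact .inl ⟨a, lt_add_one_iff'.2 (left_le_pair _ _), rfl, rfl⟩
    · rintro (⟨b', _, _, rfl⟩ | h)
      · rfl
      · exact (h.1 ⟨a, b, rfl, rfl⟩).elim
  · rw [snd_of_not_pair hc]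
    constructor
    · exact fun h => .inr ⟨hc, h⟩
    · rintro (⟨b', _, h⟩ | h)
      exacts [(hc ⟨_, _, h⟩).elim, h.2]

/-- The formula saying that variable `0` is not a pair. -/
def notPairF : ArithFormula := .neg (.bex (.add (.var 0) .one) (.bex (.add (.var 1) .one)
  (.eq (.var 2) (pairT (.var 1) (.var 0)))))

instance DFun.fst_base : DFun (fst : M → M) := by
  refine DFun.of_formula (.or (.bex (.add (.var 0) .one) (.eq (.var 1) (pairT (.var 2) (.var 0))))
    (.and notPairF (.eq (.var 1) .zero))) ⟨trivial, trivial, trivial⟩ (fun _ => 0)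
    (fun V a b e d => ?_)
  rw [eq_fst_iff]
  rfl

instance DFun.snd_base : DFun (snd : M → M) := by
  refine DFun.of_formula (.or (.bex (.add (.var 0) .one) (.eq (.var 1) (pairT (.var 0) (.var 2))))
    (.and notPairF (.eq (.var 1) .zero))) ⟨trivial, trivial, trivial⟩ (fun _ => 0)
    (fun V a b e d => ?_)
  rw [eq_snd_iff]
  rfl

instance DFun.fst [hf : DFun f] : DFun (fun c => fst (f c)) := DFun.fst_base.comp hf

instance DFun.snd [hf : DFun f] : DFun (fun c => snd (f c)) := DFun.snd_base.comp hf

/-- Composition of a definable binary operation with two definable functions. -/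
theorem DFun.comp₂ {F : M → M → M} (h : DFun fun e => F (L2Structure.fst e) (L2Structure.snd e))
    (hf : DFun f) (hg : DFun g) : DFun (fun c => F (f c) (g c)) :=
  (h.comp (DFun.pair (f := f) (g := g))).congr fun c => by simp

/-- Composition of a definable binary relation with two definable functions. -/
theorem Def.comp₂ {R : M → M → Prop} (h : Def fun e => R (fst e) (snd e))
    (hf : DFun f) (hg : DFun g) : Def (fun c => R (f c) (g c)) :=
  (h.comp (DFun.pair (f := f) (g := g))).congr fun c => by simp

/-- Composition of a definable ternary relation with three definable functions. -/
theorem Def.comp₃ {k : M → M} {R : M → M → M → Prop}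
    (h : Def fun e => R (fst e) (fst (snd e)) (snd (snd e)))
    (hf : DFun f) (hg : DFun g) (hk : DFun k) : Def (fun c => R (f c) (g c) (k c)) :=
  (h.comp (f := fun c => L2Structure.pair (f c) (L2Structure.pair (g c) (k c)))
    inferInstance).congr fun c => by simp

/-- Composition of a definable quaternary relation with four definable functions. -/
theorem Def.comp₄ {k l : M → M} {R : M → M → M → M → Prop}
    (h : Def fun e => R (fst e) (fst (snd e)) (fst (snd (snd e))) (snd (snd (snd e))))
    (hf : DFun f) (hg : DFun g) (hk : DFun k) (hl : DFun l) :
    Def (fun c => R (f c) (g c) (k c) (l c)) :=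
  (h.comp (f := fun c => L2Structure.pair (f c) (L2Structure.pair (g c)
    (L2Structure.pair (k c) (l c)))) inferInstance).congr fun c => by simp

theorem Def.comp₂' {R : M → M → Prop} (h : Def fun e => ∃ a b, e = L2Structure.pair a b ∧ R a b)
    (hf : DFun f) (hg : DFun g) : Def (fun c => R (f c) (g c)) := by
  refine (h.comp (DFun.pair (f := f) (g := g))).congr fun c => ?_
  constructor
  · rintro ⟨a, b, h1, h2⟩
    obtain ⟨rfl, rfl⟩ := pair_inj.1 h1
    exact h2
  · exact fun h => ⟨_, _, rfl, h⟩

theorem Def.of_pair_formula {R : M → M → Prop} (θ : ArithFormula) (hθ : θ.IsBounded)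
    (h1 : ∀ V v a b e d,
      M.Sat V (consVal b (consVal a (consVal d (consVal e v)))) θ ↔ R a b)
    (hf : DFun f) (hg : DFun g) : Def (fun c => R (f c) (g c)) := by
  obtain ⟨S, hS⟩ := M.sets_nonempty
  exact Def.comp₂' (bounded_comprehension_pair θ hθ _ (sets3_mem hS hS hS) (fun _ => 0) _ (h1 _ _))
    hf hg

instance Def.eq [hf : DFun f] [hg : DFun g] : Def (fun c => f c = g c) :=
  Def.of_pair_formula (R := fun a b => a = b) (.eq (.var 1) (.var 0)) trivial
    (fun _ _ _ _ _ _ => Iff.rfl) hf hg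

instance Def.lt [hf : DFun f] [hg : DFun g] : Def (fun c => f c < g c) :=
  Def.of_pair_formula (R := fun a b => a < b) (.lt (.var 1) (.var 0)) trivial
    (fun _ _ _ _ _ _ => Iff.rfl) hf hg

instance Def.le [hf : DFun f] [hg : DFun g] : Def (fun c => f c ≤ g c) :=
  Def.of_iff (fun c => f c < g c ∨ f c = g c) fun _ => le_iff_lt_or_eq.symm

instance DFun.add [hf : DFun f] [hg : DFun g] : DFun (fun c => f c + g c) := by
  refine DFun.comp₂ (F := fun a b => a + b) ?_ hf hg
  refine ⟨@Def.mem M (fun e : M => ∃ a b, e = L2Structure.pair a b ∧ a = L2Structure.fst b +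
    L2Structure.snd b) ?_⟩
  refine bounded_comprehension_pair (.bex (.add (.var 0) .one) (.bex (.add (.var 1) .one)
    (.and (.mem (pairT (.var 1) (.var 2)) 0) (.and (.mem (pairT (.var 0) (.var 2)) 1)
    (.eq (.var 3) (.add (.var 1) (.var 0))))))) ⟨trivial, trivial, trivial⟩ _
    (sets3_mem DFun.fst_base.mem DFun.snd_base.mem DFun.fst_base.mem) (fun _ => 0) _
    (fun a b e d => ?_)
  simp only [Sat, termVal_pairT, sets3, termVal, consVal, pair_mem_graph]
  -- Components do not exceed the number, also in the junk case; hence bounded quantifiers find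
  -- them.
  have h1 : L2Structure.fst b < b + 1 ∧ L2Structure.snd b < b + 1 := by
    by_cases hb : ∃ x y, b = L2Structure.pair x y
    · obtain ⟨x, y, rfl⟩ := hb
      simp only [fst_pair, snd_pair]
      exact ⟨lt_add_one_iff'.2 (left_le_pair _ _), lt_add_one_iff'.2 (right_le_pair _ _)⟩
    · rw [fst_of_not_pair hb, snd_of_not_pair hb]
      exact ⟨lt_add_one_iff'.2 zero_le, lt_add_one_iff'.2 zero_le⟩
  constructor
  · rintro ⟨x, _, y, _, rfl, rfl, h⟩
    exact h
  · exact fun h => ⟨_, h1.1, _, h1.2, rfl, rfl, h⟩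

instance DFun.mul [hf : DFun f] [hg : DFun g] : DFun (fun c => f c * g c) := by
  refine DFun.comp₂ (F := fun a b => a * b) ?_ hf hg
  refine ⟨@Def.mem M (fun e : M => ∃ a b, e = L2Structure.pair a b ∧ a = L2Structure.fst b *
    L2Structure.snd b) ?_⟩
  refine bounded_comprehension_pair (.bex (.add (.var 0) .one) (.bex (.add (.var 1) .one)
    (.and (.mem (pairT (.var 1) (.var 2)) 0) (.and (.mem (pairT (.var 0) (.var 2)) 1)
    (.eq (.var 3) (.mul (.var 1) (.var 0))))))) ⟨trivial, trivial, trivial⟩ _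
    (sets3_mem DFun.fst_base.mem DFun.snd_base.mem DFun.fst_base.mem) (fun _ => 0) _
    (fun a b e d => ?_)
  simp only [Sat, termVal_pairT, sets3, termVal, consVal, pair_mem_graph]
  have h1 : L2Structure.fst b < b + 1 ∧ L2Structure.snd b < b + 1 := by
    by_cases hb : ∃ x y, b = L2Structure.pair x y
    · obtain ⟨x, y, rfl⟩ := hb
      simp only [fst_pair, snd_pair]
      exact ⟨lt_add_one_iff'.2 (left_le_pair _ _), lt_add_one_iff'.2 (right_le_pair _ _)⟩
    · rw [fst_of_not_pair hb, snd_of_not_pair hb]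
      exact ⟨lt_add_one_iff'.2 zero_le, lt_add_one_iff'.2 zero_le⟩
  constructor
  · rintro ⟨x, _, y, _, rfl, rfl, h⟩
    exact h
  · exact fun h => ⟨_, h1.1, _, h1.2, rfl, rfl, h⟩

instance Def.bex {R : M → M → Prop} [h : Def fun e => R (L2Structure.fst e) (L2Structure.snd e)]
    [hf : DFun f] : Def (fun c => ∃ x, x < f c ∧ R x c) := by
  refine delta_comprehension
    (.and (.mem (pairT (.var 0) (.var 1)) 0) (.bex (.var 0) (.mem (pairT (.var 0) (.var 2)) 1)))
    (.or (.neg (.mem (pairT (.var 0) (.var 1)) 0))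
      (.bex (.var 0) (.mem (pairT (.var 0) (.var 2)) 1)))
    ⟨trivial, trivial⟩ ⟨trivial, trivial⟩ _ (sets3_mem hf.mem h.mem h.mem) (fun _ => 0) _
    (fun n => ?_) (fun n => ?_)
  · simp only [Sat, termVal_pairT, sets3, termVal, consVal, pair_mem_graph]
    simp
  · simp only [Sat, termVal_pairT, sets3, termVal, consVal, pair_mem_graph]
    simp [← imp_iff_not_or]

instance Def.ball {R : M → M → Prop} [h : Def fun e => R (L2Structure.fst e) (L2Structure.snd e)]
    [hf : DFun f] : Def (fun c => ∀ x, x < f c → R x c) :=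
  Def.of_iff (fun c => ¬ ∃ x, x < f c ∧ ¬ R x c) fun c => by
    push Not; rfl

instance Def.bex_le {R : M → M → Prop} [h : Def fun e => R (L2Structure.fst e) (L2Structure.snd e)]
    [hf : DFun f] : Def (fun c => ∃ x, x ≤ f c ∧ R x c) :=
  Def.of_iff (fun c => ∃ x, x < f c + 1 ∧ R x c) fun c => by
    simp only [lt_add_one_iff']

instance Def.ball_le {R : M → M → Prop} [h : Def fun e => R (L2Structure.fst e) (L2Structure.snd e)]
    [hf : DFun f] : Def (fun c => ∀ x, x ≤ f c → R x c) :=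
  Def.of_iff (fun c => ∀ x, x < f c + 1 → R x c) fun c => by
    simp only [lt_add_one_iff']

instance Def.mem_eta {S : Set M} [h : InM S] : Def (Membership.mem S) := ⟨h.mem⟩

instance Def.lt_eta {a : M} : Def (LT.lt a) := Def.lt (f := fun _ => a) (g := fun c => c)

instance Def.le_eta {a : M} : Def (LE.le a) := Def.le (f := fun _ => a) (g := fun c => c)

theorem DFun.of_graph (h : Def fun e => L2Structure.fst e = f (L2Structure.snd e)) : DFun f := by
  have h2 : Def fun e : M => e = L2Structure.pair (L2Structure.fst e) (L2Structure.snd e) ∧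
    L2Structure.fst e = f (L2Structure.snd e) := inferInstance
  refine ⟨(h2.congr fun c => ?_).mem⟩
  constructor
  · rintro ⟨h1, h2⟩
    exact ⟨_, _, h1, h2⟩
  · rintro ⟨a, b, rfl, h⟩
    simpa using h

end Closure

/-! ### Induction and least number principles -/

variable [hM : IsRCA M]

theorem set_induction {S : Set M} [h : InM S] (h0 : (0 : M) ∈ S) (hs : ∀ n, n ∈ S → n + 1 ∈ S)
    (n : M) : n ∈ S :=
  sigma_induction (.mem (.var 1) 0) trivial _ (sets3_mem h.mem h.mem h.mem) (fun _ => 0) (· ∈ S)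
    (fun _ => ⟨fun h => ⟨0, h⟩, fun ⟨_, h⟩ => h⟩) h0 hs n

theorem def_induction {P : M → Prop} (h : Def P) (h0 : P 0) (hs : ∀ n, P n → P (n + 1)) (n : M) :
    P n := set_induction (S := {n | P n}) h0 hs n

/-- `Σ⁰₁` induction. -/
theorem ex_induction {P : M → M → Prop} (h : Def fun e => P (fst e) (snd e))
    (h0 : ∃ x, P x 0) (hs : ∀ n, (∃ x, P x n) → ∃ x, P x (n + 1)) (n : M) : ∃ x, P x n :=
  sigma_induction (.mem (pairT (.var 0) (.var 1)) 0) trivial _ (sets3_mem h.mem h.mem h.mem)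
    (fun _ => 0) (fun n => ∃ x, P x n)
    (fun n => by simp [Sat, sets3, termVal, consVal]) h0 hs n

theorem set_strong_induction {S : Set M} [h : InM S] (hs : ∀ n, (∀ m < n, m ∈ S) → n ∈ S)
    (n : M) : n ∈ S := by
  refine hs n (def_induction (P := fun n => ∀ m, m < n → m ∈ S) inferInstance ?_ ?_ n)
  · exact fun m hm => (hm.not_ge zero_le).elim
  · intro n ih m hm
    rcases (lt_add_one_iff'.1 hm).lt_or_eq with h1 | rfl
    exacts [ih m h1, hs _ ih]

/-- Least number principle. -/
theorem exists_least {P : M → Prop} (h : Def P) (hn : ∃ n, P n) : ∃ n, P n ∧ ∀ m < n, ¬ P m := by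
  by_contra H
  push Not at H
  obtain ⟨n, hn⟩ := hn
  have := set_strong_induction (S := {n | ¬ P n}) (fun n ih hP => ?_) n
  · exact this hn
  · obtain ⟨m, hm, hPm⟩ := H n hP
    exact ih m hm hPm

/-- Least number principle for `Π⁰₁` predicates. -/
theorem exists_least_forall {P : M → M → Prop} (h : Def fun e => P (fst e) (snd e))
    (hn : ∃ n, ∀ t, P t n) : ∃ n, (∀ t, P t n) ∧ ∀ m < n, ∃ t, ¬ P t m := by
  by_contra H
  push Not at H
  obtain ⟨n, hn⟩ := hn
  have hR : ∀ f g : M → M, DFun f → DFun g → Def fun c => P (f c) (g c) :=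
    fun f g hf hg => h.comp₂ hf hg
  have h2 : Def fun e : M => P (fst e) (fst (snd e)) := hR _ _ inferInstance inferInstance
  -- Without a least `n`, Σ⁰₁ induction produces a common bound `b` for counterexamples to `P · m`
  -- for all `m < n`, whatever `n` is.
  have key := ex_induction (P := fun b n : M => ∀ m, m < n → ∃ t, t < b ∧ ¬ P t m)
    (by
      have : Def fun c : M => P (fst c) (fst (snd c)) := hR _ _ inferInstance inferInstance
      infer_instance) ⟨0, fun m hm => (hm.not_ge zero_le).elim⟩ (fun n hb => ?_) (n + 1)
  · obtain ⟨b, hb⟩ := key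
    obtain ⟨t, _, ht⟩ := hb n (lt_add_one_iff'.2 le_rfl)
    exact ht (hn t)
  · obtain ⟨b, hb⟩ := hb
    by_cases hP : ∀ t, P t n
    · obtain ⟨m, hm, hPm⟩ := H n hP
      obtain ⟨t, _, ht⟩ := hb m hm
      exact (ht (hPm t)).elim
    · push Not at hP
      obtain ⟨t, ht⟩ := hP
      refine ⟨max b (t + 1), fun m hm => ?_⟩
      rcases (lt_add_one_iff'.1 hm).lt_or_eq with h1 | rfl
      · obtain ⟨t', ht', h'⟩ := hb m h1
        exact ⟨t', lt_max_of_lt_left ht', h'⟩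
      · exact ⟨t, lt_max_of_lt_right (lt_add_one_iff'.2 le_rfl), ht⟩

end L2Structure

set_option synthInstance.maxSize 100000
set_option synthInstance.maxHeartbeats 200000

namespace L2Structure

variable {M : L2Structure.{u}} [hM : IsRCA M]

/-! ### Coding finite sets by divisibility -/

section Coding

theorem dvd_of_dvd_add {a x y : M} (ha : 0 < a) (hx : a ∣ x) (hxy : a ∣ x + y) : a ∣ y := by
  obtain ⟨u, rfl⟩ := hx
  obtain ⟨v, hv⟩ := hxy
  have huv : u ≤ v := by
    by_contra hlt
    have := mul_lt_mul_of_pos_left (not_le.1 hlt) ha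
    exact absurd (hv ▸ le_self_add (a := a * u) (b := y)) (not_le.2 this)
  obtain ⟨w, rfl⟩ := exists_add_of_le huv
  refine ⟨w, ?_⟩
  rw [mul_add] at hv
  exact add_left_cancel hv

/-- The moduli `m(i+1)+1` are pairwise coprime when differences of indices divide `m`. -/
theorem modulus_dvd_of_dvd_mul {m i j d n : M} (hd : d ∣ m) (hij : j = i + d ∨ i = j + d)
    (h : m * (i + 1) + 1 ∣ n * (m * (j + 1) + 1)) : m * (i + 1) + 1 ∣ n := by
  have hpos : 0 < m * (i + 1) + 1 := by positivity
  -- `m` is invertible modulo `m(i+1)+1`, because `x * m * (i + 1) + x` is a multiple of this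
  -- modulus.
  have key : ∀ x : M, m * (i + 1) + 1 ∣ x * m → m * (i + 1) + 1 ∣ x := by
    intro x hx
    refine dvd_of_dvd_add hpos (hx.mul_right (i + 1)) ⟨x, by ring⟩
  -- The moduli at `i` and `j` differ by `m * d`. As `d ∣ m`, divisibility of `n * m * m` follows,
  -- and `key` removes both factors `m`.
  have h1 : m * (i + 1) + 1 ∣ n * m * d := by
    rcases hij with rfl | rfl
    · refine dvd_of_dvd_add hpos (x := n * (m * (i + 1) + 1)) (Dvd.intro_left _ rfl) ?_
      convert h using 1
      ring
    · refine dvd_of_dvd_add hpos h (Dvd.intro_left n ?_)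
      ring
  obtain ⟨e, rfl⟩ := hd
  refine key _ (key _ ?_)
  convert h1.mul_right e using 1
  ring

instance Def.dvd {f g : M → M} [hf : DFun f] [hg : DFun g] : Def (fun c => f c ∣ g c) := by
  refine Def.comp₂ (R := fun a b => a ∣ b) ?_ hf hg
  refine Def.of_iff (fun c => ∃ q, q ≤ snd c ∧ snd c = fst c * q) fun c => ⟨?_, ?_⟩
  · rintro ⟨q, _, h⟩
    exact ⟨q, h⟩
  · rintro ⟨q, h⟩
    rcases zero_or_succ (fst c) with h0 | ⟨k, hk⟩
    · exact ⟨0, zero_le, by simp [h, h0]⟩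
    · refine ⟨q, ?_, h⟩
      rw [h, hk]
      exact (le_iff_exists_aux _ _).2 ⟨k * q, by ring⟩

theorem exists_common_multiple (k : M) : ∃ m : M, 0 < m ∧ ∀ d, d ≤ k → 0 < d → d ∣ m := by
  refine ex_induction (P := fun m k : M => 0 < m ∧ ∀ d, d ≤ k → 0 < d → d ∣ m) (by infer_instance)
    ⟨1, one_pos, fun d hd hd' => (hd'.not_ge hd).elim⟩ (fun n ⟨m, hm, h⟩ => ?_) k
  refine ⟨m * (n + 1), by positivity, fun d hd hd' => ?_⟩
  rcases hd.lt_or_eq with h1 | rfl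
  · exact (h d (lt_add_one_iff'.1 h1) hd').mul_right _
  · exact Dvd.intro_left _ rfl

theorem exists_modulus_multiple (m k : M) : ∃ n : M, 0 < n ∧ ∀ i, i < k → m * (i + 1) + 1 ∣ n := by
  refine ex_induction (P := fun n k : M => 0 < n ∧ ∀ i, i < k → m * (i + 1) + 1 ∣ n) (by infer_instance)
    ⟨1, one_pos, fun d hd => (hd.not_ge zero_le).elim⟩ (fun k ⟨n, hn, h⟩ => ?_) k
  refine ⟨n * (m * (k + 1) + 1), by positivity, fun d hd => ?_⟩
  rcases (lt_add_one_iff'.1 hd).lt_or_eq with h1 | rfl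
  · exact (h d h1).mul_right _
  · exact Dvd.intro_left _ rfl

/-- Bounded `Σ⁰₁` sets are described by numbers. -/
theorem exists_divisors {P : M → M → Prop} (h : Def fun e => P (fst e) (snd e)) (k : M) :
    ∃ m n : M, ∀ i < k, m * (i + 1) + 1 ∣ n ↔ ∃ t, P t i := by
  obtain ⟨m, hm, hmd⟩ := exists_common_multiple k
  obtain ⟨N, hN, hNd⟩ := exists_modulus_multiple m k
  have hP : Def fun c : M => P (fst (snd c)) (fst c) := h.comp₂ (by infer_instance) (by infer_instance)
  have hP' : Def fun c : M => P (fst (snd c)) (fst c) → m * (fst c + 1) + 1 ∣ snd (snd c) :=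
    inferInstance
  -- The least positive number divisible by all required moduli. The requirement is Π⁰₁, since `∃ t,
  -- P t i` enters as a hypothesis.
  obtain ⟨n, hn, hmin⟩ := exists_least_forall
    (P := fun t n => 0 < n ∧ ∀ i, i < k → P t i → m * (i + 1) + 1 ∣ n) (by infer_instance)
    ⟨N, fun t => ⟨hN, fun i hi _ => hNd i hi⟩⟩
  refine ⟨m, n, fun i hi => ⟨fun hdvd => ?_, fun ⟨t, ht⟩ => (hn t).2 i hi ht⟩⟩
  -- A superfluous modulus could be divided out: by coprimality the smaller quotient is still
  -- divisible by all required ones.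
  by_contra hno
  push Not at hno
  obtain ⟨n', rfl⟩ := hdvd
  have hpos : 0 < n' := by
    rcases zero_or_succ n' with rfl | ⟨k, rfl⟩
    · simpa using (hn 0).1
    · positivity
  have hlt : n' < (m * (i + 1) + 1) * n' := by
    obtain ⟨r, rfl⟩ := (lt_iff_exists_aux _ _).1 hm
    obtain ⟨s, rfl⟩ := (lt_iff_exists_aux _ _).1 hpos
    exact (lt_iff_exists_aux _ _).2 ⟨(r + 1) * i * (s + 1) + r * (s + 1) + s, by ring⟩
  obtain ⟨t, ht⟩ := hmin n' hlt
  refine ht ⟨hpos, fun j hj hPj => ?_⟩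
  have h1 := (hn t).2 j hj hPj
  rw [mul_comm (m * (i + 1) + 1)] at h1
  rcases lt_trichotomy i j with h2 | rfl | h2
  · obtain ⟨d, rfl⟩ := exists_add_of_le h2.le
    have hd : 0 < d := by
      rcases zero_or_succ d with rfl | ⟨k, rfl⟩
      · simp at h2
      · positivity
    exact modulus_dvd_of_dvd_mul (hmd d (le_add_self.trans hj.le) hd) (.inr rfl) h1
  · exact (hno t hPj).elim
  · obtain ⟨d, rfl⟩ := exists_add_of_le h2.le
    have hd : 0 < d := by
      rcases zero_or_succ d with rfl | ⟨k, rfl⟩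
      · simp at h2
      · positivity
    exact modulus_dvd_of_dvd_mul (hmd d (le_add_self.trans hi.le) hd) (.inl rfl) h1

theorem isTriple_iff {c : M} :
    IsTriple c ↔ c = pair (fst c) (pair (fst (snd c)) (snd (snd c))) := by
  constructor
  · rintro ⟨k, m, n, rfl⟩
    simp
  · exact fun h => ⟨_, _, _, h⟩

theorem finMem_iff {i c : M} : FinMem i c ↔ IsTriple c ∧ i < fst c ∧
    fst (snd c) * (i + 1) + 1 ∣ snd (snd c) := by
  constructor
  · rintro ⟨k, m, n, rfl, hi, q, rfl⟩
    exact ⟨⟨_, _, _, rfl⟩, by simpa using hi, by simp⟩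
  · rintro ⟨⟨k, m, n, rfl⟩, hi, hd⟩
    simp only [fst_pair, snd_pair] at hi hd
    obtain ⟨q, hq⟩ := hd
    exact ⟨k, m, n, rfl, hi, q, by rw [hq, mul_comm]⟩

theorem FinMem.lt {i c : M} (h : FinMem i c) : i < c := by
  obtain ⟨k, m, n, rfl, hi, -⟩ := h
  exact hi.trans_le (left_le_pair _ _)

instance Def.isTriple {f : M → M} [DFun f] : Def (fun c => IsTriple (f c)) :=
  Def.of_iff (fun c => f c = pair (fst (f c)) (pair (fst (snd (f c))) (snd (snd (f c)))))
    fun _ => isTriple_iff.symm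

instance Def.isTriple_eta : Def (IsTriple (M := M)) := Def.isTriple (f := fun c => c)

instance Def.finMem {f g : M → M} [DFun f] [DFun g] : Def (fun c => FinMem (f c) (g c)) :=
  Def.of_iff (fun c => IsTriple (g c) ∧ f c < fst (g c) ∧
    fst (snd (g c)) * (f c + 1) + 1 ∣ snd (snd (g c))) fun _ => finMem_iff.symm

theorem finMem_iff_bounded {c c' : M} :
    (∀ i, i < c + c' → (FinMem i c ↔ FinMem i c')) ↔ ∀ i, FinMem i c ↔ FinMem i c' := by
  refine ⟨fun h i => ?_, fun h i _ => h i⟩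
  exact ⟨fun hi => (h i (hi.lt.trans_le le_self_add)).1 hi,
    fun hi => (h i (hi.lt.trans_le le_add_self)).2 hi⟩

instance InM.finCodes : InM M.finCodes := by
  have : Def fun c : M => IsTriple c ∧ ∀ c', c' < c → IsTriple c' →
    ¬ ∀ i, i < c' + c → (FinMem i c' ↔ FinMem i c) := by infer_instance
  refine (this.congr fun c => ?_).inM
  simp only [finMem_iff_bounded]

theorem eq_of_finMem_iff {c c' : M} (hc : c ∈ M.finCodes) (hc' : c' ∈ M.finCodes)
    (h : ∀ i, FinMem i c ↔ FinMem i c') : c = c' := by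
  rcases lt_trichotomy c c' with h1 | h1 | h1
  · exact (hc'.2 c h1 hc.1 h).elim
  · exact h1
  · exact (hc.2 c' h1 hc'.1 fun i => (h i).symm).elim

/-- Every bounded `Σ⁰₁` set is coded. -/
theorem exists_finCode {P : M → M → Prop} (h : Def fun e => P (fst e) (snd e)) (k : M) :
    ∃ c ∈ M.finCodes, ∀ i, FinMem i c ↔ i < k ∧ ∃ t, P t i := by
  obtain ⟨m, n, hmn⟩ := exists_divisors h k
  have hc : ∀ i, FinMem i (pair k (pair m n)) ↔ i < k ∧ ∃ t, P t i := by
    intro i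
    rw [finMem_iff]
    simp only [fst_pair, snd_pair]
    constructor
    · rintro ⟨-, hi, hd⟩
      exact ⟨hi, (hmn i hi).1 hd⟩
    · rintro ⟨hi, hd⟩
      exact ⟨⟨_, _, _, rfl⟩, hi, (hmn i hi).2 hd⟩
  obtain ⟨c, ⟨hc1, hc2⟩, hmin⟩ := exists_least
    (P := fun c => IsTriple c ∧ ∀ i, i < c + pair k (pair m n) →
      (FinMem i c ↔ FinMem i (pair k (pair m n)))) (by infer_instance)
    ⟨_, ⟨_, _, _, rfl⟩, fun _ _ => Iff.rfl⟩
  rw [finMem_iff_bounded] at hc2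
  refine ⟨c, ⟨hc1, fun c' hlt ht hall => hmin c' hlt ⟨ht, ?_⟩⟩, fun i => (hc2 i).trans (hc i)⟩
  exact fun i _ => (hall i).trans (hc2 i)

theorem exists_finCode_of_def {P : M → Prop} (h : Def P) (k : M) :
    ∃ c ∈ M.finCodes, ∀ i, FinMem i c ↔ i < k ∧ P i := by
  have h' : Def fun e : M => P (snd e) := h.comp (by infer_instance)
  obtain ⟨c, hc, hc'⟩ := exists_finCode (P := fun _ i => P i) h' k
  exact ⟨c, hc, fun i => by rw [hc' i]; have : Nonempty M := ⟨0⟩; simp⟩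

/-- Strong bounding for `Σ⁰₁` predicates. -/
theorem strong_bounding {P : M → M → Prop} (h : Def fun e => P (fst e) (snd e)) (k : M) :
    ∃ b, ∀ i < k, (∃ t, P t i) → ∃ t < b, P t i := by
  -- The code `c` decides which `i < k` have witnesses; this makes the induction statement below
  -- Σ⁰₁.
  obtain ⟨c, -, hc⟩ := exists_finCode h k
  have hP : Def fun c : M => P (fst c) (fst (snd c)) := h.comp₂ (by infer_instance) (by infer_instance)
  have key := ex_induction
    (P := fun b n : M => ∀ i, i < n → FinMem i c → ∃ t, t < b ∧ P t i) (by infer_instance)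
    ⟨0, fun i hi => (hi.not_ge zero_le).elim⟩ (fun n ⟨b, hb⟩ => ?_) k
  · obtain ⟨b, hb⟩ := key
    exact ⟨b, fun i hi ht => hb i hi ((hc i).2 ⟨hi, ht⟩)⟩
  · by_cases hn : FinMem n c
    · obtain ⟨-, t, ht⟩ := (hc n).1 hn
      refine ⟨max b (t + 1), fun i hi hic => ?_⟩
      rcases (lt_add_one_iff'.1 hi).lt_or_eq with h1 | rfl
      · obtain ⟨t', h1, h2⟩ := hb i h1 hic
        exact ⟨t', lt_max_of_lt_left h1, h2⟩
      · exact ⟨t, lt_max_of_lt_right (lt_add_one_iff'.2 le_rfl), ht⟩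
    · refine ⟨b, fun i hi hic => ?_⟩
      rcases (lt_add_one_iff'.1 hi).lt_or_eq with h1 | rfl
      exacts [hb i h1 hic, (hn hic).elim]

end Coding

/-! ### Initial segments, successors and cuts of infinite sets -/

section Segments

/-- The finite set described by `c`. -/
def codeSet (c : M) : Set M := {i | FinMem i c}

open Classical in
/-- The code of the finite set `X ∩ [0, b)`. -/
noncomputable def seg (X : Set M) (b : M) : M :=
  if h : ∃ c ∈ M.finCodes, ∀ i, FinMem i c ↔ i < b ∧ i ∈ X then h.choose else 0

variable {X Y : Set M} [hX : InM X] [hY : InM Y]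

theorem seg_spec (X : Set M) [InM X] (b : M) :
    seg X b ∈ M.finCodes ∧ ∀ i, FinMem i (seg X b) ↔ i < b ∧ i ∈ X := by
  have h := exists_finCode_of_def (P := (· ∈ X)) (by infer_instance) b
  rw [seg, dif_pos h]
  exact h.choose_spec

theorem mem_codeSet_seg {b i : M} : i ∈ codeSet (seg X b) ↔ i < b ∧ i ∈ X := (seg_spec X b).2 i

theorem eq_seg_iff {c b : M} : c = seg X b ↔ c ∈ M.finCodes ∧ ∀ i, FinMem i c ↔ i < b ∧ i ∈ X := by
  constructor
  · rintro rfl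
    exact seg_spec X b
  · exact fun h => eq_of_finMem_iff h.1 (seg_spec X b).1 fun i => (h.2 i).trans ((seg_spec X b).2 i).symm

instance DFun.seg {f : M → M} [hf : DFun f] : DFun (fun c => seg X (f c)) := by
  refine DFun.comp (DFun.of_graph ?_) hf
  refine Def.of_iff (fun e => L2Structure.fst e ∈ M.finCodes ∧
    ∀ i, i < L2Structure.fst e + L2Structure.snd e →
    (FinMem i (L2Structure.fst e) ↔ i < L2Structure.snd e ∧ i ∈ X)) fun e => ?_
  rw [eq_seg_iff]
  refine and_congr_right fun _ => ⟨fun h i => ?_, fun h i _ => h i⟩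
  exact ⟨fun hi => (h i (hi.lt.trans_le le_self_add)).1 hi,
    fun hi => (h i (hi.1.trans_le le_add_self)).2 hi⟩

open Filter in
-- An initial segment of an infinite `X` is `X ∩ [0, y)` for the least `y ∈ X` outside it, so a
-- limit along initial segments is a limit in the bound.
theorem limitValue_iff {F : Set M} {q : M} (hinf : IsInfinite X) :
    LimitValue F X q ↔ ∀ᶠ b in atTop, pair (seg X b) q ∈ F := by
  rw [eventually_atTop]
  constructor
  · rintro ⟨s₀, ⟨-, h1, -⟩, h2⟩
    refine ⟨s₀, fun b hb => h2 _ ⟨(seg_spec X b).1, fun i hi => ((seg_spec X b).2 i |>.1 hi).2,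
      fun i hi j hj hij => ?_⟩ fun i hi => ?_⟩
    · exact ((seg_spec X b).2 i).2 ⟨hij.trans ((seg_spec X b).2 j |>.1 hj).1, hi⟩
    · exact ((seg_spec X b).2 i).2 ⟨hi.lt.trans_le hb, h1 i hi⟩
  · rintro ⟨b₀, hb⟩
    have hseg : ∀ b, IsInitialSegment (seg X b) X := fun b =>
      ⟨(seg_spec X b).1, fun i hi => ((seg_spec X b).2 i |>.1 hi).2,
      fun i hi j hj hij => ((seg_spec X b).2 i).2 ⟨hij.trans ((seg_spec X b).2 j |>.1 hj).1, hi⟩⟩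
    refine ⟨seg X b₀, hseg b₀, fun s hs hsub => ?_⟩
    obtain ⟨x, hx, hsx⟩ := hinf s
    obtain ⟨y, ⟨hyX, hys⟩, hmin⟩ := exists_least (P := fun x => x ∈ X ∧ ¬ FinMem x s)
      inferInstance ⟨x, hx, fun h => (h.lt.trans hsx).false⟩
    have hsy : s = seg X y := by
      refine eq_seg_iff.2 ⟨hs.1, fun i => ⟨fun hi => ⟨?_, hs.2.1 i hi⟩, fun hi => ?_⟩⟩
      · by_contra hiy
        rcases (not_lt.1 hiy).lt_or_eq with h1 | rfl
        exacts [hys (hs.2.2 y hyX i hi h1), hys hi]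
      · by_contra his
        exact hmin i hi.1 ⟨hi.2, his⟩
    rw [hsy]
    refine hb y ?_
    by_contra hlt
    exact hys (hsub y (((seg_spec X b₀).2 y).2 ⟨not_le.1 hlt, hyX⟩))

open Filter in
/-- The cofinite Ramsey theorem for colourings given by a set of codes. -/
theorem exists_homogeneous (hRT : M.CofiniteDelta02RT) (G : Set M) [InM G]
    (hconv : ∀ X : Set M, InM X → IsInfinite X →
      (∀ᶠ b in atTop, seg X b ∈ G) ∨ ∀ᶠ b in atTop, seg X b ∉ G) :
    ∃ X : Set M, InM X ∧ IsInfinite X ∧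
      ((∀ Y, InM Y → IsInfinite Y → Y ⊆ X → IsFinite (X \ Y) → ∀ᶠ b in atTop, seg Y b ∈ G) ∨
      ∀ Y, InM Y → IsInfinite Y → Y ⊆ X → IsFinite (X \ Y) → ∀ᶠ b in atTop, seg Y b ∉ G) := by
  set F : Set M := {e | e = pair (fst e) (snd e) ∧ fst e ∈ M.finCodes ∧
    ((snd e = 1 ∧ fst e ∈ G) ∨ (snd e = 0 ∧ fst e ∉ G))} with hF
  have hFM : InM F := inferInstance
  have hmem : ∀ c q, pair c q ∈ F ↔ c ∈ M.finCodes ∧ ((q = 1 ∧ c ∈ G) ∨ (q = 0 ∧ c ∉ G)) := by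
    intro c q
    simp [hF]
  have hlim : ∀ X : Set M, InM X → IsInfinite X → ∀ q, LimitValue F X q ↔
      ∀ᶠ b in atTop, ((q = 1 ∧ seg X b ∈ G) ∨ (q = 0 ∧ seg X b ∉ G)) := by
    intro X hX hXi q
    rw [limitValue_iff hXi]
    simp only [hmem, (seg_spec X _).1, true_and]
  have key := hRT F hFM.mem ?_ ?_
  · obtain ⟨X, hX, hXi, q, hq, hall⟩ := key
    refine ⟨X, ⟨hX⟩, hXi, ?_⟩
    rcases hq with rfl | rfl
    · right
      intro Y hY hYi hYX hfin
      have := (hlim Y hY hYi _).1 (hall Y hY.mem hYi hYX hfin)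
      simpa using this
    · left
      intro Y hY hYi hYX hfin
      have := (hlim Y hY hYi _).1 (hall Y hY.mem hYi hYX hfin)
      simpa using this
  · refine ⟨fun p hp => ?_, fun a ha => ?_⟩
    · refine ⟨_, hp.2.1, snd p, ?_, hp.1⟩
      rcases hp.2.2 with h | h
      exacts [.inr h.1, .inl h.1]
    · by_cases haG : a ∈ G
      · exact ⟨1, (hmem _ _).2 ⟨ha, .inl ⟨rfl, haG⟩⟩, fun q hq => by
          rcases ((hmem _ _).1 hq).2 with h | h
          exacts [h.1, (h.2 haG).elim]⟩
      · exact ⟨0, (hmem _ _).2 ⟨ha, .inr ⟨rfl, haG⟩⟩, fun q hq => by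
          rcases ((hmem _ _).1 hq).2 with h | h
          exacts [(haG h.2).elim, h.1]⟩
  · intro X hX hXi
    rcases hconv X ⟨hX⟩ hXi with h | h
    · exact ⟨1, (hlim X ⟨hX⟩ hXi 1).2 (by simpa using h)⟩
    · exact ⟨0, (hlim X ⟨hX⟩ hXi 0).2 (by simpa using h)⟩

/-- `y` is the smallest element of `S` above `x`. -/
def IsNext (S : Set M) (x y : M) : Prop := y ∈ S ∧ x < y ∧ ∀ z ∈ S, x < z → y ≤ z

omit hM in
theorem IsNext.unique [IsRCA M] {S : Set M} {x y z : M} (h : IsNext S x y) (h' : IsNext S x z) :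
    y = z :=
  le_antisymm (h.2.2 z h'.1 h'.2.1) (h'.2.2 y h.1 h.2.1)

theorem exists_isNext (hXi : IsInfinite X) (x : M) : ∃ y, IsNext X x y := by
  obtain ⟨y, hy, hxy⟩ := hXi x
  obtain ⟨z, hz, hmin⟩ := exists_least (P := fun y => y ∈ X ∧ x < y) (by infer_instance) ⟨y, hy, hxy⟩
  refine ⟨z, hz.1, hz.2, fun w hw hxw => ?_⟩
  by_contra hlt
  exact hmin w (not_le.1 hlt) ⟨hw, hxw⟩

theorem exists_isLeast (hXi : IsInfinite X) : ∃ x, IsLeast X x := by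
  obtain ⟨y, hy, -⟩ := hXi 0
  obtain ⟨z, hz, hmin⟩ := exists_least (P := fun y => y ∈ X) (by infer_instance) ⟨y, hy⟩
  exact ⟨z, hz, fun w hw => not_lt.1 fun hlt => hmin w hlt hw⟩

theorem exists_pred {x y : M} (hx : x ∈ X) (hy : y ∈ X) (hxy : x < y) :
    ∃ w ∈ X, x ≤ w ∧ IsNext X w y := by
  have key := def_induction (P := fun b => x < b → ∃ w, w < b ∧ w ∈ X ∧ ∀ u, u < b → u ∈ X → u ≤ w)
    inferInstance (fun h => (h.not_ge zero_le).elim) (fun b ih hb => ?_) y hxy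
  · obtain ⟨w, hwy, hwX, hmax⟩ := key
    refine ⟨w, hwX, hmax x hxy hx, hy, hwy, fun z hz hwz => ?_⟩
    by_contra hlt
    exact (hmax z (not_le.1 hlt) hz).not_gt hwz
  · by_cases hbX : b ∈ X
    · exact ⟨b, lt_add_one_iff'.2 le_rfl, hbX, fun u hu _ => lt_add_one_iff'.1 hu⟩
    · have hxb : x < b := (lt_add_one_iff'.1 hb).lt_of_ne (by rintro rfl; exact hbX hx)
      obtain ⟨w, hw, hwX, hmax⟩ := ih hxb
      refine ⟨w, lt_add_one_iff'.2 hw.le, hwX, fun u hu huX => hmax u ?_ huX⟩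
      exact (lt_add_one_iff'.1 hu).lt_of_ne (by rintro rfl; exact hbX huX)

/-- Induction along the elements of a set. -/
theorem isNext_induction {P : M → Prop} (hP : Def P) {x : M} (hx : x ∈ X) (h0 : P x)
    (hs : ∀ z w, z ∈ X → x ≤ z → P z → IsNext X z w → P w) {y : M} (hy : y ∈ X) (hxy : x ≤ y) :
    P y := by
  have := hP
  refine set_strong_induction (S := {y | y ∈ X → x ≤ y → P y}) (fun y ih hy hxy => ?_) y hy hxy
  rcases hxy.lt_or_eq with h1 | rfl
  · obtain ⟨w, hw, hxw, hwy⟩ := exists_pred hx hy h1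
    exact hs w y hw hxw (ih w hwy.2.1 hw hxw) hwy
  · exact h0

instance Def.isNext_codeSet {f g k : M → M} [DFun f] [DFun g] [DFun k] :
    Def (fun c => IsNext (codeSet (f c)) (g c) (k c)) := by
  refine Def.comp₃ (R := fun c x y => IsNext (codeSet c) x y) ?_ ‹_› ‹_› ‹_›
  refine Def.of_iff (fun e : M => FinMem (snd (snd e)) (fst e) ∧ fst (snd e) < snd (snd e) ∧
    ∀ z, z < fst e → FinMem z (fst e) → fst (snd e) < z → snd (snd e) ≤ z) fun e => ?_
  exact ⟨fun ⟨h1, h2, h3⟩ => ⟨h1, h2, fun z hz => h3 z (FinMem.lt hz) hz⟩,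
    fun ⟨h1, h2, h3⟩ => ⟨h1, h2, fun z _ hz => h3 z hz⟩⟩

instance Def.isLeast_codeSet {f g : M → M} [DFun f] [DFun g] :
    Def (fun c => IsLeast (codeSet (f c)) (g c)) := by
  refine Def.comp₂ (R := fun c x => IsLeast (codeSet c) x) ?_ ‹_› ‹_›
  refine Def.of_iff (fun e : M => FinMem (snd e) (fst e) ∧
    ∀ z, z < fst e → FinMem z (fst e) → snd e ≤ z) fun e => ?_
  exact ⟨fun ⟨h1, h2⟩ => ⟨h1, fun z hz => h2 z (FinMem.lt hz) hz⟩,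
    fun ⟨h1, h2⟩ => ⟨h1, fun z _ hz => h2 hz⟩⟩

theorem isNext_seg_iff {x y b : M} (hyb : y < b) :
    IsNext (codeSet (seg X b)) x y ↔ IsNext X x y := by
  simp only [IsNext, mem_codeSet_seg]
  constructor
  · rintro ⟨h1, h2, h3⟩
    refine ⟨h1.2, h2, fun z hz hxz => ?_⟩
    by_contra hlt
    exact hlt (h3 z ⟨(not_le.1 hlt).trans hyb, hz⟩ hxz)
  · rintro ⟨h1, h2, h3⟩
    exact ⟨⟨hyb, h1⟩, h2, fun z hz => h3 z hz.2⟩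

theorem isLeast_seg {x b : M} (h : IsLeast X x) (hb : x < b) : IsLeast (codeSet (seg X b)) x :=
  ⟨mem_codeSet_seg.2 ⟨hb, h.1⟩, fun _ hz => h.2 (mem_codeSet_seg.1 hz).2⟩

/-- The set with first element `x`, followed by the elements of `X` from `y` on. -/
def cut (X : Set M) (x y : M) : Set M := {z | z = x ∨ (z ∈ X ∧ y ≤ z)}

instance InM.cut {x y : M} : InM (cut X x y) :=
  ((by infer_instance) : InM {z | z = x ∨ (z ∈ X ∧ y ≤ z)})

omit hM hX in
theorem cut_subset [IsRCA M] {x y : M} (hx : x ∈ X) : cut X x y ⊆ X := by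
  rintro z (rfl | h)
  exacts [hx, h.1]

omit hX in
theorem isInfinite_cut {x y : M} (hXi : IsInfinite X) : IsInfinite (cut X x y) := by
  intro b
  obtain ⟨z, hz, hb⟩ := hXi (max b y)
  exact ⟨z, .inr ⟨hz, ((le_max_right _ _).trans_lt hb).le⟩, (le_max_left _ _).trans_lt hb⟩

omit hX in
theorem isFinite_diff_cut {x y : M} : IsFinite (X \ cut X x y) :=
  ⟨y, fun _ hz => not_le.1 fun h => hz.2 (.inr ⟨hz.1, h⟩)⟩

omit hX in
theorem isLeast_cut {x y : M} (hxy : x < y) : IsLeast (cut X x y) x := by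
  refine ⟨.inl rfl, ?_⟩
  rintro _ (rfl | h)
  exacts [le_rfl, hxy.le.trans h.2]

omit hX in
theorem isNext_cut {x y : M} (hy : y ∈ X) (hxy : x < y) : IsNext (cut X x y) x y := by
  refine ⟨.inr ⟨hy, le_rfl⟩, hxy, ?_⟩
  rintro _ (rfl | h) hz
  exacts [(lt_irrefl _ hz).elim, h.2]

omit hX in
theorem mem_cut_iff {x y z : M} (hxy : x < y) (hyz : y ≤ z) : z ∈ cut X x y ↔ z ∈ X := by
  constructor
  · rintro (rfl | h)
    exacts [(hxy.not_ge hyz).elim, h.1]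
  · exact fun h => .inr ⟨h, hyz⟩

omit hX hY in
theorem isNext_congr {y z w : M} (hXY : ∀ z, y ≤ z → (z ∈ X ↔ z ∈ Y)) (hyz : y ≤ z) :
    IsNext X z w ↔ IsNext Y z w := by
  constructor
  · rintro ⟨h1, h2, h3⟩
    exact ⟨(hXY w (hyz.trans h2.le)).1 h1, h2, fun u hu hzu =>
      h3 u ((hXY u (hyz.trans hzu.le)).2 hu) hzu⟩
  · rintro ⟨h1, h2, h3⟩
    exact ⟨(hXY w (hyz.trans h2.le)).2 h1, h2, fun u hu hzu =>
      h3 u ((hXY u (hyz.trans hzu.le)).1 hu) hzu⟩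

end Segments

end L2Structure

namespace L2Structure

variable {M : L2Structure.{u}}

/-- `M` is a model of `RCA₀` in which projections of sets exist. -/
class IsACA (M : L2Structure.{u}) : Prop extends IsRCA M where
  proj : ∀ S ∈ M.sets, {n | ∃ x, pair x n ∈ S} ∈ M.sets

/-! ### Arithmetical comprehension from the cofinite Ramsey theorem -/

section Projection

variable [hM : IsRCA M]

/-- `n` is enumerated into the projection of `S` before stage `b`. -/
def EnumBy (S : Set M) (n b : M) : Prop := ∃ t, t < b ∧ pair t n ∈ S

instance Def.enumBy {S : Set M} [InM S] {f g : M → M} [hf : DFun f] [hg : DFun g] :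
    Def (fun c => EnumBy S (f c) (g c)) :=
  Def.comp₂ (R := fun n b => EnumBy S n b)
    (inferInstance : Def fun e : M => ∃ t, t < snd e ∧ pair t (fst e) ∈ S) hf hg

instance Def.enumBy_eta {S : Set M} [InM S] {n : M} : Def (EnumBy S n) :=
  Def.enumBy (f := fun _ => n) (g := fun c => c)

/-- Codes of finite sets, with smallest elements `x < y < z`, such that no `n < x` is enumerated into
the projection of `S` from stage `y` on, but before stage `z`. -/
def stableCodes (S : Set M) : Set M := {c | ∃ x, x < c ∧ ∃ y, y < c ∧ ∃ z, z < c ∧ IsLeast (codeSet c) x ∧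
    IsNext (codeSet c) x y ∧ IsNext (codeSet c) y z ∧
    ∀ n, n < x → EnumBy S n z → EnumBy S n y}

instance InM.stableCodes {S : Set M} [InM S] : InM (stableCodes S) := by
  unfold L2Structure.stableCodes
  infer_instance

open Filter in
/-- The cofinite Ramsey theorem yields the existence of projections. -/
theorem proj_mem (hRT : M.CofiniteDelta02RT) (S : Set M) (hS : S ∈ M.sets) :
    {n | ∃ x, pair x n ∈ S} ∈ M.sets := by
  have : InM S := ⟨hS⟩
  have hseg : ∀ (X : Set M) (x y z b : M), InM X → IsLeast X x → IsNext X x y → IsNext X y z →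
      z < b → (seg X b ∈ stableCodes S ↔
      ∀ n, n < x → EnumBy S n z → EnumBy S n y) := by
    intro X x y z b hX hx hy hz hzb
    have hyb : y < b := hz.2.1.trans hzb
    have hxb : x < b := hy.2.1.trans hyb
    have hx' := isLeast_seg hx hxb
    have hy' := (isNext_seg_iff hyb).2 hy
    have hz' := (isNext_seg_iff hzb).2 hz
    constructor
    · rintro ⟨x₁, -, y₁, -, z₁, -, h1, h2, h3, h4⟩
      obtain rfl := h1.unique hx'
      obtain rfl := h2.unique hy'
      obtain rfl := h3.unique hz'
      exact h4
    · exact fun h => ⟨x, FinMem.lt hx'.1, y, FinMem.lt hy'.1, z, FinMem.lt hz'.1, hx', hy', hz', h⟩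
  obtain ⟨X, hX, hXi, hhom⟩ := exists_homogeneous hRT (stableCodes S) (fun X hX hXi => by
    obtain ⟨x, hx⟩ := exists_isLeast hXi
    obtain ⟨y, hy⟩ := exists_isNext hXi x
    obtain ⟨z, hz⟩ := exists_isNext hXi y
    by_cases h : ∀ n, n < x → EnumBy S n z → EnumBy S n y
    · exact .inl ((eventually_gt_atTop z).mono fun b hb => (hseg X x y z b hX hx hy hz hb).2 h)
    · exact .inr ((eventually_gt_atTop z).mono fun b hb hb' =>
        h ((hseg X x y z b hX hx hy hz hb).1 hb')))
  -- After cutting, an arbitrary pair `x < y` of `X` and the successor of `y` are the first three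
  -- elements.
  have hcut : ∀ x y z, x ∈ X → y ∈ X → x < y → IsNext X y z → ∀ᶠ b in atTop,
      (seg (cut X x y) b ∈ stableCodes S ↔ ∀ n, n < x → EnumBy S n z → EnumBy S n y) := by
    intro x y z hx hy hxy hz
    filter_upwards [eventually_gt_atTop z] with b hb
    refine hseg (cut X x y) x y z b inferInstance (isLeast_cut hxy) (isNext_cut hy hxy) ?_ hb
    exact (isNext_congr (fun w hw => mem_cut_iff hxy hw) le_rfl).2 hz
  rcases hhom with hhom | hhom
  · have key : ∀ x y z, x ∈ X → y ∈ X → x < y → IsNext X y z →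
        ∀ n, n < x → EnumBy S n z → EnumBy S n y := by
      intro x y z hx hy hxy hz
      obtain ⟨b, hb1, hb2⟩ := ((hhom (cut X x y) inferInstance (isInfinite_cut hXi) (cut_subset hx)
        isFinite_diff_cut).and (hcut x y z hx hy hxy hz)).exists
      exact hb2.1 hb1
    -- By induction along `X` from `y` up to a stage beyond the witness `t`, no new `n < x` is ever
    -- enumerated.
    have key2 : ∀ n x y, n < x → x ∈ X → y ∈ X → x < y → (∃ t, pair t n ∈ S) → EnumBy S n y := by
      rintro n x y hnx hx hy hxy ⟨t, ht⟩
      by_contra hno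
      obtain ⟨z, hz, hzt⟩ := hXi (max t y)
      refine isNext_induction (X := X) (P := fun z => ¬ EnumBy S n z) inferInstance hy hno
        (fun z w hz hyz hno hw hen => hno (key x z w hx hz (hxy.trans_le hyz) hw n hnx hen))
        hz ((le_max_right _ _).trans hzt.le) ⟨t, (le_max_left _ _).trans_lt hzt, ht⟩
    -- Being enumerated before `y` for some pair `n < x < y` in `X` (Σ⁰₁), or equivalently for all
    -- such pairs (Π⁰₁, next).
    have hall : ∀ n, (∃ t, pair t n ∈ S) ↔ ∃ e, n < fst e ∧ fst e ∈ X ∧ snd e ∈ X ∧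
        fst e < snd e ∧ EnumBy S n (snd e) := by
      refine fun n => ⟨fun h => ?_, fun ⟨e, _, _, _, _, t, _, h⟩ => ⟨t, h⟩⟩
      obtain ⟨x, hx, hnx⟩ := hXi n
      obtain ⟨y, hy, hxy⟩ := hXi x
      exact ⟨pair x y, by simpa [hx, hy, hnx, hxy] using key2 n x y hnx hx hy hxy h⟩
    have hall' : ∀ n, (∃ t, pair t n ∈ S) ↔ ∀ e, n < fst e → fst e ∈ X → snd e ∈ X →
        fst e < snd e → EnumBy S n (snd e) := by
      refine fun n => ⟨fun h e h1 h2 h3 h4 => key2 n _ _ h1 h2 h3 h4 h, fun h => ?_⟩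
      obtain ⟨x, hx, hnx⟩ := hXi n
      obtain ⟨y, hy, hxy⟩ := hXi x
      obtain ⟨t, -, ht⟩ := h (pair x y) (by simpa) (by simpa) (by simpa) (by simpa)
      exact ⟨t, ht⟩
    have hA : Def fun p : M => snd p < fst (fst p) ∧ fst (fst p) ∈ X ∧ snd (fst p) ∈ X ∧
        fst (fst p) < snd (fst p) ∧ EnumBy S (snd p) (snd (fst p)) := inferInstance
    have hB : Def fun p : M => snd p < fst (fst p) → fst (fst p) ∈ X → snd (fst p) ∈ X →
        fst (fst p) < snd (fst p) → EnumBy S (snd p) (snd (fst p)) := inferInstance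
    refine (delta_comprehension (.mem (pairT (.var 0) (.var 1)) 0) (.mem (pairT (.var 0) (.var 1)) 1)
      trivial trivial _ (sets3_mem hA.mem hB.mem hS) (fun _ => 0) (fun n => ∃ t, pair t n ∈ S)
      (fun n => ?_) (fun n => ?_)).mem
    · rw [hall]
      simp only [Sat, termVal_pairT, sets3, termVal, consVal, Set.mem_ofPred_eq, fst_pair, snd_pair]
    · rw [hall']
      simp only [Sat, termVal_pairT, sets3, termVal, consVal, Set.mem_ofPred_eq, fst_pair, snd_pair]
  · exfalso
    obtain ⟨x, hx, -⟩ := hXi 0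
    -- Beyond `b` no further `n < x` is enumerated, so a cut with `y > b` cannot have the second
    -- colour.
    obtain ⟨b, hb⟩ := strong_bounding (P := fun t n => pair t n ∈ S) inferInstance x
    obtain ⟨y, hy, hyb⟩ := hXi (max b x)
    obtain ⟨z, hz⟩ := exists_isNext hXi y
    have hxy : x < y := (le_max_right _ _).trans_lt hyb
    obtain ⟨c, hc1, hc2⟩ := ((hhom (cut X x y) inferInstance (isInfinite_cut hXi) (cut_subset hx)
      isFinite_diff_cut).and (hcut x y z hx hy hxy hz)).exists
    refine hc1 (hc2.2 fun n hn ⟨t, _, ht⟩ => ?_)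
    obtain ⟨t', ht', h'⟩ := hb n hn ⟨t, ht⟩
    exact ⟨t', ht'.trans ((le_max_left _ _).trans_lt hyb), h'⟩

theorem isACA (hRT : M.CofiniteDelta02RT) : IsACA M := ⟨proj_mem hRT⟩

end Projection

/-! ### Closure of the sets under arithmetical definitions -/

section ACA

variable [hM : IsACA M]

instance Def.ex {R : M → M → Prop} [h : Def fun e => R (fst e) (snd e)] :
    Def (fun c => ∃ x, R x c) :=
  Def.congr ⟨hM.proj _ h.mem⟩ fun c => by simp

instance Def.all {R : M → M → Prop} [h : Def fun e => R (fst e) (snd e)] :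
    Def (fun c => ∀ x, R x c) :=
  Def.of_iff (fun c => ¬ ∃ x, ¬ R x c) fun c => by push Not; rfl

theorem DFun.termVal {e : ℕ → M → M} (he : ∀ i, DFun (e i)) (t : L2Term) :
    DFun (fun c => M.termVal (fun i => e i c) t) := by
  induction t with
  | var i => exact he i
  | zero => exact DFun.const 0
  | one => exact DFun.const 1
  | add s t hs ht => exact DFun.add
  | mul s t hs ht => exact DFun.mul

/-- Under a quantifier the argument becomes a pair: its first component is the bound variable, and
its second carries the old environment. -/
theorem dFun_consVal {e : ℕ → M → M} (he : ∀ i, DFun (e i)) (i : ℕ) :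
    DFun (consVal (α := M → M) (fun p => fst p) (fun i p => e i (snd p)) i) := by
  cases i with
  | zero => exact DFun.fst_base
  | succ i => exact (he i).comp DFun.snd_base

/-- Satisfaction of an arithmetical formula is definable. -/
theorem Def.sat {V : ℕ → Set M} (hV : ∀ i, V i ∈ M.sets) (φ : ArithFormula) (e : ℕ → M → M)
    (he : ∀ i, DFun (e i)) : Def (fun c => M.Sat V (fun i => e i c) φ) := by
  have hx : ∀ (φ : ArithFormula), (∀ (e : ℕ → M → M), (∀ i, DFun (e i)) →
      Def (fun c => M.Sat V (fun i => e i c) φ)) → ∀ (e : ℕ → M → M), (∀ i, DFun (e i)) →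
      Def (fun p => M.Sat V (consVal (fst p) (fun i => e i (snd p))) φ) := by
    intro φ ih e he
    refine (ih _ (dFun_consVal he)).congr fun p => ?_
    have : (fun i => consVal (α := M → M) (fun p => fst p) (fun i p => e i (snd p)) i p) =
        consVal (fst p) (fun i => e i (snd p)) := by
      funext i
      cases i <;> rfl
    rw [this]
  induction φ generalizing e with
  | eq s t =>
    have := DFun.termVal he s
    have := DFun.termVal he t
    exact Def.eq
  | lt s t =>
    have := DFun.termVal he s
    have := DFun.termVal he t
    exact Def.lt
  | mem t i =>
    have := DFun.termVal he t
    have : InM (V i) := ⟨hV i⟩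
    exact Def.mem'
  | neg φ ih =>
    have := ih e he
    exact Def.not
  | and φ ψ ih ih' =>
    have := ih e he
    have := ih' e he
    exact Def.and
  | or φ ψ ih ih' =>
    have := ih e he
    have := ih' e he
    exact Def.or
  | ball t φ ih =>
    have := DFun.termVal he t
    have := hx φ ih e he
    exact Def.ball (R := fun x c => M.Sat V (consVal x (fun i => e i c)) φ)
  | bex t φ ih =>
    have := DFun.termVal he t
    have := hx φ ih e he
    exact Def.bex (R := fun x c => M.Sat V (consVal x (fun i => e i c)) φ)
  | all φ ih =>
    have := hx φ ih e he
    exact Def.all (R := fun x c => M.Sat V (consVal x (fun i => e i c)) φ)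
  | ex φ ih =>
    have := hx φ ih e he
    exact Def.ex (R := fun x c => M.Sat V (consVal x (fun i => e i c)) φ)

theorem aca0 : M.ACA0 where
  basic := hM.rca.basic
  induction X hX h0 hs n :=
    have : InM X := ⟨hX⟩
    set_induction h0 hs n
  comprehension φ V hV v := by
    refine ⟨_, (Def.sat hV φ (consVal (α := M → M) (fun c => c) (fun i _ => v i)) ?_).mem, fun n => ?_⟩
    · intro i
      cases i with
      | zero => exact DFun.id
      | succ i => exact DFun.const (v i)
    · have : (fun i => consVal (α := M → M) (fun c => c) (fun i _ => v i) i n) = consVal n v := by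
        funext i
        cases i <;> rfl
      rw [Set.mem_ofPred_eq, this]

end ACA

end L2Structure

namespace L2Structure

variable {M : L2Structure.{u}} [hM : IsACA M]

/-! ### Downward recursion below a bound -/

section CodeRecursion

theorem pair_le_pair {a b c d : M} (hac : a ≤ c) (hbd : b ≤ d) : pair a b ≤ pair c d := by
  obtain ⟨x, rfl⟩ := exists_add_of_le hac
  obtain ⟨y, rfl⟩ := exists_add_of_le hbd
  unfold pair
  exact (le_iff_exists_aux _ _).2 ⟨(x + y) * (a + b) + (a + b) * (x + y) + (x + y) * (x + y) + x,
    by ring⟩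

/-- Downward recursion below a bound `c`, uniformly in `c`. -/
theorem exists_recursion_below {Φ : M → M → M → (M → M → Prop) → Prop}
    (hdef : Def fun e => Φ (fst e) (fst (snd e)) (fst (snd (snd e)))
      (fun y q => FinMem (pair y q) (snd (snd (snd e)))))
    (hloc : ∀ c x p R R', x < c → (∀ y q, x < y → y < c → q < c → (R y q ↔ R' y q)) →
      (Φ c x p R ↔ Φ c x p R')) :
    ∃ G : M → M → M → Prop, (Def fun e => G (fst e) (fst (snd e)) (snd (snd e))) ∧
      ∀ c x p, x < c → p < c → (G c x p ↔ Φ c x p (G c)) := by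
  have hΦ : ∀ f g k l : M → M, ∀ [DFun f] [DFun g] [DFun k] [DFun l],
      Def fun c => Φ (f c) (g c) (k c) (fun y q => FinMem (pair y q) (l c)) :=
    fun f g k l => Def.comp₄ (R := fun c x p w => Φ c x p (fun y q => FinMem (pair y q) w)) hdef
      ‹_› ‹_› ‹_› ‹_›
  -- `d` counts the stages settled from the top: `w` is correct at all `x < c` with `c ≤ x + d`.
  have hex : ∀ c d : M, ∃ w, ∀ x, x < c → c ≤ x + d → ∀ p, p < c →
      (FinMem (pair x p) w ↔ Φ c x p (fun y q => FinMem (pair y q) w)) := by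
    intro c d
    refine def_induction (P := fun d => ∃ w, ∀ x, x < c → c ≤ x + d → ∀ p, p < c →
      (FinMem (pair x p) w ↔ Φ c x p (fun y q => FinMem (pair y q) w))) (by infer_instance) ?_ ?_ d
    · exact ⟨0, fun x hx hc => (hx.not_ge (by simpa using hc)).elim⟩
    · rintro d ⟨w, hw⟩
      obtain ⟨w', -, hw'⟩ := exists_finCode_of_def (P := fun i => (c ≤ fst i + d ∧ FinMem i w) ∨
        (c = fst i + (d + 1) ∧ Φ c (fst i) (snd i) (fun y q => FinMem (pair y q) w)))
        (by infer_instance) (pair c c + 1)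
      have hmem : ∀ x p, x < c → p < c → (FinMem (pair x p) w' ↔ (c ≤ x + d ∧ FinMem (pair x p) w) ∨
          (c = x + (d + 1) ∧ Φ c x p (fun y q => FinMem (pair y q) w))) := by
        intro x p hx hp
        rw [hw']
        simp only [fst_pair, snd_pair, lt_add_one_iff', pair_le_pair hx.le hp.le, true_and]
      have hlt : ∀ x, c ≤ x + d → c ≠ x + (d + 1) := by
        rintro x hx rfl
        rw [← add_assoc, add_one_le_iff'] at hx
        exact hx.false
      have hold : ∀ x p, x < c → p < c → c ≤ x + d →
          (FinMem (pair x p) w' ↔ FinMem (pair x p) w) := by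
        intro x p hx hp hc
        rw [hmem x p hx hp]
        simp [hc, hlt x hc]
      refine ⟨w', fun x hx hc p hp => ?_⟩
      have hΦw : Φ c x p (fun y q => FinMem (pair y q) w) ↔
          Φ c x p (fun y q => FinMem (pair y q) w') := by
        refine hloc c x p _ _ hx fun y q hxy hy hq => (hold y q hy hq (hc.trans ?_)).symm
        rw [add_comm d 1, ← add_assoc]
        exact add_le_add_left (add_one_le_iff'.2 hxy) d
      by_cases hcd : c ≤ x + d
      · rw [hold x p hx hp hcd, hw x hx hcd p hp, hΦw]
      · have : c = x + (d + 1) := by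
          refine hc.antisymm ?_
          rw [← add_assoc, add_one_le_iff']
          exact not_le.1 hcd
        rw [hmem x p hx hp, ← hΦw]
        simp [hcd, ← this]
  -- Uniqueness permits defining the solution by `∃ w`, uniformly in `c`.
  have huniq : ∀ c w w' : M, (∀ x, x < c → ∀ p, p < c →
      (FinMem (pair x p) w ↔ Φ c x p (fun y q => FinMem (pair y q) w))) → (∀ x, x < c → ∀ p, p < c →
      (FinMem (pair x p) w' ↔ Φ c x p (fun y q => FinMem (pair y q) w'))) →
      ∀ x, x < c → ∀ p, p < c → (FinMem (pair x p) w ↔ FinMem (pair x p) w') := by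
    intro c w w' hw hw'
    have := def_induction (P := fun d => ∀ x, x < c → c ≤ x + d → ∀ p, p < c →
      (FinMem (pair x p) w ↔ FinMem (pair x p) w')) (by infer_instance) ?_ ?_ c
    · exact fun x hx p hp => this x hx le_add_self p hp
    · exact fun x hx hc => (hx.not_ge (by simpa using hc)).elim
    · intro d ih x hx hc p hp
      rw [hw x hx p hp, hw' x hx p hp]
      refine hloc c x p _ _ hx fun y q hxy hy hq => ih y hy (hc.trans ?_) q hq
      rw [add_comm d 1, ← add_assoc]
      exact add_le_add_left (add_one_le_iff'.2 hxy) d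
  refine ⟨fun c x p => ∃ w, (∀ x, x < c → ∀ p, p < c →
      (FinMem (pair x p) w ↔ Φ c x p (fun y q => FinMem (pair y q) w))) ∧ FinMem (pair x p) w,
      by infer_instance, fun c x p hx hp => ?_⟩
  obtain ⟨w, hw⟩ := hex c c
  have hw' : ∀ x, x < c → ∀ p, p < c →
      (FinMem (pair x p) w ↔ Φ c x p (fun y q => FinMem (pair y q) w)) :=
    fun x hx => hw x hx le_add_self
  have hG : ∀ x p, x < c → p < c → ((∃ w, (∀ x, x < c → ∀ p, p < c →
      (FinMem (pair x p) w ↔ Φ c x p (fun y q => FinMem (pair y q) w))) ∧ FinMem (pair x p) w) ↔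
      FinMem (pair x p) w) := by
    intro x p hx hp
    exact ⟨fun ⟨v, hv, h⟩ => (huniq c v w hv hw' x hx p hp).1 h, fun h => ⟨w, hw', h⟩⟩
  exact (hG x p hx hp).trans ((hw' x hx p hp).trans
    (hloc c x p _ _ hx fun y q _ hy hq => (hG y q hy hq).symm))

end CodeRecursion

instance Def.isNext {X : Set M} [InM X] {f g : M → M} [hf : DFun f] [hg : DFun g] :
    Def (fun c => IsNext X (f c) (g c)) :=
  Def.comp₂ (R := fun x y => IsNext X x y)
    (inferInstance : Def fun e : M => snd e ∈ X ∧ fst e < snd e ∧ ∀ z, z ∈ X → fst e < z → snd e ≤ z)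
    hf hg

theorem IsNext.exists_iff {S : Set M} {x y : M} {R : M → Prop} (h : IsNext S x y) :
    (∃ z, IsNext S x z ∧ R z) ↔ R y :=
  ⟨fun ⟨_, hz, hR⟩ => h.unique hz ▸ hR, fun hR => ⟨y, h, hR⟩⟩

/-! ### Limits over the possibly nonstandard numbers -/

section Eventually

open Filter

theorem eventually_iff_exists {φ : M → Prop} :
    (∀ᶠ b in atTop, φ b) ↔ ∃ a, ∀ b, a ≤ b → φ b := eventually_atTop

/-- As `k` may be nonstandard, closure of filters under finite intersections is not enough. The
assertion is arithmetical, so induction inside `M` applies. -/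
theorem eventually_ball {ψ : M → M → Prop} (h : Def fun e => ψ (fst e) (snd e)) {k : M}
    (hk : ∀ q < k, ∀ᶠ b in atTop, ψ q b) : ∀ᶠ b in atTop, ∀ q < k, ψ q b := by
  have hψ : ∀ f g : M → M, ∀ [DFun f] [DFun g], Def fun c => ψ (f c) (g c) :=
    fun f g => Def.comp₂ h ‹_› ‹_›
  simp only [eventually_iff_exists] at hk ⊢
  refine def_induction (P := fun k => (∀ q, q < k → ∃ a, ∀ b, a ≤ b → ψ q b) →
    ∃ a, ∀ b, a ≤ b → ∀ q, q < k → ψ q b) (by infer_instance) ?_ ?_ k hk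
  · exact fun _ => ⟨0, fun b _ q hq => (hq.not_ge zero_le).elim⟩
  · intro k ih hk
    obtain ⟨a, ha⟩ := ih fun q hq => hk q (hq.trans (lt_add_one_iff'.2 le_rfl))
    obtain ⟨a', ha'⟩ := hk k (lt_add_one_iff'.2 le_rfl)
    refine ⟨max a a', fun b hb q hq => ?_⟩
    rcases (lt_add_one_iff'.1 hq).lt_or_eq with h1 | rfl
    exacts [ha b ((le_max_left _ _).trans hb) q h1, ha' b ((le_max_right _ _).trans hb)]

theorem eventually_iff_of_const {α : Type*} {l : Filter α} [l.NeBot] {φ : α → Prop} {c : Prop}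
    (h : ∀ᶠ b in l, (φ b ↔ c)) : ((∀ᶠ b in l, φ b) ↔ c) := by
  constructor
  · intro h'
    obtain ⟨b, hb, hb'⟩ := (h.and h').exists
    exact hb.1 hb'
  · exact fun hc => h.mono fun b hb => hb.2 hc

theorem eventually_lt_seg {X : Set M} [InM X] (hXi : IsInfinite X) (k : M) :
    ∀ᶠ b in atTop, k < seg X b := by
  obtain ⟨i, hi, hki⟩ := hXi k
  filter_upwards [eventually_gt_atTop i] with b hb
  exact hki.trans (FinMem.lt (mem_codeSet_seg.2 ⟨hb, hi⟩))

end Eventually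

/-- A recursive condition `p ∈ D ↔ base p ∨ ∃ q, (pos q p ∧ q ∈ D) ∨ (neg q p ∧ q ∉ D)` on a set `D`,
where `q` always precedes `p` in a strict weak order that is well founded in the sense of `M`. -/
structure Recursion (M : L2Structure.{u}) [IsACA M] where
  base : M → Prop
  pos : M → M → Prop
  neg : M → M → Prop
  prec : M → M → Prop
  def_base : Def base
  def_pos : Def fun e => pos (fst e) (snd e)
  def_neg : Def fun e => neg (fst e) (snd e)
  def_prec : Def fun e => prec (fst e) (snd e)
  prec_of_pos : ∀ q p, pos q p → prec q p
  prec_of_neg : ∀ q p, neg q p → prec q p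
  prec_or : ∀ q p r, prec q r → prec q p ∨ prec p r
  wf : ∀ P : M → Prop, Def P → (∃ p, P p) → ∃ p, P p ∧ ∀ q, P q → ¬ prec q p

/-! ### Approximations and colours computed along finite sets -/

namespace Recursion

variable (T : Recursion M)

instance {f : M → M} [hf : DFun f] : Def (fun c => T.base (f c)) := T.def_base.comp hf
instance {f g : M → M} [hf : DFun f] [hg : DFun g] : Def (fun c => T.pos (f c) (g c)) :=
  T.def_pos.comp₂ hf hg
instance {f g : M → M} [hf : DFun f] [hg : DFun g] : Def (fun c => T.neg (f c) (g c)) :=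
  T.def_neg.comp₂ hf hg
instance {f g : M → M} [hf : DFun f] [hg : DFun g] : Def (fun c => T.prec (f c) (g c)) :=
  T.def_prec.comp₂ hf hg

/-- The recursive condition at stage `x` of `S`, with the search bounded by `x` and smaller values
taken at the next stage. -/
def Step (S : Set M) (x p : M) (R : M → M → Prop) : Prop :=
  T.base p ∨ ∃ q, q < x ∧ ((T.pos q p ∧ ∃ y, IsNext S x y ∧ R y q) ∨
    (T.neg q p ∧ ¬ ∃ y, IsNext S x y ∧ R y q))

/-- The value at `x` consults only the next element of `codeSet c`, so downward recursion below `c`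
applies. -/
theorem exists_fin : ∃ G : M → M → M → Prop, (Def fun e => G (fst e) (fst (snd e)) (snd (snd e))) ∧
    ∀ c x p, x < c → p < c → (G c x p ↔ T.Step (codeSet c) x p (G c)) := by
  refine exists_recursion_below (Φ := fun c x p R => T.Step (codeSet c) x p R) ?_ ?_
  · unfold Step
    infer_instance
  · intro c x p R R' hx hR
    refine or_congr_right (exists_congr fun q => and_congr_right fun hq => ?_)
    have : (∃ y, IsNext (codeSet c) x y ∧ R y q) ↔ ∃ y, IsNext (codeSet c) x y ∧ R' y q :=
      exists_congr fun y => and_congr_right fun hy =>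
        hR y q hy.2.1 (FinMem.lt hy.1) (hq.trans hx)
    rw [this]

/-- The approximation computed along the finite set with code `c`. -/
noncomputable def fin : M → M → M → Prop := T.exists_fin.choose

instance {f g k : M → M} [hf : DFun f] [hg : DFun g] [hk : DFun k] :
    Def (fun c => T.fin (f c) (g c) (k c)) := T.exists_fin.choose_spec.1.comp₃ hf hg hk

theorem fin_iff {c x p : M} (hx : x < c) (hp : p < c) :
    T.fin c x p ↔ T.Step (codeSet c) x p (T.fin c) := T.exists_fin.choose_spec.2 c x p hx hp

/-- `p` changes between the two stages that follow `x` in `S`. -/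
def Chg (S : Set M) (R : M → M → Prop) (x p : M) : Prop :=
  p < x ∧ ∃ y, IsNext S x y ∧ ∃ z, IsNext S y z ∧ ¬ (R y p ↔ R z p)

/-- The changes at the stage after `x` undercut those at stage `x`. -/
def Und (S : Set M) (R : M → M → Prop) (x : M) : Prop :=
  ∃ y, IsNext S x y ∧ ∃ q, Chg S R y q ∧ ∀ p, Chg S R x p → T.prec q p

/-- The recursive condition on the colouring. -/
def ColStep (S : Set M) (R : M → M → Prop) (x : M) (C : M → Prop) : Prop :=
  (∀ p, ¬ Chg S R x p) ∨ (T.Und S R x ∧ ∃ y, IsNext S x y ∧ ¬ C y)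

/-- A colour depends on the stage alone; the second argument of the recursion is a dummy, read at
`0`. -/
theorem exists_col : ∃ G : M → M → M → Prop, (Def fun e => G (fst e) (fst (snd e)) (snd (snd e))) ∧
    ∀ c x p, x < c → p < c → (G c x p ↔ T.ColStep (codeSet c) (T.fin c) x fun y => G c y 0) := by
  refine exists_recursion_below
    (Φ := fun c x _ R => T.ColStep (codeSet c) (T.fin c) x fun y => R y 0) ?_ ?_
  · unfold ColStep Und Chg
    infer_instance
  · intro c x p R R' hx hR
    refine or_congr_right (and_congr_right fun _ => exists_congr fun y => and_congr_right fun hy => ?_)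
    exact not_congr (hR y 0 hy.2.1 (FinMem.lt hy.1) (zero_le.trans_lt hx))

/-- The colour computed along the finite set with code `c`, started at `x`. -/
noncomputable def col (c x : M) : Prop := T.exists_col.choose c x 0

instance {f g : M → M} [hf : DFun f] [hg : DFun g] :
    Def (fun c => T.col (f c) (g c)) :=
  T.exists_col.choose_spec.1.comp₃ hf hg (inferInstance : DFun fun _ => 0)

theorem col_iff {c x : M} (hx : x < c) :
    T.col c x ↔ T.ColStep (codeSet c) (T.fin c) x (T.col c) :=
  T.exists_col.choose_spec.2 c x 0 hx (zero_le.trans_lt hx)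

end Recursion

end L2Structure

namespace L2Structure

variable {M : L2Structure.{u}} [hM : IsACA M]

/-! ### Convergence along infinite sets -/

namespace Recursion

open Filter

variable (T : Recursion M) {X Y : Set M} [hX : InM X] [hY : InM Y]

/-- The limit of the approximations along the initial segments of `X`. -/
def lim (X : Set M) (x p : M) : Prop := ∃ a, ∀ b, a ≤ b → T.fin (seg X b) x p

/-- The limit of the colours along the initial segments of `X`. -/
def clim (X : Set M) (x : M) : Prop := ∃ a, ∀ b, a ≤ b → T.col (seg X b) x

instance {f g : M → M} [hf : DFun f] [hg : DFun g] : Def (fun c => T.lim X (f c) (g c)) :=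
  Def.comp₂ (R := fun x p => T.lim X x p) (by unfold lim; infer_instance) hf hg

instance {f : M → M} [hf : DFun f] : Def (fun c => T.clim X (f c)) :=
  Def.comp (P := fun x => T.clim X x) (by unfold clim; infer_instance) hf

omit hX in
theorem lim_iff_eventually {x p : M} :
    T.lim X x p ↔ ∀ᶠ b in atTop, T.fin (seg X b) x p := eventually_iff_exists.symm

omit hX in
theorem clim_iff_eventually {x : M} :
    T.clim X x ↔ ∀ᶠ b in atTop, T.col (seg X b) x := eventually_iff_exists.symm

/-- A step consults only predecessors `q < x` at the stage `y`; `eventually_ball` makes their values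
settle simultaneously. -/
theorem eventually_step (hXi : IsInfinite X) {x y p : M} (hy : IsNext X x y)
    (h : ∀ q, T.prec q p → ∀ᶠ b in atTop, (T.fin (seg X b) y q ↔ T.lim X y q)) :
    ∀ᶠ b in atTop, (T.fin (seg X b) x p ↔ T.Step X x p (T.lim X)) := by
  have h' : ∀ᶠ b in atTop, ∀ q < x, T.prec q p → (T.fin (seg X b) y q ↔ T.lim X y q) := by
    refine eventually_ball (ψ := fun q b => T.prec q p → (T.fin (seg X b) y q ↔ T.lim X y q))
      (by infer_instance) fun q _ => ?_
    by_cases hq : T.prec q p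
    · exact (h q hq).mono fun b hb _ => hb
    · exact Eventually.of_forall fun b hb => (hq hb).elim
  filter_upwards [h', eventually_gt_atTop y, eventually_lt_seg hXi x, eventually_lt_seg hXi p]
    with b hb hyb hx hp
  rw [T.fin_iff hx hp]
  refine or_congr_right (exists_congr fun q => and_congr_right fun hq => ?_)
  rw [((isNext_seg_iff hyb).2 hy).exists_iff (R := fun y => T.fin (seg X b) y q),
    hy.exists_iff (R := fun y => T.lim X y q)]
  refine or_congr (and_congr_right fun hqp => hb q hq (T.prec_of_pos q p hqp))
    (and_congr_right fun hqp => not_congr (hb q hq (T.prec_of_neg q p hqp)))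

/-- For a minimal `p` whose values diverge at some stage, all predecessors converge at the next
stage, and then `eventually_step` gives convergence for `p`. This replaces a definition of the
values by transfinite recursion, which is not yet available. -/
theorem eventually_fin_iff (hXi : IsInfinite X) (x p : M) :
    ∀ᶠ b in atTop, (T.fin (seg X b) x p ↔ T.lim X x p) := by
  by_contra hno
  obtain ⟨p, ⟨x, hx⟩, hmin⟩ := T.wf (fun p => ∃ x, ¬ ∃ a, ∀ b, a ≤ b →
    (T.fin (seg X b) x p ↔ T.lim X x p)) (by infer_instance)
    ⟨p, x, fun h => hno (eventually_iff_exists.2 h)⟩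
  rw [← eventually_iff_exists] at hx
  obtain ⟨y, hy⟩ := exists_isNext hXi x
  have hs := T.eventually_step hXi hy (p := p) fun q hq => by
    by_contra hno
    exact hmin q ⟨y, fun h => hno (eventually_iff_exists.2 h)⟩ hq
  refine hx ?_
  rw [T.lim_iff_eventually, eventually_iff_of_const hs]
  exact hs

theorem lim_iff (hXi : IsInfinite X) {x p : M} :
    T.lim X x p ↔ T.Step X x p (T.lim X) := by
  obtain ⟨y, hy⟩ := exists_isNext hXi x
  obtain ⟨b, h1, h2⟩ := ((T.eventually_fin_iff hXi x p).and
    (T.eventually_step hXi hy (p := p) fun q _ => T.eventually_fin_iff hXi y q)).exists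
  rw [← h1, h2]

omit hX in
theorem chg_iff {S : Set M} {R : M → M → Prop} {x y z p : M} (hy : IsNext S x y)
    (hz : IsNext S y z) : Chg S R x p ↔ p < x ∧ ¬ (R y p ↔ R z p) := by
  rw [Chg, hy.exists_iff (R := fun y => ∃ z, IsNext S y z ∧ ¬ (R y p ↔ R z p)),
    hz.exists_iff (R := fun z => ¬ (R y p ↔ R z p))]

omit hX in
theorem und_iff {S : Set M} {R : M → M → Prop} {x y : M} (hy : IsNext S x y) :
    T.Und S R x ↔ ∃ q, Chg S R y q ∧ ∀ p, Chg S R x p → T.prec q p :=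
  hy.exists_iff (R := fun y => ∃ q, Chg S R y q ∧ ∀ p, Chg S R x p → T.prec q p)

theorem eventually_chg_iff (hXi : IsInfinite X) (x : M) : ∀ᶠ b in atTop,
    ∀ p, (Chg (codeSet (seg X b)) (T.fin (seg X b)) x p ↔ Chg X (T.lim X) x p) := by
  obtain ⟨y, hy⟩ := exists_isNext hXi x
  obtain ⟨z, hz⟩ := exists_isNext hXi y
  have h : ∀ w, ∀ᶠ b in atTop, ∀ p < x, (T.fin (seg X b) w p ↔ T.lim X w p) := fun w =>
    eventually_ball (ψ := fun p b => (T.fin (seg X b) w p ↔ T.lim X w p)) (by infer_instance)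
      fun p _ => T.eventually_fin_iff hXi w p
  filter_upwards [h y, h z, eventually_gt_atTop y, eventually_gt_atTop z] with b h1 h2 h3 h4 p
  rw [chg_iff ((isNext_seg_iff h3).2 hy) ((isNext_seg_iff h4).2 hz), chg_iff hy hz]
  refine and_congr_right fun hp => ?_
  rw [h1 p hp, h2 p hp]

theorem eventually_und_iff (hXi : IsInfinite X) (x : M) : ∀ᶠ b in atTop,
    (T.Und (codeSet (seg X b)) (T.fin (seg X b)) x ↔ T.Und X (T.lim X) x) := by
  obtain ⟨y, hy⟩ := exists_isNext hXi x
  filter_upwards [T.eventually_chg_iff hXi x, T.eventually_chg_iff hXi y, eventually_gt_atTop y]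
    with b h1 h2 h3
  rw [T.und_iff ((isNext_seg_iff h3).2 hy), T.und_iff hy]
  simp only [h1, h2]

/-- The colour of the next stage matters only when undercutting occurs, hence the conditional
hypothesis. -/
theorem eventually_colStep (hXi : IsInfinite X) {x y : M} (hy : IsNext X x y)
    (h : T.Und X (T.lim X) x → ∀ᶠ b in atTop, (T.col (seg X b) y ↔ T.clim X y)) :
    ∀ᶠ b in atTop, (T.col (seg X b) x ↔ T.ColStep X (T.lim X) x (T.clim X)) := by
  have h' : ∀ᶠ b in atTop, T.Und X (T.lim X) x → (T.col (seg X b) y ↔ T.clim X y) := by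
    by_cases hU : T.Und X (T.lim X) x
    · exact (h hU).mono fun b hb _ => hb
    · exact Eventually.of_forall fun b hb => (hU hb).elim
  filter_upwards [h', T.eventually_chg_iff hXi x, T.eventually_und_iff hXi x,
    eventually_gt_atTop y, eventually_lt_seg hXi x] with b h1 h2 h3 h4 h5
  rw [T.col_iff h5, ColStep, ColStep, h3, ((isNext_seg_iff h4).2 hy).exists_iff
    (R := fun y => ¬ T.col (seg X b) y), hy.exists_iff (R := fun y => ¬ T.clim X y)]
  simp only [h2]
  exact or_congr_right (and_congr_right fun hU => not_congr (h1 hU))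

instance {f g : M → M} [hf : DFun f] [hg : DFun g] :
    Def (fun c => Chg X (T.lim X) (f c) (g c)) :=
  Def.comp₂ (R := fun x p => Chg X (T.lim X) x p) (by unfold Chg; infer_instance) hf hg

/-- Divergence at `x` forces undercutting at `x` and divergence at the next stage, where some change
precedes all changes at `x`. Hence the changes at divergent stages have no minimal element. -/
theorem eventually_col_iff (hXi : IsInfinite X) (x : M) :
    ∀ᶠ b in atTop, (T.col (seg X b) x ↔ T.clim X x) := by
  by_contra hno
  have key : ∀ x y, IsNext X x y → (¬ ∀ᶠ b in atTop, (T.col (seg X b) x ↔ T.clim X x)) →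
      T.Und X (T.lim X) x ∧ ¬ ∀ᶠ b in atTop, (T.col (seg X b) y ↔ T.clim X y) := by
    intro x y hy hx
    by_contra hn
    have hs := T.eventually_colStep hXi hy fun hU => by
      by_contra hn'
      exact hn ⟨hU, hn'⟩
    refine hx ?_
    rw [T.clim_iff_eventually, eventually_iff_of_const hs]
    exact hs
  simp only [eventually_iff_exists] at key hno
  obtain ⟨y, hy⟩ := exists_isNext hXi x
  obtain ⟨hU, hyn⟩ := key x y hy hno
  -- The undercutting change at `y` shows that the set to be minimized is nonempty.
  obtain ⟨q, hq, -⟩ := (T.und_iff hy).1 hU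
  obtain ⟨p, ⟨x, hx, hxp⟩, hmin⟩ := T.wf (fun p => ∃ x, (¬ ∃ a, ∀ b, a ≤ b →
    (T.col (seg X b) x ↔ T.clim X x)) ∧ Chg X (T.lim X) x p) (by infer_instance) ⟨q, y, hyn, hq⟩
  obtain ⟨y, hy⟩ := exists_isNext hXi x
  obtain ⟨hU, hyn⟩ := key x y hy hx
  obtain ⟨q, hq, hqp⟩ := (T.und_iff hy).1 hU
  exact hmin q ⟨y, hyn, hq⟩ (hqp p hxp)

theorem clim_iff (hXi : IsInfinite X) {x : M} :
    T.clim X x ↔ T.ColStep X (T.lim X) x (T.clim X) := by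
  obtain ⟨y, hy⟩ := exists_isNext hXi x
  obtain ⟨b, h1, h2⟩ := ((T.eventually_col_iff hXi x).and
    (T.eventually_colStep hXi hy fun _ => T.eventually_col_iff hXi y)).exists
  rw [← h1, h2]

/-- The limit values at `x` depend only on the part of the set above `x`. -/
theorem lim_congr (hXi : IsInfinite X) (hYi : IsInfinite Y) {y : M}
    (hXY : ∀ z, y ≤ z → (z ∈ X ↔ z ∈ Y)) {x : M} (hx : y ≤ x) (p : M) :
    T.lim X x p ↔ T.lim Y x p := by
  by_contra hno
  obtain ⟨p, ⟨x, hx, hxp⟩, hmin⟩ := T.wf (fun p => ∃ x, y ≤ x ∧ ¬ (T.lim X x p ↔ T.lim Y x p))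
    (by infer_instance) ⟨p, x, hx, hno⟩
  refine hxp ?_
  obtain ⟨w, hw⟩ := exists_isNext hXi x
  have hw' := (isNext_congr hXY hx).1 hw
  have ih : ∀ q, T.prec q p → (T.lim X w q ↔ T.lim Y w q) := by
    intro q hq
    by_contra hn
    exact hmin q ⟨w, hx.trans hw.2.1.le, hn⟩ hq
  rw [T.lim_iff hXi, T.lim_iff hYi]
  refine or_congr_right (exists_congr fun q => and_congr_right fun hq => ?_)
  rw [hw.exists_iff (R := fun y => T.lim X y q), hw'.exists_iff (R := fun y => T.lim Y y q)]
  exact or_congr (and_congr_right fun hqp => ih q (T.prec_of_pos q p hqp))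
    (and_congr_right fun hqp => not_congr (ih q (T.prec_of_neg q p hqp)))

theorem chg_congr (hXi : IsInfinite X) (hYi : IsInfinite Y) {y : M}
    (hXY : ∀ z, y ≤ z → (z ∈ X ↔ z ∈ Y)) {x : M} (hx : y ≤ x) (p : M) :
    Chg X (T.lim X) x p ↔ Chg Y (T.lim Y) x p := by
  obtain ⟨w, hw⟩ := exists_isNext hXi x
  obtain ⟨v, hv⟩ := exists_isNext hXi w
  have hxw := hx.trans hw.2.1.le
  rw [chg_iff hw hv, chg_iff ((isNext_congr hXY hx).1 hw) ((isNext_congr hXY hxw).1 hv),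
    T.lim_congr hXi hYi hXY hxw, T.lim_congr hXi hYi hXY (hxw.trans hv.2.1.le)]

theorem und_congr (hXi : IsInfinite X) (hYi : IsInfinite Y) {y : M}
    (hXY : ∀ z, y ≤ z → (z ∈ X ↔ z ∈ Y)) {x : M} (hx : y ≤ x) :
    T.Und X (T.lim X) x ↔ T.Und Y (T.lim Y) x := by
  obtain ⟨w, hw⟩ := exists_isNext hXi x
  rw [T.und_iff hw, T.und_iff ((isNext_congr hXY hx).1 hw)]
  simp only [T.chg_congr hXi hYi hXY hx, T.chg_congr hXi hYi hXY (hx.trans hw.2.1.le)]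

/-- The descent of `eventually_col_iff`, with disagreement of the two colours in place of
divergence. -/
theorem clim_congr (hXi : IsInfinite X) (hYi : IsInfinite Y) {y : M}
    (hXY : ∀ z, y ≤ z → (z ∈ X ↔ z ∈ Y)) {x : M} (hx : y ≤ x) :
    T.clim X x ↔ T.clim Y x := by
  by_contra hno
  have key : ∀ x w, y ≤ x → IsNext X x w → ¬ (T.clim X x ↔ T.clim Y x) →
      T.Und X (T.lim X) x ∧ ¬ (T.clim X w ↔ T.clim Y w) := by
    intro x w hx hw hn
    by_contra hn'
    refine hn ?_
    rw [T.clim_iff hXi, T.clim_iff hYi, ColStep, ColStep, hw.exists_iff (R := fun y => ¬ T.clim X y),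
      ((isNext_congr hXY hx).1 hw).exists_iff (R := fun y => ¬ T.clim Y y),
      ← T.und_congr hXi hYi hXY hx]
    simp only [T.chg_congr hXi hYi hXY hx]
    refine or_congr_right (and_congr_right fun hU => not_congr ?_)
    by_contra hc
    exact hn' ⟨hU, hc⟩
  obtain ⟨w, hw⟩ := exists_isNext hXi x
  obtain ⟨hU, hwn⟩ := key x w hx hw hno
  obtain ⟨q, hq, -⟩ := (T.und_iff hw).1 hU
  obtain ⟨p, ⟨x, hx, hxn, hxp⟩, hmin⟩ := T.wf (fun p => ∃ x, y ≤ x ∧ ¬ (T.clim X x ↔ T.clim Y x) ∧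
    Chg X (T.lim X) x p) (by infer_instance) ⟨q, w, hx.trans hw.2.1.le, hwn, hq⟩
  obtain ⟨w, hw⟩ := exists_isNext hXi x
  obtain ⟨hU, hwn⟩ := key x w hx hw hxn
  obtain ⟨q, hq, hqp⟩ := (T.und_iff hw).1 hU
  exact hmin q ⟨w, hx.trans hw.2.1.le, hwn, hq⟩ (hqp p hxp)

/-! ### Homogeneous sets and solutions of recursive conditions -/

/-- The codes that receive the first colour. -/
def goodCodes : Set M := {c | ∃ x, IsLeast (codeSet c) x ∧ T.col c x}

instance : InM T.goodCodes := by unfold goodCodes; infer_instance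

theorem eventually_goodCodes_iff (hXi : IsInfinite X) {x : M} (hx : IsLeast X x) :
    ∀ᶠ b in atTop, (seg X b ∈ T.goodCodes ↔ T.clim X x) := by
  filter_upwards [T.eventually_col_iff hXi x, eventually_gt_atTop x] with b h1 h2
  rw [← h1]
  constructor
  · rintro ⟨x', hx', h⟩
    rwa [(isLeast_seg hx h2).unique hx']
  · exact fun h => ⟨x, isLeast_seg hx h2, h⟩

/-- `p` changes from stage `y` of `X` to the next. -/
def Chg₁ (X : Set M) (y p : M) : Prop := ∃ z, IsNext X y z ∧ ¬ (T.lim X y p ↔ T.lim X z p)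

instance {f g : M → M} [hf : DFun f] [hg : DFun g] : Def (fun c => T.Chg₁ X (f c) (g c)) :=
  Def.comp₂ (R := fun x p => T.Chg₁ X x p) (by unfold Chg₁; infer_instance) hf hg

/-- In the cut, `x` acts only as the bound on the changes considered at `y`; by `lim_congr` the
values are those of `X`. From `y` on, the cut agrees with `cut X y y'`, so the recursive call
concerns another cut of `X`. -/
theorem clim_cut (hXi : IsInfinite X) {x y y' : M} (hy : y ∈ X) (hxy : x < y)
    (hy' : IsNext X y y') : (T.clim (cut X x y) x ↔ (∀ p < x, ¬ T.Chg₁ X y p) ∨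
      ((∃ q < y, T.Chg₁ X y' q ∧ ∀ p < x, T.Chg₁ X y p → T.prec q p) ∧
        ¬ T.clim (cut X y y') y)) := by
  have hci : IsInfinite (cut X x y) := isInfinite_cut hXi
  have hcong : ∀ z, y ≤ z → (z ∈ cut X x y ↔ z ∈ X) := fun z hz => mem_cut_iff hxy hz
  have hcong' : ∀ z, y ≤ z → (z ∈ cut X x y ↔ z ∈ cut X y y') := by
    intro z hz
    rw [hcong z hz]
    rcases hz.lt_or_eq with h1 | rfl
    · exact ⟨fun h => .inr ⟨h, hy'.2.2 z h h1⟩, fun h => cut_subset hy h⟩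
    · exact ⟨fun _ => .inl rfl, fun _ => hy⟩
  have hyn : IsNext (cut X x y) x y := isNext_cut hy hxy
  have hyn' : IsNext (cut X x y) y y' := (isNext_congr hcong le_rfl).2 hy'
  have h1 : ∀ p, Chg (cut X x y) (T.lim (cut X x y)) x p ↔ p < x ∧ T.Chg₁ X y p := by
    intro p
    rw [chg_iff hyn hyn', Chg₁, hy'.exists_iff (R := fun z => ¬ (T.lim X y p ↔ T.lim X z p)),
      T.lim_congr hci hXi hcong le_rfl, T.lim_congr hci hXi hcong hy'.2.1.le]
  have h2 : ∀ p, Chg (cut X x y) (T.lim (cut X x y)) y p ↔ p < y ∧ T.Chg₁ X y' p := by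
    intro p
    obtain ⟨z, hz⟩ := exists_isNext hXi y'
    rw [T.chg_congr hci hXi hcong le_rfl, chg_iff hy' hz, Chg₁,
      hz.exists_iff (R := fun z => ¬ (T.lim X y' p ↔ T.lim X z p))]
  rw [T.clim_iff hci, ColStep, T.und_iff hyn, hyn.exists_iff (R := fun w => ¬ T.clim (cut X x y) w),
    T.clim_congr hci (isInfinite_cut hXi) hcong' le_rfl]
  simp only [h1, h2, not_and, and_imp, and_assoc]

/-- All cuts share one colour. For the first colour, the alternative requiring `¬ clim` of the next
cut drops out; for the second, this requirement is automatic, so undercutting itself must fail. -/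
theorem exists_homogeneous (hRT : M.CofiniteDelta02RT) : ∃ X : Set M, InM X ∧ IsInfinite X ∧
    ((∀ x y, x ∈ X → y ∈ X → x < y → ∀ p < x, ¬ T.Chg₁ X y p) ∨
    ∀ x y y', x ∈ X → y ∈ X → x < y → IsNext X y y' → (∃ p < x, T.Chg₁ X y p) ∧
      ∀ q < y, T.Chg₁ X y' q → ∃ p < x, T.Chg₁ X y p ∧ ¬ T.prec q p) := by
  obtain ⟨X, hX, hXi, hhom⟩ := L2Structure.exists_homogeneous hRT T.goodCodes (fun X hX hXi => by
    obtain ⟨x, hx⟩ := exists_isLeast hXi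
    have := T.eventually_goodCodes_iff hXi hx
    by_cases h : T.clim X x
    · exact .inl (this.mono fun b hb => hb.2 h)
    · exact .inr (this.mono fun b hb hb' => h (hb.1 hb')))
  have hcut : ∀ x y, x ∈ X → y ∈ X → x < y →
      ∀ᶠ b in atTop, (seg (cut X x y) b ∈ T.goodCodes ↔ T.clim (cut X x y) x) :=
    fun x y hx hy hxy => T.eventually_goodCodes_iff (isInfinite_cut hXi) (isLeast_cut hxy)
  refine ⟨X, hX, hXi, ?_⟩
  rcases hhom with hhom | hhom
  · left
    have hall : ∀ x y, x ∈ X → y ∈ X → x < y → T.clim (cut X x y) x := by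
      intro x y hx hy hxy
      obtain ⟨b, h1, h2⟩ := ((hhom _ inferInstance (isInfinite_cut hXi) (cut_subset hx)
        isFinite_diff_cut).and (hcut x y hx hy hxy)).exists
      exact h2.1 h1
    intro x y hx hy hxy
    obtain ⟨y', hy'⟩ := exists_isNext hXi y
    exact ((T.clim_cut hXi hy hxy hy').1 (hall x y hx hy hxy)).resolve_right fun h =>
      h.2 (hall y y' hy hy'.1 hy'.2.1)
  · right
    have hall : ∀ x y, x ∈ X → y ∈ X → x < y → ¬ T.clim (cut X x y) x := by
      intro x y hx hy hxy
      obtain ⟨b, h1, h2⟩ := ((hhom _ inferInstance (isInfinite_cut hXi) (cut_subset hx)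
        isFinite_diff_cut).and (hcut x y hx hy hxy)).exists
      exact fun h => h1 (h2.2 h)
    intro x y y' hx hy hxy hy'
    have h := hall x y hx hy hxy
    rw [T.clim_cut hXi hy hxy hy', not_or] at h
    refine ⟨by simpa using h.1, fun q hq hqc => ?_⟩
    by_contra hno
    push Not at hno
    exact h.2 ⟨⟨q, hq, hqc, hno⟩, hall y y' hy hy'.1 hy'.2.1⟩

/-- From `1` to `0` a value changes only if a preceding value changes at the next stage. -/
theorem exists_chg_of_drop (hXi : IsInfinite X) {y y' p : M} (hy' : IsNext X y y')
    (h : T.lim X y p) (h' : ¬ T.lim X y' p) : ∃ q < y, T.prec q p ∧ T.Chg₁ X y' q := by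
  obtain ⟨z, hz⟩ := exists_isNext hXi y'
  rw [T.lim_iff hXi] at h h'
  rcases h with h | ⟨q, hq, h⟩
  · exact (h' (.inl h)).elim
  -- The witness `q < y` is still admitted at `y'`, so `p` can drop only if the value of `q` differs
  -- between `y'` and `z`.
  refine ⟨q, hq, ?_, z, hz, fun hiff => h' (.inr ⟨q, hq.trans hy'.2.1, ?_⟩)⟩
  · rcases h with h | h
    exacts [T.prec_of_pos q p h.1, T.prec_of_neg q p h.1]
  · rw [hz.exists_iff (R := fun y => T.lim X y q), ← hiff]
    rwa [hy'.exists_iff (R := fun y => T.lim X y q)] at h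

/-- A minimal `p < x` among those changing infinitely often can eventually only rise, and a rising
value changes at most once. -/
theorem not_all_chg (hXi : IsInfinite X) : ¬ ∀ x y y', x ∈ X → y ∈ X → x < y → IsNext X y y' →
    (∃ p < x, T.Chg₁ X y p) ∧ ∀ q < y, T.Chg₁ X y' q → ∃ p < x, T.Chg₁ X y p ∧ ¬ T.prec q p := by
  intro H
  obtain ⟨x, hx, -⟩ := hXi 0
  -- beyond `b`, only those `p < x` change that change infinitely often
  obtain ⟨b, hb⟩ : ∃ b, ∀ y, b ≤ y → ∀ p < x, y ∈ X → T.Chg₁ X y p →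
      ∀ c, ∃ y, y ∈ X ∧ c < y ∧ T.Chg₁ X y p := by
    refine eventually_iff_exists.1 (eventually_ball
      (ψ := fun p y => y ∈ X → T.Chg₁ X y p → ∀ c, ∃ y, y ∈ X ∧ c < y ∧ T.Chg₁ X y p)
      (by infer_instance) fun p _ => ?_)
    by_cases hp : ∀ c, ∃ y, y ∈ X ∧ c < y ∧ T.Chg₁ X y p
    · exact Eventually.of_forall fun _ _ _ => hp
    · push Not at hp
      obtain ⟨c, hc⟩ := hp
      filter_upwards [eventually_gt_atTop c] with y hy hyX hyc
      exact (hc y hyX hy hyc).elim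
  obtain ⟨y₀, hy₀, hby₀⟩ := hXi (max b x)
  obtain ⟨y₀', hy₀'⟩ := exists_isNext hXi y₀
  have hb₀ : b ≤ y₀ := (le_max_left _ _).trans hby₀.le
  have hx₀ : x < y₀ := (le_max_right _ _).trans_lt hby₀
  obtain ⟨⟨p₀, hp₀, hpc⟩, -⟩ := H x y₀ y₀' hx hy₀ hx₀ hy₀'
  obtain ⟨p, ⟨hpx, hp⟩, hmin⟩ := T.wf
    (fun p => p < x ∧ ∀ c, ∃ y, y ∈ X ∧ c < y ∧ T.Chg₁ X y p) (by infer_instance)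
    ⟨p₀, hp₀, hb y₀ hb₀ p₀ hp₀ hy₀ hpc⟩
  have hmono : ∀ y y', y ∈ X → y₀ ≤ y → T.lim X y p → IsNext X y y' → T.lim X y' p := by
    intro y y' hy hyy h hy'
    by_contra h'
    obtain ⟨q, hqy, hqp, hqc⟩ := T.exists_chg_of_drop hXi hy' h h'
    obtain ⟨r, hr, hrc, hrq⟩ := (H x y y' hx hy (hx₀.trans_le hyy) hy').2 q hqy hqc
    have hrinf := hb y (hb₀.trans hyy) r hr hy hrc
    -- Either `q` precedes `r`, against the choice of `r`, or `r` precedes `p`, against the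
    -- minimality of `p`.
    rcases T.prec_or q r p hqp with h1 | h1
    exacts [hrq h1, hmin r ⟨hr, hrinf⟩ h1]
  obtain ⟨y₁, hy₁, hyy₁, z, hz, hchg⟩ := hp y₀
  have hup : T.lim X z p := by
    by_cases h : T.lim X y₁ p
    · exact hmono y₁ z hy₁ hyy₁.le h hz
    · by_contra h'
      exact hchg ⟨fun h'' => (h h'').elim, fun h'' => (h' h'').elim⟩
  -- `p` is true at `z` and stays true, so this further change is impossible.
  obtain ⟨y₂, hy₂, hzy₂, w, hw, hchg₂⟩ := hp z
  have hz₀ : y₀ ≤ z := hyy₁.le.trans hz.2.1.le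
  have hup₂ : T.lim X y₂ p := isNext_induction (X := X) (P := fun y => T.lim X y p) inferInstance
    hz.1 hup (fun y y' hy hyy h hy' => hmono y y' hy (hz₀.trans hyy) h hy') hy₂ hzy₂.le
  exact hchg₂ ⟨fun _ => hmono y₂ w hy₂ (hz₀.trans hzy₂.le) hup₂ hw, fun _ => hup₂⟩

/-- Solutions of well founded recursive conditions exist. -/
theorem exists_solution (hRT : M.CofiniteDelta02RT) : ∃ D : M → Prop, Def D ∧
    ∀ p, D p ↔ T.base p ∨ ∃ q, (T.pos q p ∧ D q) ∨ (T.neg q p ∧ ¬ D q) := by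
  obtain ⟨X, hX, hXi, H | H⟩ := T.exists_homogeneous hRT
  · have hstep : ∀ p x y, x ∈ X → y ∈ X → p < x → x < y → ∀ z ∈ X, y ≤ z →
        (T.lim X z p ↔ T.lim X y p) := by
      intro p x y hx hy hpx hxy z hz hyz
      refine isNext_induction (X := X) (P := fun z => T.lim X z p ↔ T.lim X y p)
        (by infer_instance) hy Iff.rfl (fun z w hz hyz h hw => ?_) hz hyz
      by_contra hn
      exact H x z hx hz (hxy.trans_le hyz) p hpx ⟨w, hw, fun h' => hn (h'.symm.trans h)⟩
    have huniq : ∀ p x y x' y', x ∈ X → y ∈ X → p < x → x < y → x' ∈ X → y' ∈ X → p < x' →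
        x' < y' → (T.lim X y p ↔ T.lim X y' p) := by
      intro p x y x' y' hx hy hpx hxy hx' hy' hpx' hxy'
      obtain ⟨z, hz, hz'⟩ := hXi (max y y')
      rw [← hstep p x y hx hy hpx hxy z hz ((le_max_left _ _).trans hz'.le),
        ← hstep p x' y' hx' hy' hpx' hxy' z hz ((le_max_right _ _).trans hz'.le)]
    have hD : ∀ p x y, x ∈ X → y ∈ X → p < x → x < y →
        ((∃ x, x ∈ X ∧ ∃ y, y ∈ X ∧ p < x ∧ x < y ∧ T.lim X y p) ↔ T.lim X y p) := by
      intro p x y hx hy hpx hxy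
      exact ⟨fun ⟨x', hx', y', hy', h1, h2, h⟩ => (huniq p x' y' x y hx' hy' h1 h2 hx hy hpx hxy).1 h,
        fun h => ⟨x, hx, y, hy, hpx, hxy, h⟩⟩
    refine ⟨fun p => ∃ x, x ∈ X ∧ ∃ y, y ∈ X ∧ p < x ∧ x < y ∧ T.lim X y p, by infer_instance,
      fun p => ?_⟩
    -- For `q < x` the value at the stage after `x` is already final, so the step at `x` tests the
    -- recursive condition with the search restricted to `q < x`.
    have hcomp : ∀ x y q, x ∈ X → IsNext X x y → q < x →
        (((T.pos q p ∧ ∃ x, x ∈ X ∧ ∃ y, y ∈ X ∧ q < x ∧ x < y ∧ T.lim X y q) ∨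
          (T.neg q p ∧ ¬ ∃ x, x ∈ X ∧ ∃ y, y ∈ X ∧ q < x ∧ x < y ∧ T.lim X y q)) ↔
        ((T.pos q p ∧ ∃ z, IsNext X x z ∧ T.lim X z q) ∨
          (T.neg q p ∧ ¬ ∃ z, IsNext X x z ∧ T.lim X z q))) := by
      intro x y q hx hy hq
      rw [hD q x y hx hy.1 hq hy.2.1, hy.exists_iff (R := fun z => T.lim X z q)]
    constructor
    · rintro ⟨x, hx, y, hy, hpx, hxy, h⟩
      rw [T.lim_iff hXi] at h
      refine h.imp id ?_
      rintro ⟨q, hq, h⟩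
      obtain ⟨z, hz⟩ := exists_isNext hXi y
      exact ⟨q, (hcomp y z q hy hz hq).2 h⟩
    · intro h
      have hq : ∃ q, T.base p ∨ ((T.pos q p ∧ ∃ x, x ∈ X ∧ ∃ y, y ∈ X ∧ q < x ∧ x < y ∧ T.lim X y q) ∨
          (T.neg q p ∧ ¬ ∃ x, x ∈ X ∧ ∃ y, y ∈ X ∧ q < x ∧ x < y ∧ T.lim X y q)) := by
        rcases h with h | ⟨q, h⟩
        exacts [⟨0, .inl h⟩, ⟨q, .inr h⟩]
      obtain ⟨q, hq⟩ := hq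
      obtain ⟨x, hx, hxm⟩ := hXi (max p q)
      obtain ⟨y, hy, hxy⟩ := hXi x
      obtain ⟨z, hz⟩ := exists_isNext hXi y
      have hqx : q < x := (le_max_right _ _).trans_lt hxm
      refine ⟨x, hx, y, hy, (le_max_left _ _).trans_lt hxm, hxy, (T.lim_iff hXi).2 ?_⟩
      exact hq.imp id fun hq => ⟨q, hqx.trans hxy, (hcomp y z q hy hz (hqx.trans hxy)).1 hq⟩
  · exact (T.not_all_chg hXi H).elim

end Recursion

end L2Structure

namespace L2Structure

variable {M : L2Structure.{u}} [hM : IsACA M]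

/-! ### Definable choice and iteration -/

section Choice

/-- Definable choice. -/
theorem exists_choice {R : M → M → Prop} (h : Def fun e => R (fst e) (snd e)) :
    ∃ g : M → M, DFun g ∧ ∀ a, (∃ b, R b a) → R (g a) a := by
  have hR : ∀ f g : M → M, ∀ [DFun f] [DFun g], Def fun c => R (f c) (g c) :=
    fun f g => Def.comp₂ h ‹_› ‹_›
  -- Taking the least witness, and `0` if there is none, makes the function total and its graph
  -- definable.
  have hex : ∀ a, ∃ b, (R b a ∧ ∀ b', b' < b → ¬ R b' a) ∨ ((¬ ∃ b, R b a) ∧ b = 0) := by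
    intro a
    by_cases ha : ∃ b, R b a
    · have hRa : Def fun b => R b a := hR (fun b => b) fun _ => a
      obtain ⟨b, hb⟩ := exists_least hRa ha
      exact ⟨b, .inl hb⟩
    · exact ⟨0, .inr ⟨ha, rfl⟩⟩
  choose g hg using hex
  refine ⟨g, DFun.of_graph ?_, fun a ha => ?_⟩
  · refine Def.of_iff (fun e : M => (R (fst e) (snd e) ∧ ∀ b', b' < fst e → ¬ R b' (snd e)) ∨
      ((¬ ∃ b, R b (snd e)) ∧ fst e = 0)) fun e => ?_
    constructor
    · rintro (h1 | h1) <;> rcases hg (snd e) with h2 | h2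
      · rcases lt_trichotomy (fst e) (g (snd e)) with h3 | h3 | h3
        exacts [(h2.2 _ h3 h1.1).elim, h3, (h1.2 _ h3 h2.1).elim]
      · exact (h2.1 ⟨_, h1.1⟩).elim
      · exact (h1.1 ⟨_, h2.1⟩).elim
      · rw [h1.2, h2.2]
    · intro he
      rw [he]
      exact hg (snd e)
  · exact ((hg a).resolve_right fun h => h.1 ha).1

theorem exists_dFun_ite {P : M → Prop} [Def P] {f g : M → M} [hf : DFun f] [hg : DFun g] :
    ∃ k : M → M, DFun k ∧ (∀ c, P c → k c = f c) ∧ ∀ c, ¬ P c → k c = g c := by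
  have h1 : Def fun e : M => fst e = f (snd e) := by
    have := hf.comp DFun.snd_base
    infer_instance
  have h2 : Def fun e : M => fst e = g (snd e) := by
    have := hg.comp DFun.snd_base
    infer_instance
  have h3 : Def fun e : M => P (snd e) := Def.comp ‹_› DFun.snd_base
  obtain ⟨k, hk, hk'⟩ := exists_choice (R := fun b a => (P a ∧ b = f a) ∨ (¬ P a ∧ b = g a))
    (by infer_instance)
  refine ⟨k, hk, fun c hc => ?_, fun c hc => ?_⟩
  · simpa [hc] using hk' c ⟨f c, .inl ⟨hc, rfl⟩⟩
  · simpa [hc] using hk' c ⟨g c, .inr ⟨hc, rfl⟩⟩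

/-- The condition defining the iteration of `g` from `a`. -/
def iterateRecursion (g : M → M) [hg : DFun g] (a : M) : Recursion M where
  base p := fst p = 0 ∧ snd p = a
  pos q p := fst p = fst q + 1 ∧ snd p = g (snd q)
  neg _ _ := False
  prec q p := fst q < fst p
  def_base := inferInstance
  def_pos := by
    have : DFun fun e : M => g (snd (fst e)) := hg.comp inferInstance
    infer_instance
  def_neg := inferInstance
  def_prec := inferInstance
  prec_of_pos q p h := by rw [h.1, lt_add_one_iff']
  prec_of_neg _ _ h := h.elim
  prec_or q p r h := (lt_or_ge (fst q) (fst p)).imp id fun h' => h'.trans_lt h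
  wf P hP hne := by
    have : Def fun e : M => P (fst e) := hP.comp DFun.fst_base
    obtain ⟨p, hp⟩ := hne
    obtain ⟨n, ⟨q, hq, rfl⟩, hmin⟩ := exists_least (P := fun n => ∃ p, P p ∧ fst p = n)
      (by infer_instance) ⟨_, p, hp, rfl⟩
    exact ⟨q, hq, fun r hr hlt => hmin _ hlt ⟨r, hr, rfl⟩⟩

/-- Definable functions can be iterated. -/
theorem exists_iterate (hRT : M.CofiniteDelta02RT) (g : M → M) [hg : DFun g] (a : M) :
    ∃ D : M → M → Prop, (Def fun e => D (fst e) (snd e)) ∧ (∀ n, ∃! b, D n b) ∧ D 0 a ∧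
      ∀ n b, D n b → D (n + 1) (g b) := by
  obtain ⟨D, hD, hrec⟩ := (iterateRecursion g a).exists_solution hRT
  have hrec' : ∀ n b, D (pair n b) ↔ (n = 0 ∧ b = a) ∨ ∃ q, n = fst q + 1 ∧ b = g (snd q) ∧ D q := by
    intro n b
    rw [hrec]
    simp [iterateRecursion, and_assoc]
  have hDef : ∀ f k : M → M, ∀ [DFun f] [DFun k], Def fun c => D (pair (f c) (k c)) :=
    fun f k => hD.comp inferInstance
  have hgs : DFun fun e : M => g (snd e) := hg.comp DFun.snd_base
  -- The recursive condition sees only the components, so a `q` that is not a pair may be replaced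
  -- by the pair of its junk components.
  have hpair : ∀ q, D q → q = pair (fst q) (snd q) ∨ D (pair (fst q) (snd q)) := by
    intro q hq
    right
    rw [hrec']
    rw [hrec] at hq
    simpa [iterateRecursion, and_assoc] using hq
  have hsucc : ∀ n b, D (pair (n + 1) b) ↔ ∃ c, b = g c ∧ D (pair n c) := by
    intro n b
    rw [hrec']
    constructor
    · rintro (h | ⟨q, h1, rfl, hq⟩)
      · exact (hM.rca.basic.succ_ne_zero n h.1).elim
      · rw [add_right_cancel h1]
        refine ⟨snd q, rfl, ?_⟩
        rcases hpair q hq with h | h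
        exacts [h ▸ hq, h]
    · rintro ⟨c, rfl, hc⟩
      exact .inr ⟨_, by simp, by simp, hc⟩
  have hzero : ∀ b, D (pair 0 b) ↔ b = a := by
    intro b
    rw [hrec']
    constructor
    · rintro (h | ⟨q, h1, -⟩)
      exacts [h.2, (hM.rca.basic.succ_ne_zero _ h1.symm).elim]
    · exact fun h => .inl ⟨rfl, h⟩
  refine ⟨fun n b => D (pair n b), hDef _ _, fun n => ?_, (hzero a).2 rfl, fun n b h =>
    (hsucc n _).2 ⟨b, rfl, h⟩⟩
  refine def_induction (P := fun n => ∃ b, D (pair n b) ∧ ∀ c, D (pair n c) → c = b)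
    (by infer_instance) ?_ ?_ n
  · exact ⟨a, (hzero a).2 rfl, fun c hc => (hzero c).1 hc⟩
  · rintro n ⟨b, hb, huniq⟩
    refine ⟨g b, (hsucc n _).2 ⟨b, rfl, hb⟩, fun c hc => ?_⟩
    obtain ⟨d, rfl, hd⟩ := (hsucc n c).1 hc
    rw [huniq d hd]

end Choice

/-! ### Minimal elements in well orders -/

section WellOrder

variable {X : Set M} [hX : InM X]

instance {f : M → M} [hf : DFun f] : Def (fun c => f c ∈ field X) :=
  Def.comp (P := fun i => i ∈ field X) (inferInstance : Def fun i => pair i i ∈ X) hf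

instance {f g : M → M} [hf : DFun f] [hg : DFun g] : Def (fun c => relLt X (f c) (g c)) :=
  Def.comp₂ (R := fun i j => relLt X i j) (by unfold relLt; infer_instance) hf hg

omit hM hX in
theorem IsLinOrd.relLt_trans (h : IsLinOrd X) {i j k : M} (h1 : relLt X i j) (h2 : relLt X j k) :
    relLt X i k :=
  ⟨h.trans i j k h1.1 h2.1, fun h3 => h1.2 (h.trans j k i h2.1 h3)⟩

omit hM hX in
theorem IsLinOrd.trichotomy (h : IsLinOrd X) {i j : M} (hi : i ∈ field X) (hj : j ∈ field X) :
    relLt X i j ∨ i = j ∨ relLt X j i := by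
  by_cases h1 : pair i j ∈ X <;> by_cases h2 : pair j i ∈ X
  · exact .inr (.inl (h.antisymm i j h1 h2))
  · exact .inl ⟨h1, h2⟩
  · exact .inr (.inr ⟨h2, h1⟩)
  · exact ((h.total i hi j hj).elim h1 h2).elim

/-- Nonempty definable sets have least elements with respect to well orders. -/
theorem IsWellOrd.exists_min (hRT : M.CofiniteDelta02RT) (h : IsWellOrd X) {P : M → Prop}
    (hP : Def P) (hne : ∃ a ∈ field X, P a) :
    ∃ a ∈ field X, P a ∧ ∀ b, P b → ¬ relLt X b a := by
  by_contra hno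
  push Not at hno
  obtain ⟨a, ha, hPa⟩ := hne
  have hP' : Def fun e : M => P (fst e) := hP.comp DFun.fst_base
  -- Without a minimal element, iterating a choice of smaller elements gives an infinite descending
  -- sequence in `M`.
  obtain ⟨g, hg, hg'⟩ := exists_choice (R := fun b a => P b ∧ relLt X b a) (by infer_instance)
  obtain ⟨D, hD, hfun, h0, hs⟩ := exists_iterate hRT g a
  have hDef : ∀ f k : M → M, ∀ [DFun f] [DFun k], Def fun c => D (f c) (k c) :=
    fun f k => hD.comp₂ ‹_› ‹_›
  have hall : ∀ n, ∀ b, D n b → b ∈ field X ∧ P b := by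
    refine def_induction (by
      have : Def fun e : M => P (fst e) := hP'
      infer_instance) ?_ ?_
    · intro b hb
      rw [(hfun 0).unique hb h0]
      exact ⟨ha, hPa⟩
    · intro n ih b hb
      obtain ⟨c, hc, -⟩ := hfun n
      obtain ⟨h1, h2⟩ := ih c hc
      obtain ⟨d, hd⟩ := hno c h1 h2
      have := hg' c ⟨d, hd⟩
      rw [(hfun (n + 1)).unique hb (hs n c hc)]
      exact ⟨(h.1.refl _ _ this.2.1).1, this.1⟩
  have hF : Def fun e : M => e = pair (fst e) (snd e) ∧ D (fst e) (snd e) := by infer_instance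
  refine h.2 ⟨_, hF.mem, ⟨fun p hp => ⟨_, trivial, _, (hall _ _ hp.2).1, hp.1⟩, fun n _ => ?_⟩, ?_⟩
  · simpa using hfun n
  · intro n b c hb hc
    have hb' : D n b := by simpa using hb.2
    have hc' : D (n + 1) c := by simpa using hc.2
    rw [(hfun (n + 1)).unique hc' (hs n b hb')]
    obtain ⟨h1, h2⟩ := hall n b hb'
    exact (hg' b (hno b h1 h2)).2

end WellOrder

/-! ### Normal forms of arithmetical conditions on a set -/

section NormalForm

/-- Literals: `A c`, or `h c ∈ Z` when `B c`, or `h c ∉ Z` when `C c`. -/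
def literal (A B C : M → Prop) (h : M → M) (c : M) (Z : Set M) : Prop :=
  A c ∨ (B c ∧ h c ∈ Z) ∨ (C c ∧ h c ∉ Z)

/-- The operation `Q ↦ ∃ x, ¬ Q (x, ·)`. -/
def exNot (Q : M → Set M → Prop) (c : M) (Z : Set M) : Prop := ∃ x, ¬ Q (pair x c) Z

/-- `Q` arises from a literal by `k` applications of `exNot`. -/
def IsNorm (k : ℕ) (Q : M → Set M → Prop) : Prop :=
  ∃ A B C : M → Prop, ∃ h : M → M, Def A ∧ Def B ∧ Def C ∧ DFun h ∧
    Q = exNot^[k] (literal A B C h)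

omit hM in
theorem IsNorm.exNot {k : ℕ} {Q : M → Set M → Prop} (hQ : IsNorm k Q) :
    IsNorm (k + 1) (exNot Q) := by
  obtain ⟨A, B, C, h, hA, hB, hC, hh, rfl⟩ := hQ
  exact ⟨A, B, C, h, hA, hB, hC, hh, (Function.iterate_succ_apply' _ _ _).symm⟩

omit hM in
theorem IsNorm.exists_of_succ {k : ℕ} {Q : M → Set M → Prop} (hQ : IsNorm (k + 1) Q) :
    ∃ Q', IsNorm k Q' ∧ Q = L2Structure.exNot Q' := by
  obtain ⟨A, B, C, h, hA, hB, hC, hh, rfl⟩ := hQ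
  exact ⟨_, ⟨A, B, C, h, hA, hB, hC, hh, rfl⟩, Function.iterate_succ_apply' _ _ _⟩

omit hM in
theorem IsNorm.of_iff {k : ℕ} {Q Q' : M → Set M → Prop} (hQ : IsNorm k Q)
    (h : ∀ c Z, Q' c Z ↔ Q c Z) : IsNorm k Q' := by
  have : Q' = Q := funext fun c => funext fun Z => propext (h c Z)
  rwa [this]

theorem IsNorm.comp {k : ℕ} {Q : M → Set M → Prop} (hQ : IsNorm k Q) (g : M → M) [hg : DFun g] :
    IsNorm k (fun c Z => Q (g c) Z) := by
  induction k generalizing Q g with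
  | zero =>
    obtain ⟨A, B, C, h, hA, hB, hC, hh, rfl⟩ := hQ
    exact ⟨_, _, _, _, hA.comp hg, hB.comp hg, hC.comp hg, hh.comp hg, rfl⟩
  | succ k ih =>
    obtain ⟨Q', hQ', rfl⟩ := hQ.exists_of_succ
    have : DFun fun p : M => g (snd p) := hg.comp DFun.snd_base
    refine (ih hQ' (fun p => pair (fst p) (g (snd p)))).exNot.of_iff fun c Z => ?_
    simp [L2Structure.exNot]

/-- A negation is `exNot` with a vacuous quantifier. -/
theorem IsNorm.not {k : ℕ} {Q : M → Set M → Prop} (hQ : IsNorm k Q) :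
    IsNorm (k + 1) (fun c Z => ¬ Q c Z) := by
  refine (hQ.comp snd).exNot.of_iff fun c Z => ?_
  have : Nonempty M := ⟨0⟩
  simp [L2Structure.exNot]

/-- A case distinction that does not involve `Z` passes through the prefix into the literals; it
serves to express disjunctions. -/
theorem IsNorm.cases {k : ℕ} {Q Q' : M → Set M → Prop} (hQ : IsNorm k Q) (hQ' : IsNorm k Q')
    (S : M → Prop) [hS : Def S] : IsNorm k (fun c Z => (S c ∧ Q c Z) ∨ (¬ S c ∧ Q' c Z)) := by
  induction k generalizing Q Q' S with
  | zero =>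
    obtain ⟨A, B, C, h, hA, hB, hC, hh, rfl⟩ := hQ
    obtain ⟨A', B', C', h', hA', hB', hC', hh', rfl⟩ := hQ'
    obtain ⟨g, hg, hg1, hg2⟩ := exists_dFun_ite (P := S) (f := h) (g := h')
    refine ⟨fun c => (S c ∧ A c) ∨ (¬ S c ∧ A' c), fun c => (S c ∧ B c) ∨ (¬ S c ∧ B' c),
      fun c => (S c ∧ C c) ∨ (¬ S c ∧ C' c), g, inferInstance, inferInstance, inferInstance, hg, ?_⟩
    funext c Z
    by_cases hc : S c
    · simp [literal, hc, hg1 c hc]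
    · simp [literal, hc, hg2 c hc]
  | succ k ih =>
    obtain ⟨R, hR, rfl⟩ := hQ.exists_of_succ
    obtain ⟨R', hR', rfl⟩ := hQ'.exists_of_succ
    have : Def fun p : M => S (snd p) := hS.comp DFun.snd_base
    refine (ih hR hR' (fun p => S (snd p))).exNot.of_iff fun c Z => ?_
    by_cases hc : S c <;> simp [L2Structure.exNot, hc]

/-- Literals are closed under negation, so a double negation lengthens the prefix at its inner end.
Padding brings two normal forms to a common length. -/
theorem IsNorm.succ {k : ℕ} {Q : M → Set M → Prop} (hQ : IsNorm k Q) : IsNorm (k + 1) Q := by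
  induction k generalizing Q with
  | zero =>
    have hn : IsNorm 0 (fun c Z => ¬ Q c Z) := by
      obtain ⟨A, B, C, h, hA, hB, hC, hh, rfl⟩ := hQ
      -- If `h c ∈ Z`, the literal fails when `A` and `B` fail; otherwise when `A` and `C` fail.
      refine ⟨fun _ => False, fun c => ¬ A c ∧ ¬ B c, fun c => ¬ A c ∧ ¬ C c, h, inferInstance,
        inferInstance, inferInstance, hh, ?_⟩
      funext c Z
      by_cases hz : h c ∈ Z <;> simp [literal, hz]
    exact hn.not.of_iff fun c Z => not_not.symm
  | succ k ih =>
    obtain ⟨R, hR, rfl⟩ := hQ.exists_of_succ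
    exact (ih hR).exNot

theorem IsNorm.mono {k l : ℕ} {Q : M → Set M → Prop} (hQ : IsNorm k Q) (hkl : k ≤ l) :
    IsNorm l Q := by
  induction l, hkl using Nat.le_induction with
  | base => exact hQ
  | succ l _ ih => exact ih.succ

/-- `Q` has a normal form. -/
def HasNorm (Q : M → Set M → Prop) : Prop := ∃ k, IsNorm k Q

theorem HasNorm.not {Q : M → Set M → Prop} (hQ : HasNorm Q) : HasNorm (fun c Z => ¬ Q c Z) :=
  let ⟨k, hk⟩ := hQ
  ⟨k + 1, hk.not⟩

omit hM in
theorem HasNorm.of_iff {Q Q' : M → Set M → Prop} (hQ : HasNorm Q) (h : ∀ c Z, Q' c Z ↔ Q c Z) :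
    HasNorm Q' :=
  let ⟨k, hk⟩ := hQ
  ⟨k, hk.of_iff h⟩

theorem HasNorm.ex {Q : M → Set M → Prop} (hQ : HasNorm Q) :
    HasNorm (fun c Z => ∃ x, Q (pair x c) Z) := by
  obtain ⟨k, hk⟩ := hQ
  refine ⟨k + 2, hk.not.exNot.of_iff fun c Z => ?_⟩
  simp [exNot]

theorem HasNorm.all {Q : M → Set M → Prop} (hQ : HasNorm Q) :
    HasNorm (fun c Z => ∀ x, Q (pair x c) Z) :=
  hQ.not.ex.not.of_iff fun c Z => by simp

/-- A quantified number selects the disjunct: `0` the first, any other number the second. -/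
theorem HasNorm.or {Q Q' : M → Set M → Prop} (hQ : HasNorm Q) (hQ' : HasNorm Q') :
    HasNorm (fun c Z => Q c Z ∨ Q' c Z) := by
  obtain ⟨k, hk⟩ := hQ
  obtain ⟨l, hl⟩ := hQ'
  have hc : HasNorm fun p Z => (fst p = 0 ∧ Q (snd p) Z) ∨ (¬ fst p = 0 ∧ Q' (snd p) Z) :=
    ⟨max k l, ((hk.mono (le_max_left k l)).comp snd).cases ((hl.mono (le_max_right k l)).comp snd)
      fun p => fst p = 0⟩
  refine hc.ex.of_iff fun c Z => ?_
  simp only [fst_pair, snd_pair]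
  constructor
  · rintro (h | h)
    exacts [⟨0, .inl ⟨rfl, h⟩⟩, ⟨1, .inr ⟨one_ne_zero, h⟩⟩]
  · rintro ⟨x, h | h⟩
    exacts [.inl h.2, .inr h.2]

theorem HasNorm.and {Q Q' : M → Set M → Prop} (hQ : HasNorm Q) (hQ' : HasNorm Q') :
    HasNorm (fun c Z => Q c Z ∧ Q' c Z) :=
  (hQ.not.or hQ'.not).not.of_iff fun c Z => by tauto

theorem HasNorm.of_def {P : M → Prop} (hP : Def P) : HasNorm (fun c _ => P c) := by
  refine ⟨0, P, fun _ => False, fun _ => False, fun c => c, hP, inferInstance, inferInstance,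
    inferInstance, ?_⟩
  funext c Z
  simp [literal]

theorem HasNorm.of_dFun {h : M → M} (hh : DFun h) : HasNorm (fun c Z => h c ∈ Z) := by
  refine ⟨0, fun _ => False, fun _ => True, fun _ => False, h, inferInstance, inferInstance,
    inferInstance, hh, ?_⟩
  funext c Z
  simp [literal]

/-- Arithmetical formulas have normal forms as conditions on their first set variable. -/
theorem HasNorm.sat {V : ℕ → Set M} (hV : ∀ i, V i ∈ M.sets) (φ : ArithFormula) (e : ℕ → M → M)
    (he : ∀ i, DFun (e i)) :
    HasNorm (fun c Z => M.Sat (consVal Z V) (fun i => e i c) φ) := by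
  have hx : ∀ (φ : ArithFormula), (∀ (e : ℕ → M → M), (∀ i, DFun (e i)) →
      HasNorm (fun c Z => M.Sat (consVal Z V) (fun i => e i c) φ)) → ∀ (e : ℕ → M → M),
      (∀ i, DFun (e i)) →
      HasNorm (fun p Z => M.Sat (consVal Z V) (consVal (fst p) (fun i => e i (snd p))) φ) := by
    intro φ ih e he
    refine (ih _ (dFun_consVal he)).of_iff fun p Z => ?_
    have : (fun i => consVal (α := M → M) (fun p => fst p) (fun i p => e i (snd p)) i p) =
        consVal (fst p) (fun i => e i (snd p)) := by
      funext i
      cases i <;> rfl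
    rw [this]
  have hlt : ∀ (t : L2Term) (e : ℕ → M → M), (∀ i, DFun (e i)) →
      HasNorm (fun p _ => fst p < M.termVal (fun i => e i (snd p)) t) := by
    intro t e he
    have : DFun fun p => M.termVal (fun i => e i (snd p)) t := (DFun.termVal he t).comp DFun.snd_base
    exact HasNorm.of_def (inferInstance : Def fun p => fst p < M.termVal (fun i => e i (snd p)) t)
  induction φ generalizing e with
  | eq s t =>
    have := DFun.termVal he s
    have := DFun.termVal he t
    exact HasNorm.of_def Def.eq
  | lt s t =>
    have := DFun.termVal he s
    have := DFun.termVal he t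
    exact HasNorm.of_def Def.lt
  | mem t i =>
    have := DFun.termVal he t
    cases i with
    | zero => exact HasNorm.of_dFun this
    | succ i =>
      have : InM (V i) := ⟨hV i⟩
      exact HasNorm.of_def (Def.mem' (S := V i))
  | neg φ ih => exact (ih e he).not
  | and φ ψ ih ih' => exact (ih e he).and (ih' e he)
  | or φ ψ ih ih' => exact (ih e he).or (ih' e he)
  | ball t φ ih =>
    refine ((hlt t e he).not.or (hx φ ih e he)).all.of_iff fun c Z => ?_
    simp [Sat, imp_iff_not_or]
  | bex t φ ih =>
    refine ((hlt t e he).and (hx φ ih e he)).ex.of_iff fun c Z => ?_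
    simp [Sat]
  | all φ ih =>
    refine (hx φ ih e he).all.of_iff fun c Z => ?_
    simp [Sat]
  | ex φ ih =>
    refine (hx φ ih e he).ex.of_iff fun c Z => ?_
    simp [Sat]

end NormalForm

end L2Structure

namespace L2Structure

variable {M : L2Structure.{u}} [hM : IsACA M]

/-! ### The hierarchy along a well order -/

section TransfiniteRecursion

/-- `m` is a pair `(a, i)` with `i <_X j`. -/
def IsBelow (X : Set M) (m j : M) : Prop := m = pair (fst m) (snd m) ∧ relLt X (snd m) j

theorem mem_below_iff {X Y : Set M} {m j : M} : m ∈ below X Y j ↔ IsBelow X m j ∧ m ∈ Y := by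
  constructor
  · rintro ⟨a, i, rfl, h1, h2⟩
    exact ⟨by simpa [IsBelow] using h1, h2⟩
  · rintro ⟨⟨h1, h2⟩, h3⟩
    exact ⟨_, _, h1, h2, h3⟩

/-- Lexicographic comparison of positions `(j, (k, c))` by `j` and `k`, with the numbers that are not
positions at the bottom. -/
def PosLt (X : Set M) (q p : M) : Prop :=
  fst p ∈ field X ∧ (¬ fst q ∈ field X ∨ relLt X (fst q) (fst p) ∨
    (fst q = fst p ∧ fst (snd q) < fst (snd p)))

instance {X : Set M} [InM X] {f g : M → M} [hf : DFun f] [hg : DFun g] :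
    Def (fun c => IsBelow X (f c) (g c)) :=
  Def.comp₂ (R := IsBelow X) (by unfold IsBelow; infer_instance) hf hg

instance {X : Set M} [InM X] {f g : M → M} [hf : DFun f] [hg : DFun g] :
    Def (fun c => PosLt X (f c) (g c)) :=
  Def.comp₂ (R := PosLt X) (by unfold PosLt; infer_instance) hf hg

omit hM in
theorem PosLt.or [IsRCA M] {X : Set M} (hX : IsLinOrd X) {q r : M} (h : PosLt X q r) (p : M) :
    PosLt X q p ∨ PosLt X p r := by
  obtain ⟨hr, h⟩ := h
  by_cases hp : fst p ∈ field X
  · rcases h with h | h | ⟨h, h'⟩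
    · exact .inl ⟨hp, .inl h⟩
    · rcases hX.trichotomy hp hr with h1 | h1 | h1
      · exact .inr ⟨hr, .inr (.inl h1)⟩
      · exact .inl ⟨hp, .inr (.inl (h1 ▸ h))⟩
      · exact .inl ⟨hp, .inr (.inl (hX.relLt_trans h h1))⟩
    · rcases hX.trichotomy hp hr with h1 | h1 | h1
      · exact .inr ⟨hr, .inr (.inl h1)⟩
      · rcases lt_or_ge (fst (snd q)) (fst (snd p)) with h2 | h2
        · exact .inl ⟨hp, .inr (.inr ⟨h.trans h1.symm, h2⟩)⟩
        · exact .inr ⟨hr, .inr (.inr ⟨h1, h2.trans_lt h'⟩)⟩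
      · exact .inl ⟨hp, .inr (.inl (h ▸ h1))⟩
  · exact .inr ⟨hr, .inl hp⟩

/-- A number that is not a position is minimal at once; otherwise `j` is minimized along `X`, then
`k` numerically. -/
theorem exists_minimal_posLt {X : Set M} [InM X] (hRT : M.CofiniteDelta02RT) (hX : IsWellOrd X)
    {P : M → Prop} (hP : Def P) (hne : ∃ p, P p) : ∃ p, P p ∧ ∀ q, P q → ¬ PosLt X q p := by
  by_cases hpos : ∃ p, P p ∧ ¬ fst p ∈ field X
  · obtain ⟨p, hp, hpX⟩ := hpos
    exact ⟨p, hp, fun q _ h => hpX h.1⟩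
  push Not at hpos
  have hP' : Def fun e : M => P (fst e) := hP.comp DFun.fst_base
  obtain ⟨p₀, hp₀⟩ := hne
  obtain ⟨j, hj, ⟨p₁, hp₁, hpj⟩, hjmin⟩ := hX.exists_min (P := fun j => ∃ p, P p ∧ fst p = j) hRT
    (by infer_instance) ⟨_, hpos _ hp₀, p₀, hp₀, rfl⟩
  obtain ⟨k, ⟨p, hp, hpj', hpk⟩, hkmin⟩ :=
    exists_least (P := fun k => ∃ p, P p ∧ fst p = j ∧ fst (snd p) = k) (by infer_instance)
      ⟨_, p₁, hp₁, hpj, rfl⟩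
  refine ⟨p, hp, fun q hq h => ?_⟩
  rcases h.2 with h1 | h1 | ⟨h1, h2⟩
  · exact h1 (hpos q hq)
  · exact hjmin _ ⟨q, hq, rfl⟩ (hpj' ▸ h1)
  · exact hkmin _ (hpk ▸ h2) ⟨q, hq, h1.trans hpj', rfl⟩

/-- The recursive condition for the predicate that holds at `(j, (k, c))` if `exNot^[k]` of the given
literal holds of `c` at stage `j` of the hierarchy along `X` with successor step
`exNot^[K]` of this literal. -/
def hierarchyRecursion (hRT : M.CofiniteDelta02RT) (X : Set M) [InM X] (hX : IsWellOrd X)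
    (A B C : M → Prop) [hA : Def A] [hB : Def B] [hC : Def C] (h : M → M) [hh : DFun h] (K : M) :
    Recursion M where
  -- A condition `h c ∉ Z` holds outright when `h c` is no pair `(a, i)` with `i <_X j`.
  base p := fst p ∈ field X ∧ fst (snd p) = 0 ∧ (A (snd (snd p)) ∨
    (C (snd (snd p)) ∧ ¬ IsBelow X (h (snd (snd p))) (fst p)))
  -- Membership of `h c = (a, i)` in the hierarchy is the value at position `(i, (K, a))`, the full
  -- step at stage `i`.
  pos q p := fst p ∈ field X ∧ fst (snd p) = 0 ∧ B (snd (snd p)) ∧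
    IsBelow X (h (snd (snd p))) (fst p) ∧
    q = pair (snd (h (snd (snd p)))) (pair K (fst (h (snd (snd p)))))
  neg q p := fst p ∈ field X ∧ ((fst (snd p) = 0 ∧ C (snd (snd p)) ∧
    IsBelow X (h (snd (snd p))) (fst p) ∧
    q = pair (snd (h (snd (snd p)))) (pair K (fst (h (snd (snd p)))))) ∨
    -- One application of `exNot`: some instance one level lower is false.
    ∃ k x, fst (snd p) = k + 1 ∧ q = pair (fst p) (pair k (pair x (snd (snd p)))))
  prec := PosLt X
  def_base := by
    have : DFun fun p : M => h (snd (snd p)) := hh.comp (by infer_instance)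
    have : Def fun p : M => A (snd (snd p)) := hA.comp (by infer_instance)
    have : Def fun p : M => C (snd (snd p)) := hC.comp (by infer_instance)
    infer_instance
  def_pos := by
    have : DFun fun p : M => h (snd (snd (snd p))) := hh.comp (by infer_instance)
    have : Def fun p : M => B (snd (snd (snd p))) := hB.comp (by infer_instance)
    infer_instance
  def_neg := by
    have : DFun fun p : M => h (snd (snd (snd p))) := hh.comp (by infer_instance)
    have : Def fun p : M => C (snd (snd (snd p))) := hC.comp (by infer_instance)
    infer_instance
  def_prec := inferInstance
  prec_of_pos q p := by
    rintro ⟨hp, -, -, hb, rfl⟩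
    exact ⟨hp, .inr (.inl (by simpa using hb.2))⟩
  prec_of_neg q p := by
    rintro ⟨hp, ⟨-, -, hb, rfl⟩ | ⟨k, x, hk, rfl⟩⟩
    · exact ⟨hp, .inr (.inl (by simpa using hb.2))⟩
    · exact ⟨hp, .inr (.inr ⟨by simp, by simp [hk]⟩)⟩
  prec_or _ p _ hqr := hqr.or hX.1 p
  wf _ hP hne := exists_minimal_posLt hRT hX hP hne

/-- Transfinite recursion with the step in normal form. -/
theorem IsNorm.exists_hierarchy (hRT : M.CofiniteDelta02RT) {X : Set M} [hXM : InM X]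
    (hX : IsWellOrd X) {K : ℕ} {Q : M → Set M → Prop} (hQ : IsNorm K Q) :
    ∃ Y ∈ M.sets, ∀ p, p ∈ Y ↔ ∃ n j, p = pair n j ∧ j ∈ field X ∧ Q n (below X Y j) := by
  obtain ⟨A, B, C, h, hA, hB, hC, hh, rfl⟩ := hQ
  obtain ⟨D, hD, hrec⟩ := (hierarchyRecursion hRT X hX A B C h (K : M)).exists_solution hRT
  have hDef : Def fun e : M => e = pair (fst e) (snd e) ∧ snd e ∈ field X ∧
      D (pair (snd e) (pair (K : M) (fst e))) := by
    have : Def fun e : M => D (pair (snd e) (pair (K : M) (fst e))) := hD.comp (by infer_instance)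
    infer_instance
  generalize hY : {e : M | e = pair (fst e) (snd e) ∧ snd e ∈ field X ∧
    D (pair (snd e) (pair (K : M) (fst e)))} = Y
  have hYmem : ∀ e, e ∈ Y ↔ e = pair (fst e) (snd e) ∧ snd e ∈ field X ∧
      D (pair (snd e) (pair (K : M) (fst e))) := fun e => by rw [← hY]; rfl
  -- As `K` is standard, external induction on the level suffices. Earlier stages enter through `D`
  -- itself, so no induction along `X` is needed.
  have hval : ∀ k : ℕ, ∀ j ∈ field X, ∀ c, D (pair j (pair (k : M) c)) ↔
      L2Structure.exNot^[k] (literal A B C h) c (below X Y j) := by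
    intro k j hj
    induction k with
    | zero =>
      intro c
      have hlit : h c ∈ below X Y j ↔ IsBelow X (h c) j ∧
          D (pair (snd (h c)) (pair (K : M) (fst (h c)))) := by
        rw [mem_below_iff, hYmem]
        exact and_congr_right fun hb => by simp [← hb.1, (hX.1.refl _ _ hb.2.1).1]
      have h0 : ∀ k : M, (0 : M) ≠ k + 1 := fun k => (hM.rca.basic.succ_ne_zero k).symm
      rw [hrec, Function.iterate_zero, id, literal, hlit]
      by_cases hb : IsBelow X (h c) j
      · simp [hierarchyRecursion, hj, hb, h0]
        simp [exists_or, and_right_comm]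
      · simp [hierarchyRecursion, hj, hb, h0]
    | succ k ih =>
      intro c
      rw [hrec, Function.iterate_succ_apply', L2Structure.exNot]
      simp only [← ih]
      simp [hierarchyRecursion, hj]
  refine ⟨Y, hY ▸ hDef.mem, fun p => ?_⟩
  rw [hYmem]
  constructor
  · rintro ⟨h1, h2, h3⟩
    exact ⟨_, _, h1, h2, (hval K _ h2 _).1 h3⟩
  · rintro ⟨n, j, rfl, h2, h3⟩
    exact ⟨by simp, by simpa using h2, by simpa using (hval K _ h2 _).2 h3⟩

theorem arithTransfiniteRecursion (hRT : M.CofiniteDelta02RT) : M.ArithTransfiniteRecursion := by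
  intro θ V hV v X hXM hX
  have : InM X := ⟨hXM⟩
  obtain ⟨K, hK⟩ := HasNorm.sat hV θ (consVal (α := M → M) (fun c => c) (fun i _ => v i)) (by
    intro i
    cases i with
    | zero => exact DFun.id
    | succ i => exact DFun.const (v i))
  obtain ⟨Y, hY, hY'⟩ := hK.exists_hierarchy hRT hX
  refine ⟨Y, hY, fun p => ?_⟩
  have hv : ∀ n, (fun i => consVal (α := M → M) (fun c => c) (fun i _ => v i) i n) = consVal n v := by
    intro n
    funext i
    cases i <;> rfl
  simpa only [hv] using hY' p

end TransfiniteRecursion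

end L2Structure

/-- Over `RCA₀`, the cofinite `Δ⁰₂`-Ramsey theorem entails arithmetical transfinite recursion:
every model of `RCA₀` in which the former holds is a model of `ATR₀`. -/
theorem proposition3p5 (M : L2Structure.{u}) (hRCA : M.RCA0) (hRT : M.CofiniteDelta02RT) :
    M.ATR0 := by
  have : L2Structure.IsRCA M := ⟨hRCA⟩
  have : L2Structure.IsACA M := L2Structure.isACA hRT
  exact ⟨L2Structure.aca0, L2Structure.arithTransfiniteRecursion hRT⟩
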